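/- Let $M$ be a smooth 3-manifold with a strictly pseudoconvex CR structure $(H,J)$. A distinguished coframe $(\mu,\bar\mu,\lambda)$ is the dual of a frame $(\partial,\bar\partial,\partial_0)$ with $\partial=X-\mathrm iJX$ and $\partial_0=\mathrm i[\partial,\bar\partial]$, for a non-vanishing smooth section $X$ of $H$; its structure function $c$ is given by $d\lambda=\mathrm i\mu\wedge\bar\mu+c\,\mu\wedge\lambda+\bar c\,\bar\mu\wedge\lambda$. Assume that $\mu=d\zeta$ for a smooth CR function $\zeta$ (that is, $\bar\partial\zeta=0$). Let $U\subseteq M\times\mathbb R$ be an open set whose intersection with each fibre $\{p\}\times\mathbb R$ is a non-empty interval, let $r$ be the coordinate on $\mathbb R$, let $P\neq0$ and $\mathsf H$ be smooth real functions on $U$ and $x$ a smooth complex function on $M$, and consider on $U$ the quasi-Fefferman metric $$g=2P^2\big[\mu\bar\mu+\lambda(dr+W\mu+\overline W\bar\mu+\mathsf H\lambda)\big],\qquad W=\mathrm i x\mathrm e^{-\mathrm i r}-\tfrac{\mathrm i}{3}c .$$ An adapted frame is a complex frame $(e_1,e_2=\bar e_1,e_3=\bar e_3,e_4)$ on $U$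 with $e_4$ a nowhere vanishing real multiple of $\partial_r$, $g(e_1,e_2)=g(e_3,e_4)=1$, and $g(e_i,e_j)=0$ for all other pairs $i\le j$. The frame $$e_1=\tfrac1P(\partial-W\partial_r),\quad e_2=\tfrac1P(\bar\partial-\overline W\partial_r),\quad e_3=\tfrac1P(\partial_0-\mathsf H\partial_r),\quad e_4=\tfrac1P\partial_r$$ is adapted. For every adapted frame, the components $R_{ij}=\mathrm{Ric}(e_i,e_j)$ of the Ricci tensor of $g$ satisfy: (i) $R_{44}=0$ on $U$ if and only if there are smooth real functions $a,s$ on $M$ (that is, independent of $r$) with $$P=\frac{a}{\cos(\frac{r+s}{2})}\quad\text{on }U .$$ (ii) If $P$ has this form, then $R_{24}=0$ on $U$ if and only if $$\partial\log a^2+\mathrm i\,\partial s-2x\mathrm e^{\mathrm i s}=-\frac{2c}{3}\quad\text{on }M .$$ (iii) If $P$ has this form and $R_{24}=0$ on $U$, then $R_{22}=0$ on $U$ if and only if $$\partial t+t(c-t)=0\quad\text{on }M,\qquad\text{where } t=c+\partial\log a^2-x\mathrm e^{\mathrm i s}.$$ Finally, let $(\mu',\lambda')$ be another distinguished coframe,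 with $\partial'=\mathrm e^{-\tau-\mathrm i\theta}\partial$ for smooth real functions $\tau,\theta$ on $M$, and put $h=-\mathrm i\bar\partial(\tau+\mathrm i\theta)$. Suppose that, after the change of fibre coordinate $r'=r-\frac23\theta$, the metric $g$ is the quasi-Fefferman metric of $(\mu',\lambda')$ with parameters $P',\mathsf H',x'$, and that $P=a/\cos(\frac{r+s}2)$ and $P'=a'/\cos(\frac{r'+s'}2)$ with smooth real functions $a,s,a',s'$ on $M$. Then $t'=c'+\partial'\log a'^2-x'\mathrm e^{\mathrm i s'}$ satisfies $$t'=\mathrm e^{-\tau-\mathrm i\theta}(t-\mathrm i\bar h).$$ -/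

import Mathlib

open scoped Manifold ContDiff TensorProduct
open VectorField

/-! ## Complexified tangent vectors -/

/-- Complex conjugation on the complexification `ℂ ⊗ V` of a real vector space. -/
noncomputable def conjTensor (V : Type*) [AddCommGroup V] [Module ℝ V] :
    (ℂ ⊗[ℝ] V) →ₗ[ℝ] (ℂ ⊗[ℝ] V) :=
  LinearMap.rTensor V Complex.conjAe.toLinearMap

section Differential

variable {E H N F : Type*} [NormedAddCommGroup E] [NormedSpace ℝ E] [TopologicalSpace H]
  (I : ModelWithCorners ℝ E H) [TopologicalSpace N] [ChartedSpace H N]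
  [NormedAddCommGroup F] [NormedSpace ℝ F]

/-- The real differential `df_p` of a vector-valued function, as a linear map. -/
noncomputable def differential (f : N → F) (p : N) : TangentSpace I p →ₗ[ℝ] F :=
  (mfderiv I 𝓘(ℝ, F) f p).toLinearMap

/-- A complex tangent vector `v` acting on a complex-valued function: the complex linear extension
of the real differential `df_p`. -/
noncomputable def cderiv (f : N → ℂ) (p : N) (v : ℂ ⊗[ℝ] TangentSpace I p) : ℂ :=
  LinearMap.liftBaseChange ℂ (differential I f p) v

end Differential

/-! ## Ricci curvature of a metric, in charts -/

section Ricci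

variable {E : Type*} [NormedAddCommGroup E] [NormedSpace ℝ E] [FiniteDimensional ℝ E]

/-- Christoffel symbols `Γ^k_{ij}` of the matrix-valued function `G` (the components of a metric),
with respect to the linear coordinates of the fixed basis `Module.finBasis ℝ E`. -/
noncomputable def christoffel
    (G : E → Matrix (Fin (Module.finrank ℝ E)) (Fin (Module.finrank ℝ E)) ℝ)
    (k i j : Fin (Module.finrank ℝ E)) (y : E) : ℝ :=
  let b := Module.finBasis ℝ E
  (1 / 2) * ∑ l, (G y)⁻¹ k l *
    (fderiv ℝ (fun z => G z l j) y (b i) + fderiv ℝ (fun z => G z l i) y (b j)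
      - fderiv ℝ (fun z => G z i j) y (b l))

/-- Components `R_{ij} = R^k_{ikj}` of the Ricci tensor in linear coordinates. -/
noncomputable def ricciCoord
    (G : E → Matrix (Fin (Module.finrank ℝ E)) (Fin (Module.finrank ℝ E)) ℝ) (y : E) :
    Matrix (Fin (Module.finrank ℝ E)) (Fin (Module.finrank ℝ E)) ℝ :=
  Matrix.of fun i j =>
    let b := Module.finBasis ℝ E
    ∑ k, (fderiv ℝ (christoffel G k i j) y (b k) - fderiv ℝ (christoffel G k i k) y (b j)
      + ∑ l, (christoffel G k k l y * christoffel G l i j y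
        - christoffel G k j l y * christoffel G l i k y))

variable {H : Type*} [TopologicalSpace H] (I : ModelWithCorners ℝ E H)
  {N : Type*} [TopologicalSpace N] [ChartedSpace H N]

/-- Components at `y` of the metric `g` in the preferred chart at `q₀`. -/
noncomputable def metricInChart (g : ∀ q : N, LinearMap.BilinForm ℝ (TangentSpace I q))
    (q₀ : N) (y : E) : Matrix (Fin (Module.finrank ℝ E)) (Fin (Module.finrank ℝ E)) ℝ :=
  Matrix.of fun i j =>
    g ((extChartAt I q₀).symm y)
      (mfderiv 𝓘(ℝ, E) I (extChartAt I q₀).symm y (Module.finBasis ℝ E i))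
      (mfderiv 𝓘(ℝ, E) I (extChartAt I q₀).symm y (Module.finBasis ℝ E j))

/-- The Ricci tensor at `q` of a pseudo-Riemannian metric `g` (for the Levi-Civita connection),
computed in the preferred chart at `q`. -/
noncomputable def ricciTensor (g : ∀ q : N, LinearMap.BilinForm ℝ (TangentSpace I q)) (q : N) :
    LinearMap.BilinForm ℝ (TangentSpace I q) :=
  (Matrix.toBilin (Module.finBasis ℝ E)
      (ricciCoord (metricInChart I g q) (extChartAt I q q))).compl₁₂
    (mfderiv I 𝓘(ℝ, E) (extChartAt I q) q).toLinearMap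
    (mfderiv I 𝓘(ℝ, E) (extChartAt I q) q).toLinearMap

/-- The complexified Ricci tensor. -/
noncomputable def ricciC (g : ∀ q : N, LinearMap.BilinForm ℝ (TangentSpace I q)) (q : N) :
    LinearMap.BilinForm ℂ (ℂ ⊗[ℝ] TangentSpace I q) :=
  LinearMap.BilinForm.baseChange ℂ (ricciTensor I g q)

end Ricci

/-- `(e₁, e₂, e₃, e₄) = (e 0, e 1, e 2, e 3)` is a complex frame adapted to the Lorentzian scalar
product `g` and the null vector `k`: `e₂` is conjugate to `e₁`, `e₃` is real, `e₄ = k`, and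
`g = 2 (θ¹ θ² + θ³ θ⁴)` in the dual coframe. (As `e₁` is orthogonal to `k` and null, it lies in an
`α`-plane for one of the two orientations of the screen space.) -/
def IsAdaptedFrame {V : Type*} [AddCommGroup V] [Module ℝ V] (g : LinearMap.BilinForm ℝ V) (k : V)
    (e : Fin 4 → ℂ ⊗[ℝ] V) : Prop :=
  e 3 = (1 : ℂ) ⊗ₜ[ℝ] k ∧ e 1 = conjTensor V (e 0) ∧ conjTensor V (e 2) = e 2 ∧
    ∀ i j, LinearMap.BilinForm.baseChange ℂ g (e i) (e j) =
      (!![0, 1, 0, 0; 1, 0, 0, 0; 0, 0, 0, 1; 0, 0, 1, 0] : Matrix (Fin 4) (Fin 4) ℂ) i j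

/-! ## Strictly pseudoconvex CR structures on 3-manifolds -/

section CR

variable {M : Type*} [TopologicalSpace M] [ChartedSpace (EuclideanSpace ℝ (Fin 3)) M]

/-- On `V`, `X` is a smooth non-vanishing section of `H`, and `Y = J X` is smooth. -/
def IsFramePair [IsManifold (𝓡 3) ∞ M]
    (H : ∀ p : M, Submodule ℝ (TangentSpace (𝓡 3) p)) (J : ∀ p : M, H p →ₗ[ℝ] H p)
    (V : Set M) (X Y : ∀ p : M, TangentSpace (𝓡 3) p) : Prop :=
  ContMDiffOn (𝓡 3) (𝓡 3).tangent ∞ (fun p => (⟨p, X p⟩ : TangentBundle (𝓡 3) M)) V ∧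
  ContMDiffOn (𝓡 3) (𝓡 3).tangent ∞ (fun p => (⟨p, Y p⟩ : TangentBundle (𝓡 3) M)) V ∧
  ∀ p ∈ V, X p ≠ 0 ∧ ∃ h : X p ∈ H p, ((J p ⟨X p, h⟩ : H p) : TangentSpace (𝓡 3) p) = Y p

variable (M) in
/-- A strictly pseudoconvex CR structure `(H, J)` on a 3-manifold `M`: a smooth plane field `H` with
a smooth field `J` of complex structures on it, such that `[X, JX]` is nowhere in `H` for every
local non-vanishing section `X` of `H`. -/
structure CRStructure [IsManifold (𝓡 3) ∞ M] where
  H : ∀ p : M, Submodule ℝ (TangentSpace (𝓡 3) p)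
  finrank_H : ∀ p, Module.finrank ℝ (H p) = 2
  J : ∀ p : M, H p →ₗ[ℝ] H p
  J_sq : ∀ p v, J p (J p v) = -v
  exists_frame : ∀ p : M, ∃ V : Set M, IsOpen V ∧ p ∈ V ∧ ∃ X Y, IsFramePair H J V X Y
  pseudoconvex : ∀ (V : Set M) (X Y : ∀ p : M, TangentSpace (𝓡 3) p), IsOpen V →
    IsFramePair H J V X Y → ∀ p ∈ V, mlieBracket (𝓡 3) X Y p ∉ H p

/-- A distinguished coframe `(μ, μ̄, λ)` of a CR structure: the dual of a frame `(∂, ∂̄, ∂₀)` with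
`∂ = X - i JX` and `∂₀ = i [∂, ∂̄] = -2 [X, JX]`, for a non-vanishing section `X` of `H`. Here
`Y = JX`, and duality is expressed on the real basis `X, JX, ∂₀`. -/
structure DistinguishedCoframe [IsManifold (𝓡 3) ∞ M] (C : CRStructure M) where
  X : ∀ p : M, TangentSpace (𝓡 3) p
  Y : ∀ p : M, TangentSpace (𝓡 3) p
  frame : IsFramePair C.H C.J Set.univ X Y
  mu : ∀ p : M, TangentSpace (𝓡 3) p →ₗ[ℝ] ℂ
  lam : ∀ p : M, TangentSpace (𝓡 3) p →ₗ[ℝ] ℝ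
  mu_X : ∀ p, mu p (X p) = 1 / 2
  mu_Y : ∀ p, mu p (Y p) = Complex.I / 2
  mu_T : ∀ p, mu p ((-2 : ℝ) • mlieBracket (𝓡 3) X Y p) = 0
  lam_X : ∀ p, lam p (X p) = 0
  lam_Y : ∀ p, lam p (Y p) = 0
  lam_T : ∀ p, lam p ((-2 : ℝ) • mlieBracket (𝓡 3) X Y p) = 1

namespace DistinguishedCoframe

variable [IsManifold (𝓡 3) ∞ M] {C : CRStructure M} (η : DistinguishedCoframe C)

/-- `∂ = X - i JX`. -/
noncomputable def del (p : M) : ℂ ⊗[ℝ] TangentSpace (𝓡 3) p :=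
  (1 : ℂ) ⊗ₜ[ℝ] η.X p - Complex.I ⊗ₜ[ℝ] η.Y p

/-- `∂̄ = X + i JX`. -/
noncomputable def delbar (p : M) : ℂ ⊗[ℝ] TangentSpace (𝓡 3) p :=
  (1 : ℂ) ⊗ₜ[ℝ] η.X p + Complex.I ⊗ₜ[ℝ] η.Y p

/-- The real vector field `∂₀ = i [∂, ∂̄] = -2 [X, JX]`. -/
noncomputable def del0 (p : M) : TangentSpace (𝓡 3) p :=
  (-2 : ℝ) • mlieBracket (𝓡 3) η.X η.Y p

/-- The structure function `c` of `dλ = i μ ∧ μ̄ + c μ ∧ λ + c̄ μ̄ ∧ λ`, that is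
`c = dλ(∂, ∂₀) = -λ([∂, ∂₀])` with `[∂, ∂₀] = [X, ∂₀] - i [JX, ∂₀]`. -/
noncomputable def c (p : M) : ℂ :=
  -((η.lam p (mlieBracket (𝓡 3) η.X η.del0 p) : ℂ)
    - Complex.I * (η.lam p (mlieBracket (𝓡 3) η.Y η.del0 p) : ℂ))

/-- `∂ f` for a complex-valued function `f` on `M`. -/
noncomputable def d (f : M → ℂ) (p : M) : ℂ := cderiv (𝓡 3) f p (η.del p)

/-- `∂̄ f` for a complex-valued function `f` on `M`. -/
noncomputable def dbar (f : M → ℂ) (p : M) : ℂ := cderiv (𝓡 3) f p (η.delbar p)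

/-- `h = -i ∂̄ (τ + i θ)`. -/
noncomputable def h (τ θ : M → ℝ) (p : M) : ℂ :=
  -Complex.I * η.dbar (fun p' => (τ p' : ℂ) + Complex.I * θ p') p

/-- `t = c + ∂ log a² - x e^{is}`. -/
noncomputable def t (x : M → ℂ) (a s : M → ℝ) (p : M) : ℂ :=
  η.c p + η.d (fun p' => ((Real.log (a p' ^ 2) : ℝ) : ℂ)) p
    - x p * Complex.exp (Complex.I * s p)

end DistinguishedCoframe

/-! ## Quasi-Fefferman metrics

In the trivialisation induced by a distinguished coframe, the circle bundle (with the coordinate `r`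
taken modulo `2π`) is covered by the line bundle `M × ℝ`; the metric is considered on a subset `U` of
the latter. -/

/-- The model with corners of the line bundle `M × ℝ`. -/
noncomputable abbrev lineModel :
    ModelWithCorners ℝ (EuclideanSpace ℝ (Fin 3) × ℝ) (ModelProd (EuclideanSpace ℝ (Fin 3)) ℝ) :=
  (𝓡 3).prod 𝓘(ℝ, ℝ)

/-- The vertical vector field `∂_r` on `M × ℝ`. -/
noncomputable def vertical (q : M × ℝ) : TangentSpace (lineModel) q :=
  mfderiv 𝓘(ℝ, ℝ) lineModel (fun r : ℝ => (q.1, r)) q.2 (1 : ℝ)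

/-- The horizontal lift to `M × ℝ`, in the trivialisation, of a tangent vector of `M`. -/
noncomputable def horizontal (q : M × ℝ) :
    TangentSpace (𝓡 3) q.1 →ₗ[ℝ] TangentSpace (lineModel) q :=
  (mfderiv (𝓡 3) lineModel (fun p : M => (p, q.2)) q.1).toLinearMap

/-- The functional parameters of a quasi-Fefferman metric over `U ⊆ M × ℝ`. -/
structure QuasiFefferman [IsManifold (𝓡 3) ∞ M] {C : CRStructure M} (η : DistinguishedCoframe C)
    (U : Set (M × ℝ)) where
  P : M × ℝ → ℝ
  H : M × ℝ → ℝ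
  x : M → ℂ
  smooth_P : ContMDiffOn lineModel 𝓘(ℝ, ℝ) ∞ P U
  smooth_H : ContMDiffOn lineModel 𝓘(ℝ, ℝ) ∞ H U
  smooth_x : ContMDiff (𝓡 3) 𝓘(ℝ, ℂ) ∞ x
  P_ne_zero : ∀ q ∈ U, P q ≠ 0

namespace QuasiFefferman

variable [IsManifold (𝓡 3) ∞ M] {C : CRStructure M} {η : DistinguishedCoframe C}
  {U : Set (M × ℝ)} (D : QuasiFefferman η U)

/-- `W = i x e^{-ir} - (i/3) c`. -/
noncomputable def W (q : M × ℝ) : ℂ :=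
  Complex.I * D.x q.1 * Complex.exp (-(Complex.I * q.2)) - Complex.I / 3 * η.c q.1

/-- The pull-back of `μ` to `M × ℝ`. -/
noncomputable def mu (_D : QuasiFefferman η U) (q : M × ℝ) :
    TangentSpace (lineModel) q →ₗ[ℝ] ℂ :=
  η.mu q.1 ∘ₗ (mfderiv lineModel (𝓡 3) (Prod.fst : M × ℝ → M) q).toLinearMap

/-- The pull-back of `λ` to `M × ℝ`. -/
noncomputable def lam (_D : QuasiFefferman η U) (q : M × ℝ) :
    TangentSpace (lineModel) q →ₗ[ℝ] ℝ :=
  η.lam q.1 ∘ₗ (mfderiv lineModel (𝓡 3) (Prod.fst : M × ℝ → M) q).toLinearMap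

/-- The real 1-form `dr + W μ + W̄ μ̄ + H λ` on `M × ℝ`. -/
noncomputable def kappa (q : M × ℝ) : TangentSpace (lineModel) q →ₗ[ℝ] ℝ :=
  differential lineModel (Prod.snd : M × ℝ → ℝ) q
    + (2 : ℝ) • (Complex.reLm ∘ₗ (LinearMap.mulLeft ℝ (D.W q) ∘ₗ D.mu q)) + D.H q • D.lam q

/-- The quasi-Fefferman metric `g = 2 P² [μ μ̄ + λ (dr + W μ + W̄ μ̄ + H λ)]`, where the product of
1-forms is the symmetric product `φ ψ = (φ ⊗ ψ + ψ ⊗ φ) / 2`. -/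
noncomputable def metric (q : M × ℝ) : LinearMap.BilinForm ℝ (TangentSpace (lineModel) q) :=
  LinearMap.mk₂ ℝ
    (fun v w => 2 * D.P q ^ 2 *
      ((D.mu q v * (starRingEnd ℂ) (D.mu q w)).re
        + (D.lam q v * D.kappa q w + D.kappa q v * D.lam q w) / 2))
    (by intro v v' w; simp only [map_add, add_mul, Complex.add_re]; ring)
    (by
      intro a v w
      simp only [map_smul, smul_eq_mul, smul_mul_assoc, Complex.smul_re]; ring)
    (by intro v w w'; simp only [map_add, mul_add, Complex.add_re]; ring)
    (by
      intro a v w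
      simp only [map_smul, smul_eq_mul, Complex.real_smul, map_mul, Complex.conj_ofReal,
        mul_left_comm _ (a : ℂ), Complex.re_ofReal_mul]; ring)

/-- The frame `e₁ = P⁻¹ (∂ - W ∂_r)`, `e₂ = P⁻¹ (∂̄ - W̄ ∂_r)`, `e₃ = P⁻¹ (∂₀ - H ∂_r)`,
`e₄ = P⁻¹ ∂_r`. -/
noncomputable def standardFrame (q : M × ℝ) : Fin 4 → ℂ ⊗[ℝ] TangentSpace (lineModel) q :=
  ![((D.P q)⁻¹ : ℂ) • ((horizontal q).baseChange ℂ (η.del q.1) - D.W q ⊗ₜ[ℝ] vertical q),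
    ((D.P q)⁻¹ : ℂ) • ((horizontal q).baseChange ℂ (η.delbar q.1)
      - (starRingEnd ℂ) (D.W q) ⊗ₜ[ℝ] vertical q),
    (1 : ℂ) ⊗ₜ[ℝ] ((D.P q)⁻¹ • (horizontal q (η.del0 q.1) - D.H q • vertical q)),
    (1 : ℂ) ⊗ₜ[ℝ] ((D.P q)⁻¹ • vertical q)]

/-- The component `R_{ij}` at `q` of the Ricci curvature of the metric with respect to the frame
`e = (e₁, e₂, e₃, e₄)` at `q`; the indices `i, j : Fin 4` are shifted by one. -/
noncomputable def ricciComponent (q : M × ℝ) (e : Fin 4 → ℂ ⊗[ℝ] TangentSpace (lineModel) q)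
    (i j : Fin 4) : ℂ :=
  ricciC lineModel D.metric q (e i) (e j)

/-- `P = a / cos ((r + s) / 2)` on `U`, with smooth real functions `a, s` on `M`. -/
def HasProfile (a s : M → ℝ) : Prop :=
  ContMDiff (𝓡 3) 𝓘(ℝ, ℝ) ∞ a ∧ ContMDiff (𝓡 3) 𝓘(ℝ, ℝ) ∞ s ∧
    ∀ q ∈ U, Real.cos ((q.2 + s q.1) / 2) ≠ 0 ∧ D.P q = a q.1 / Real.cos ((q.2 + s q.1) / 2)

end QuasiFefferman

end CR

/-! Everything is computed in the real frame A = X - Re W ∂_r, B = Y + Im W ∂_r, T = ∂₀ - H ∂_r, V =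
∂_r, for which A - iB = P e₁. In this frame g is e^{2f} times a constant matrix, with f = log |P|.
Because μ = dζ is closed, all brackets of the frame are combinations of T and V. Koszul's formula
then gives the connection coefficients explicitly, and a trace identity for the curvature
(`ricciTrace_eq`, `ricciCoord_frame`) turns them into Ricci components.

Write w = x e^{-ir} and let δ be the derivation along A - iB. Then (`NullFrame.ricci_VV`,
`NullFrame.ricci_e₁_V`, `NullFrame.ricci_e₁_e₁`) Ric(V,V) = 1/2 - 2 VVf + 2 (Vf)², Ric(A-iB,V) = -2
δVf + i δf + (2 δf + c + w) Vf + (i/2)(c - 3w), Ric(A-iB,A-iB) = δ(w - c) - 2 δδf + 2 (δf)² -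
(1/2)(w - c)². The parameter H has disappeared from all three.

(i) On a fibre, Ric(V,V) = 0 is the Riccati equation u' = 1/4 + u² for u = Vf. Its solutions are u =
(1/2) tan((r+s)/2), and integrating once more gives P = a / cos((r+s)/2) (`profile_of_ode`). The
constants a, s of the fibres are smooth on M because they can be read off at a locally constant
value of r.

(ii), (iii) Put τ = tan((r+s)/2). The identity (τ - i) e^{-ir} = -(τ + i) e^{is}
(`halfTan_sub_I_mul_exp`) removes r from w. It makes Ric(A-iB,V) equal to (τ + i)/2 times a function
on M, and, once that function vanishes, Ric(A-iB,A-iB) equal to -(1 + iτ)(∂t + t(c - t)). As τ is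
real, neither τ + i nor 1 + iτ has a zero.

In an arbitrary adapted frame, e₂ is a non-zero complex multiple of A - iB or A + iB plus a complex
multiple of V (`IsAdaptedFrame.exists_rotation`). Since Ric is real, the vanishing conditions,
imposed one after the other, are the same for all adapted frames.

For the last claim let φ = e^{-τ-iθ}, where τ is now the scale function of the coframes. Comparing
the two expressions of g on horizontal vectors gives P'² = |φ|² P² and φW = W' + φ(h̄ - (2/3) ∂θ).
Separating the powers of e^{-ir} yields the transformation rules of x, c, a², e^{is}, and these
combine into the rule for t (`QuasiFefferman.t_change`). -/

/-! ### Coordinate Ricci curvature as a trace of covariant derivatives. -/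

section FrameCalculus

set_option maxSynthPendingDepth 3

variable {E : Type*} [NormedAddCommGroup E] [NormedSpace ℝ E] [FiniteDimensional ℝ E]

variable (E) in
/-- The coordinate functionals of the fixed basis of `E`. -/
noncomputable def coordCLM (i : Fin (Module.finrank ℝ E)) : E →L[ℝ] ℝ :=
  LinearMap.toContinuousLinearMap ((Module.finBasis ℝ E).coord i)

theorem coordCLM_apply (i : Fin (Module.finrank ℝ E)) (v : E) :
    coordCLM E i v = (Module.finBasis ℝ E).repr v i := rfl

theorem coordCLM_basis (i j : Fin (Module.finrank ℝ E)) :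
    coordCLM E i (Module.finBasis ℝ E j) = if j = i then 1 else 0 := by
  simp [coordCLM_apply, Finsupp.single_apply]

/-- The Christoffel symbols as a bilinear map. -/
noncomputable def christoffelCLM
    (G : E → Matrix (Fin (Module.finrank ℝ E)) (Fin (Module.finrank ℝ E)) ℝ) (y : E) :
    E →L[ℝ] E →L[ℝ] E :=
  ∑ k, ∑ i, ∑ j, christoffel G k i j y •
    (coordCLM E i).smulRight ((coordCLM E j).smulRight (Module.finBasis ℝ E k))

/-- The bilinear form with a given matrix of components. -/
noncomputable def formCLM (G : Matrix (Fin (Module.finrank ℝ E)) (Fin (Module.finrank ℝ E)) ℝ) :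
    E →L[ℝ] E →L[ℝ] ℝ :=
  ∑ i, ∑ j, G i j • (coordCLM E i).smulRight (coordCLM E j)

theorem formCLM_apply (G : Matrix (Fin (Module.finrank ℝ E)) (Fin (Module.finrank ℝ E)) ℝ)
    (v w : E) : formCLM G v w = ∑ i, ∑ j, G i j * (coordCLM E i v * coordCLM E j w) := by
  simp [formCLM]

theorem formCLM_basis (G : Matrix (Fin (Module.finrank ℝ E)) (Fin (Module.finrank ℝ E)) ℝ)
    (i j : Fin (Module.finrank ℝ E)) :
    formCLM G (Module.finBasis ℝ E i) (Module.finBasis ℝ E j) = G i j := by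
  simp [formCLM_apply, coordCLM_basis]

theorem christoffelCLM_apply
    (G : E → Matrix (Fin (Module.finrank ℝ E)) (Fin (Module.finrank ℝ E)) ℝ) (y v w : E) :
    christoffelCLM G y v w = ∑ k, ∑ i, ∑ j,
      (christoffel G k i j y * (coordCLM E i v * coordCLM E j w)) • Module.finBasis ℝ E k := by
  simp [christoffelCLM, smul_smul, mul_assoc]

theorem christoffelCLM_basis
    (G : E → Matrix (Fin (Module.finrank ℝ E)) (Fin (Module.finrank ℝ E)) ℝ) (y : E)
    (i j : Fin (Module.finrank ℝ E)) :
    christoffelCLM G y (Module.finBasis ℝ E i) (Module.finBasis ℝ E j) =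
      ∑ k, christoffel G k i j y • Module.finBasis ℝ E k := by
  simp [christoffelCLM_apply, coordCLM_basis]

theorem coordCLM_christoffelCLM
    (G : E → Matrix (Fin (Module.finrank ℝ E)) (Fin (Module.finrank ℝ E)) ℝ) (y : E)
    (k i j : Fin (Module.finrank ℝ E)) :
    coordCLM E k (christoffelCLM G y (Module.finBasis ℝ E i) (Module.finBasis ℝ E j)) =
      christoffel G k i j y := by
  simp [christoffelCLM_basis, coordCLM_basis]

/-- The trace of an endomorphism, as a continuous linear functional. -/
noncomputable def traceCLM (E : Type*) [NormedAddCommGroup E] [NormedSpace ℝ E]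
    [FiniteDimensional ℝ E] : (E →L[ℝ] E) →L[ℝ] ℝ :=
  ∑ k, (coordCLM E k).comp (ContinuousLinearMap.apply ℝ E (Module.finBasis ℝ E k))

theorem traceCLM_apply (f : E →L[ℝ] E) :
    traceCLM E f = ∑ k, coordCLM E k (f (Module.finBasis ℝ E k)) := by
  simp [traceCLM]

theorem traceCLM_eq_trace (f : E →L[ℝ] E) : traceCLM E f = LinearMap.trace ℝ E f := by
  rw [LinearMap.trace_eq_matrix_trace ℝ (Module.finBasis ℝ E), traceCLM_apply]
  simp [Matrix.trace, LinearMap.toMatrix_apply, coordCLM_apply]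

theorem traceCLM_comp_comm (f g : E →L[ℝ] E) : traceCLM E (f.comp g) = traceCLM E (g.comp f) := by
  simp only [traceCLM_eq_trace]
  exact LinearMap.trace_mul_comm ℝ (f : E →ₗ[ℝ] E) (g : E →ₗ[ℝ] E)

/-- The endomorphism is a sum of rank one maps θ^a ⊗ f(F_a), each of trace θ^a(f(F_a)). This allows
traces to be taken in the frame of the metric instead of the coordinate basis. -/
theorem traceCLM_eq_sum {ι : Type*} [Fintype ι] [DecidableEq ι] (F : ι → E) (θ : ι → E →L[ℝ] ℝ)
    (hθ : ∀ v, v = ∑ a, θ a v • F a) (f : E →L[ℝ] E) :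
    traceCLM E f = ∑ a, θ a (f (F a)) := by
  have : f = ∑ a, (θ a).smulRight (f (F a)) := by
    ext v
    conv_lhs => rw [hθ v]
    simp
  conv_lhs => rw [this]
  simp only [map_sum]
  refine Finset.sum_congr rfl fun a _ => ?_
  simp only [traceCLM_apply, ContinuousLinearMap.smulRight_apply, map_smul, smul_eq_mul]
  conv_rhs => rw [← (Module.finBasis ℝ E).sum_repr (f (F a)), map_sum]
  simp [coordCLM_apply, mul_comm]

/-- The covariant derivative `u ↦ ∇_u Y` at `y`. -/
noncomputable def covDeriv (Γ : E → E →L[ℝ] E →L[ℝ] E) (Y : E → E) (y : E) : E →L[ℝ] E :=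
  fderiv ℝ Y y + (Γ y).flip (Y y)

omit [FiniteDimensional ℝ E] in
theorem covDeriv_apply (Γ : E → E →L[ℝ] E →L[ℝ] E) (Y : E → E) (y u : E) :
    covDeriv Γ Y y u = fderiv ℝ Y y u + Γ y u (Y y) := by
  simp [covDeriv]

/-- The Ricci curvature of a connection on a vector space, as a trace. -/
noncomputable def ricciTrace (Γ : E → E →L[ℝ] E →L[ℝ] E) (y w v : E) : ℝ :=
  ∑ k, coordCLM E k (fderiv ℝ Γ y (Module.finBasis ℝ E k) v w
    - fderiv ℝ Γ y v (Module.finBasis ℝ E k) w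
    + Γ y (Module.finBasis ℝ E k) (Γ y v w) - Γ y v (Γ y (Module.finBasis ℝ E k) w))

theorem fderiv_christoffel
    (G : E → Matrix (Fin (Module.finrank ℝ E)) (Fin (Module.finrank ℝ E)) ℝ) (y u : E)
    (hΓ : DifferentiableAt ℝ (christoffelCLM G) y) (k i j : Fin (Module.finrank ℝ E)) :
    fderiv ℝ (christoffel G k i j) y u = coordCLM E k
      (fderiv ℝ (christoffelCLM G) y u (Module.finBasis ℝ E i) (Module.finBasis ℝ E j)) := by
  have h := (((coordCLM E k).hasFDerivAt).comp y
    ((hΓ.hasFDerivAt.clm_apply (hasFDerivAt_const (Module.finBasis ℝ E i) y)).clm_apply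
      (hasFDerivAt_const (Module.finBasis ℝ E j) y)))
  have e : christoffel G k i j = coordCLM E k ∘ fun z =>
      christoffelCLM G z (Module.finBasis ℝ E i) (Module.finBasis ℝ E j) := by
    ext z; simp [coordCLM_christoffelCLM]
  rw [e, h.fderiv]
  simp

theorem coordCLM_christoffelCLM_christoffelCLM
    (G : E → Matrix (Fin (Module.finrank ℝ E)) (Fin (Module.finrank ℝ E)) ℝ) (y : E)
    (k m i j : Fin (Module.finrank ℝ E)) :
    coordCLM E k (christoffelCLM G y (Module.finBasis ℝ E m)
      (christoffelCLM G y (Module.finBasis ℝ E i) (Module.finBasis ℝ E j))) =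
      ∑ l, christoffel G k m l y * christoffel G l i j y := by
  rw [christoffelCLM_basis G y i j]
  simp only [map_sum, map_smul, coordCLM_christoffelCLM, smul_eq_mul]
  exact Finset.sum_congr rfl fun l _ => mul_comm _ _

theorem christoffel_symm
    {G : E → Matrix (Fin (Module.finrank ℝ E)) (Fin (Module.finrank ℝ E)) ℝ}
    (hG : ∀ y i j, G y i j = G y j i) (k i j : Fin (Module.finrank ℝ E)) :
    christoffel G k i j = christoffel G k j i := by
  have h : ∀ i j, (fun z => G z i j) = fun z => G z j i := fun i j => funext fun z => hG z i j
  funext y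
  simp only [christoffel, h i j]
  congr 1
  exact Finset.sum_congr rfl fun l _ => by ring

theorem christoffelCLM_symm
    {G : E → Matrix (Fin (Module.finrank ℝ E)) (Fin (Module.finrank ℝ E)) ℝ}
    (hG : ∀ y i j, G y i j = G y j i) (y u v : E) :
    christoffelCLM G y u v = christoffelCLM G y v u := by
  simp only [christoffelCLM_apply]
  refine Finset.sum_congr rfl fun k _ => ?_
  rw [Finset.sum_comm]
  refine Finset.sum_congr rfl fun i _ => Finset.sum_congr rfl fun j _ => ?_
  rw [christoffel_symm hG k i j, mul_comm (coordCLM E j u)]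

/-- Both sides are bilinear, so basis vectors suffice. There the index orders of the coordinate
formula and of the trace of u ↦ R(u,v)w are reconciled by the symmetry of the Christoffel symbols.
-/
theorem formCLM_ricciCoord
    {G : E → Matrix (Fin (Module.finrank ℝ E)) (Fin (Module.finrank ℝ E)) ℝ}
    (hG : ∀ y i j, G y i j = G y j i) (y w v : E)
    (hΓ : DifferentiableAt ℝ (christoffelCLM G) y) :
    formCLM (ricciCoord G y) w v = ricciTrace (christoffelCLM G) y w v := by
  have key : ∀ i j, ricciTrace (christoffelCLM G) y (Module.finBasis ℝ E i)
      (Module.finBasis ℝ E j) = ricciCoord G y i j := by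
    intro i j
    simp only [ricciTrace, ricciCoord, Matrix.of_apply]
    refine Finset.sum_congr rfl fun k _ => ?_
    rw [christoffel_symm hG k i j, christoffel_symm hG k i k, Finset.sum_sub_distrib,
      ← coordCLM_christoffelCLM_christoffelCLM, ← coordCLM_christoffelCLM_christoffelCLM,
      fderiv_christoffel G y _ hΓ, fderiv_christoffel G y _ hΓ,
      christoffelCLM_symm hG y (Module.finBasis ℝ E i),
      christoffelCLM_symm hG y (Module.finBasis ℝ E i)]
    simp only [map_add, map_sub]
    ring
  let B : LinearMap.BilinForm ℝ E := LinearMap.mk₂ ℝ (ricciTrace (christoffelCLM G) y)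
    (by
      intro a b c
      simp only [ricciTrace, ← Finset.sum_add_distrib, map_add, map_sub]
      refine Finset.sum_congr rfl fun k _ => by ring)
    (by
      intro a b c
      simp only [ricciTrace, smul_eq_mul, Finset.mul_sum, map_add, map_sub, map_smul]
      refine Finset.sum_congr rfl fun k _ => by ring)
    (by
      intro a b c
      simp only [ricciTrace, ← Finset.sum_add_distrib, map_add, map_sub,
        add_apply]
      refine Finset.sum_congr rfl fun k _ => by ring)
    (by
      intro a b c
      simp only [ricciTrace, smul_eq_mul, Finset.mul_sum, map_add, map_sub, map_smul,
        smul_apply]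
      refine Finset.sum_congr rfl fun k _ => by ring)
  have hB : (formCLM (ricciCoord G y)).toLinearMap₁₂ = B := by
    refine LinearMap.BilinForm.ext_basis (Module.finBasis ℝ E) fun i j => ?_
    simp [B, key, formCLM_basis]
  exact LinearMap.congr_fun₂ hB w v

/-- Take the trace over u of R(u,Y)Z. For a torsion-free connection the second derivatives combine
into the divergence of ∇_Y Z minus the Y-derivative of the divergence of Z, and what is left is
tr(∇Z ∘ ∇Y). No bracket occurs, so in a frame only connection coefficients and their derivatives are
needed. -/
theorem ricciTrace_eq {Γ : E → E →L[ℝ] E →L[ℝ] E} {Y Z : E → E} {y : E}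
    (hsymm : ∀ u v, Γ y u v = Γ y v u) (hΓ : DifferentiableAt ℝ Γ y)
    (hY : DifferentiableAt ℝ Y y) (hZ : ContDiffAt ℝ 2 Z y) :
    ricciTrace Γ y (Z y) (Y y) =
      traceCLM E (covDeriv Γ (fun x => covDeriv Γ Z x (Y x)) y)
        - fderiv ℝ (fun x => traceCLM E (covDeriv Γ Z x)) y (Y y)
        - traceCLM E ((covDeriv Γ Z y).comp (covDeriv Γ Y y)) := by
  have hZ1 : DifferentiableAt ℝ Z y := hZ.differentiableAt (by norm_num)
  have hZ2 : DifferentiableAt ℝ (fderiv ℝ Z) y :=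
    (hZ.fderiv_right (m := 1) (by norm_num)).differentiableAt (by norm_num)
  have hflip : HasFDerivAt (fun x => (Γ x).flip)
      ((ContinuousLinearMap.flipₗᵢ ℝ E E E).toContinuousLinearEquiv.toContinuousLinearMap.comp
        (fderiv ℝ Γ y)) y :=
    ((ContinuousLinearMap.flipₗᵢ ℝ E E E).toContinuousLinearEquiv.hasFDerivAt).comp y
      hΓ.hasFDerivAt
  have hL := hZ2.hasFDerivAt.add (hflip.clm_apply hZ1.hasFDerivAt)
  set L := fderiv ℝ (fderiv ℝ Z) y + _ with hLdef
  have hcov : HasFDerivAt (covDeriv Γ Z) L y := hL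
  have hLa : ∀ u v, L u v = fderiv ℝ (fderiv ℝ Z) y u v + fderiv ℝ Γ y u v (Z y)
      + Γ y v (fderiv ℝ Z y u) := by
    intro u v
    simp [hLdef]
    abel
  have h1 := hcov.clm_apply hY.hasFDerivAt
  have h2 : HasFDerivAt (fun x => traceCLM E (covDeriv Γ Z x)) ((traceCLM E).comp L) y :=
    (traceCLM E).hasFDerivAt.comp y hcov
  have hsym2 : ∀ u v, fderiv ℝ (fderiv ℝ Z) y u v = fderiv ℝ (fderiv ℝ Z) y v u := fun u v =>
    (hZ.isSymmSndFDerivAt (by simp)).eq u v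
  -- After expansion the two sides differ only in the order of the compositions of Γ(Y,·) with DZ
  -- and with Γ(Z,·). The trace does not see this order, but the summands do, so these two
  -- identities are added to the sum.
  have t1 := traceCLM_comp_comm (Γ y (Y y)) (fderiv ℝ Z y)
  have t2 := traceCLM_comp_comm (Γ y (Y y)) (Γ y (Z y))
  have hcc : ∀ u, covDeriv Γ (fun x => covDeriv Γ Z x (Y x)) y u = L u (Y y)
      + covDeriv Γ Z y (fderiv ℝ Y y u) + Γ y u (covDeriv Γ Z y (Y y)) := by
    intro u
    rw [covDeriv_apply, h1.fderiv]
    simp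
    abel
  have hs := hsymm (Z y)
  rw [h2.fderiv]
  simp only [traceCLM_apply, ContinuousLinearMap.comp_apply, hcc] at t1 t2 ⊢
  rw [ricciTrace, ← Finset.sum_sub_distrib, ← Finset.sum_sub_distrib]
  rw [← sub_eq_zero, ← Finset.sum_sub_distrib] at t1 t2
  have t3 := congrArg₂ (· + ·) t1 t2
  simp only [← Finset.sum_add_distrib, add_zero] at t3
  rw [← sub_eq_zero, ← neg_zero, ← t3, ← Finset.sum_sub_distrib, ← Finset.sum_neg_distrib]
  refine Finset.sum_congr rfl fun k _ => ?_
  rw [hLa, hLa, covDeriv_apply, covDeriv_apply, covDeriv_apply, covDeriv_apply,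
    hsym2 _ (Y y), hsymm _ (Y y), hsymm _ (Z y), hsymm _ (Z y)]
  simp only [map_add, map_sub, add_apply, ← hs]
  ring

end FrameCalculus

/-! ### Koszul's formula for the coordinate Christoffel symbols. -/

section FrameCalculus2

set_option maxSynthPendingDepth 3

variable {E : Type*} [NormedAddCommGroup E] [NormedSpace ℝ E] [FiniteDimensional ℝ E]

theorem differentiableAt_formCLM
    {G : E → Matrix (Fin (Module.finrank ℝ E)) (Fin (Module.finrank ℝ E)) ℝ} {y : E}
    (hG : ∀ i j, DifferentiableAt ℝ (fun z => G z i j) y) :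
    DifferentiableAt ℝ (fun z => formCLM (G z)) y := by
  unfold formCLM
  exact DifferentiableAt.fun_sum fun i _ => DifferentiableAt.fun_sum fun j _ =>
    (hG i j).smul_const _

theorem fderiv_formCLM_basis
    {G : E → Matrix (Fin (Module.finrank ℝ E)) (Fin (Module.finrank ℝ E)) ℝ} {y : E}
    (hG : ∀ i j, DifferentiableAt ℝ (fun z => G z i j) y) (u : E)
    (i j : Fin (Module.finrank ℝ E)) :
    fderiv ℝ (fun z => formCLM (G z)) y u (Module.finBasis ℝ E i) (Module.finBasis ℝ E j) =
      fderiv ℝ (fun z => G z i j) y u := by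
  have h := (((differentiableAt_formCLM hG).hasFDerivAt.clm_apply
    (hasFDerivAt_const (Module.finBasis ℝ E i) y)).clm_apply
      (hasFDerivAt_const (Module.finBasis ℝ E j) y))
  have e : (fun z => G z i j) = fun z =>
      formCLM (G z) (Module.finBasis ℝ E i) (Module.finBasis ℝ E j) := by
    ext z; simp [formCLM_basis]
  rw [e, h.fderiv]
  simp

/-- The formula of Koszul for the Christoffel symbols. -/
theorem formCLM_christoffelCLM
    {G : E → Matrix (Fin (Module.finrank ℝ E)) (Fin (Module.finrank ℝ E)) ℝ} {y : E}
    (hGs : ∀ y i j, G y i j = G y j i)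
    (hG : ∀ i j, DifferentiableAt ℝ (fun z => G z i j) y) (hdet : IsUnit (G y).det) (u v w : E) :
    2 * formCLM (G y) (christoffelCLM G y u v) w =
      fderiv ℝ (fun z => formCLM (G z)) y u v w + fderiv ℝ (fun z => formCLM (G z)) y v u w
        - fderiv ℝ (fun z => formCLM (G z)) y w u v := by
  set D := fderiv ℝ (fun z => formCLM (G z)) y with hD
  have hbasis : ∀ i j l, 2 * formCLM (G y) (christoffelCLM G y (Module.finBasis ℝ E i)
      (Module.finBasis ℝ E j)) (Module.finBasis ℝ E l) =
      D (Module.finBasis ℝ E i) (Module.finBasis ℝ E j) (Module.finBasis ℝ E l)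
      + D (Module.finBasis ℝ E j) (Module.finBasis ℝ E i) (Module.finBasis ℝ E l)
        - D (Module.finBasis ℝ E l) (Module.finBasis ℝ E i) (Module.finBasis ℝ E j) := by
    intro i j l
    simp only [hD, fderiv_formCLM_basis hG, christoffelCLM_basis, map_sum, map_smul, sum_apply,
      smul_apply, formCLM_basis, smul_eq_mul]
    have h1 : ∀ m, ∑ k, G y l k * (G y)⁻¹ k m = if l = m then 1 else 0 := by
      intro m
      rw [← Matrix.mul_apply, Matrix.mul_nonsing_inv _ hdet, Matrix.one_apply]
    have h2 : ∑ k, christoffel G k i j y * G y k l = ∑ m, (∑ k, G y l k * (G y)⁻¹ k m) *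
        ((1 / 2) * (fderiv ℝ (fun z => G z m j) y (Module.finBasis ℝ E i)
          + fderiv ℝ (fun z => G z m i) y (Module.finBasis ℝ E j)
          - fderiv ℝ (fun z => G z i j) y (Module.finBasis ℝ E m))) := by
      simp only [christoffel, Finset.sum_mul, Finset.mul_sum]
      rw [Finset.sum_comm]
      refine Finset.sum_congr rfl fun m _ => Finset.sum_congr rfl fun k _ => ?_
      rw [hGs y k l]
      ring
    have hs : ∀ i j, (fun z => G z i j) = fun z => G z j i := fun i j => funext fun z => hGs z i j
    rw [h2]
    simp only [h1, ite_mul, zero_mul, one_mul, Finset.sum_ite_eq, Finset.mem_univ, if_true]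
    rw [hs l j, hs l i]
    ring
  -- The identity is trilinear; it is extended from basis vectors to all vectors one slot at a time.
  have ext1 : ∀ {f g : E →L[ℝ] ℝ}, (∀ i, f (Module.finBasis ℝ E i) = g (Module.finBasis ℝ E i)) →
      ∀ x, f x = g x := fun {f g} h x =>
    LinearMap.congr_fun ((Module.finBasis ℝ E).ext (f₁ := (f : E →ₗ[ℝ] ℝ)) (f₂ := (g : E →ₗ[ℝ] ℝ)) h) x
  have s1 : ∀ i j w, _ := fun i j => ext1
    (f := (2 : ℝ) • formCLM (G y) (christoffelCLM G y (Module.finBasis ℝ E i)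
      (Module.finBasis ℝ E j)))
    (g := D (Module.finBasis ℝ E i) (Module.finBasis ℝ E j)
      + D (Module.finBasis ℝ E j) (Module.finBasis ℝ E i)
      - (D.flip (Module.finBasis ℝ E i)).flip (Module.finBasis ℝ E j)) (hbasis i j)
  have s2 : ∀ i v, _ := fun i => ext1
    (f := (2 : ℝ) • ((formCLM (G y)).flip w).comp (christoffelCLM G y (Module.finBasis ℝ E i)))
    (g := (D (Module.finBasis ℝ E i)).flip w + (D.flip (Module.finBasis ℝ E i)).flip w
      - D w (Module.finBasis ℝ E i)) (fun j => s1 i j w)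
  exact ext1 (f := (2 : ℝ) • ((formCLM (G y)).flip w).comp ((christoffelCLM G y).flip v))
    (g := (D.flip v).flip w + (D v).flip w - (D w).flip v) (fun i => s2 i v) u

/-- The derivative of a scalar product of vector fields. -/
theorem fderiv_formCLM_apply
    {G : E → Matrix (Fin (Module.finrank ℝ E)) (Fin (Module.finrank ℝ E)) ℝ} {y : E}
    (hG : ∀ i j, DifferentiableAt ℝ (fun z => G z i j) y) {Y Z : E → E}
    (hY : DifferentiableAt ℝ Y y) (hZ : DifferentiableAt ℝ Z y) (u : E) :
    fderiv ℝ (fun z => formCLM (G z) (Y z) (Z z)) y u =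
      fderiv ℝ (fun z => formCLM (G z)) y u (Y y) (Z y) + formCLM (G y) (fderiv ℝ Y y u) (Z y)
        + formCLM (G y) (Y y) (fderiv ℝ Z y u) := by
  rw [(((differentiableAt_formCLM hG).hasFDerivAt.clm_apply hY.hasFDerivAt).clm_apply
    hZ.hasFDerivAt).fderiv]
  simp
  ring

/-- The formula of Koszul for the Levi-Civita connection. -/
theorem koszul
    {G : E → Matrix (Fin (Module.finrank ℝ E)) (Fin (Module.finrank ℝ E)) ℝ} {y : E}
    (hGs : ∀ y i j, G y i j = G y j i)
    (hG : ∀ i j, DifferentiableAt ℝ (fun z => G z i j) y) (hdet : IsUnit (G y).det)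
    {X Y Z : E → E} (hX : DifferentiableAt ℝ X y) (hY : DifferentiableAt ℝ Y y)
    (hZ : DifferentiableAt ℝ Z y) :
    2 * formCLM (G y) (covDeriv (christoffelCLM G) Y y (X y)) (Z y) =
      fderiv ℝ (fun z => formCLM (G z) (Y z) (Z z)) y (X y)
      + fderiv ℝ (fun z => formCLM (G z) (X z) (Z z)) y (Y y)
      - fderiv ℝ (fun z => formCLM (G z) (X z) (Y z)) y (Z y)
      + formCLM (G y) (lieBracket ℝ X Y y) (Z y)
      - formCLM (G y) (lieBracket ℝ X Z y) (Y y)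
      - formCLM (G y) (lieBracket ℝ Y Z y) (X y) := by
  have hsymm : ∀ u v, formCLM (G y) u v = formCLM (G y) v u := by
    intro u v
    simp only [formCLM_apply]
    rw [Finset.sum_comm]
    refine Finset.sum_congr rfl fun i _ => Finset.sum_congr rfl fun j _ => ?_
    rw [hGs y j i, mul_comm (coordCLM E j u)]
  rw [covDeriv_apply, map_add, add_apply, mul_add, formCLM_christoffelCLM hGs hG hdet,
    fderiv_formCLM_apply hG hY hZ, fderiv_formCLM_apply hG hX hZ, fderiv_formCLM_apply hG hX hY]
  simp only [lieBracket, map_sub, sub_apply]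
  rw [hsymm (Y y) (fderiv ℝ Z y (X y)), hsymm (X y) (fderiv ℝ Z y (Y y)),
    hsymm (X y) (fderiv ℝ Y y (Z y))]
  ring

end FrameCalculus2

/-! ### Ricci curvature in a frame with scalar products conformal to constants. -/

section FrameRicci

set_option maxSynthPendingDepth 3

variable {E : Type*} [NormedAddCommGroup E] [NormedSpace ℝ E] [FiniteDimensional ℝ E]
  {ι : Type*} [Fintype ι] [DecidableEq ι]

omit [DecidableEq ι] in
/-- The connection coefficients of a frame whose scalar products are conformal to constants. -/
theorem covDeriv_frame
    {G : E → Matrix (Fin (Module.finrank ℝ E)) (Fin (Module.finrank ℝ E)) ℝ} {y : E}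
    (hGs : ∀ y i j, G y i j = G y j i)
    (hG : ∀ i j, DifferentiableAt ℝ (fun z => G z i j) y) (hdet : IsUnit (G y).det)
    {F : ι → E → E} (hF : ∀ a, DifferentiableAt ℝ (F a) y)
    {f : E → ℝ} (hf : DifferentiableAt ℝ f y) {h : ι → ι → ℝ}
    (hg : ∀ a b, ∀ᶠ z in nhds y, formCLM (G z) (F a z) (F b z) = Real.exp (2 * f z) * h a b)
    (hnd : ∀ v, (∀ c, formCLM (G y) v (F c y) = 0) → v = 0)
    {C : ι → ι → ι → ℝ} (hC : ∀ a b, lieBracket ℝ (F a) (F b) y = ∑ c, C a b c • F c y)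
    {κ : ι → ι → ι → ℝ}
    (hκ : ∀ a b c, 2 * ∑ d, κ a b d * h d c =
      ∑ d, C a b d * h d c - ∑ d, C a c d * h d b - ∑ d, C b c d * h d a
      + 2 * (fderiv ℝ f y (F a y) * h b c + fderiv ℝ f y (F b y) * h a c
        - fderiv ℝ f y (F c y) * h a b)) (a b : ι) :
    covDeriv (christoffelCLM G) (F b) y (F a y) = ∑ c, κ a b c • F c y := by
  rw [← sub_eq_zero]
  -- By non-degeneracy it suffices to pair with the frame. Koszul's formula gives one side and the
  -- hypothesis on `κ`, multiplied by the conformal factor, the other.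
  refine hnd _ fun c => ?_
  have hgy : ∀ a b, formCLM (G y) (F a y) (F b y) = Real.exp (2 * f y) * h a b :=
    fun a b => (hg a b).self_of_nhds
  have hd : ∀ a b u, fderiv ℝ (fun z => formCLM (G z) (F a z) (F b z)) y u =
      Real.exp (2 * f y) * (2 * fderiv ℝ f y u * h a b) := by
    intro a b u
    have h1 : HasFDerivAt (fun z => Real.exp (2 * f z) * h a b) _ y :=
      ((hf.hasFDerivAt.const_mul 2).exp).mul_const (h a b)
    rw [Filter.EventuallyEq.fderiv_eq (hg a b), h1.fderiv]
    simp
    ring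
  have hk := koszul hGs hG hdet (hF a) (hF b) (hF c)
  rw [hd, hd, hd, hC, hC, hC] at hk
  simp only [map_sum, map_smul, sum_apply, smul_apply, smul_eq_mul, hgy] at hk
  have hw := congrArg (fun t => Real.exp (2 * f y) * t) (hκ a b c)
  simp only [mul_add, mul_sub, Finset.mul_sum] at hw
  have : 2 * formCLM (G y) (covDeriv (christoffelCLM G) (F b) y (F a y)
      - ∑ c, κ a b c • F c y) (F c y) = 0 := by
    rw [map_sub, sub_apply, mul_sub, hk]
    simp only [map_sum, map_smul, sum_apply, smul_apply, smul_eq_mul, hgy, Finset.mul_sum]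
    have e : ∀ (k : ι → ℝ) (c : ι), ∑ d, k d * (Real.exp (2 * f y) * h d c) =
        ∑ d, Real.exp (2 * f y) * (k d * h d c) := fun k c =>
      Finset.sum_congr rfl fun d _ => by ring
    have e2 : ∑ d, 2 * (κ a b d * (Real.exp (2 * f y) * h d c)) =
        ∑ d, Real.exp (2 * f y) * (2 * (κ a b d * h d c)) :=
      Finset.sum_congr rfl fun d _ => by ring
    rw [e, e, e, e2, hw]
    ring
  linarith

omit [FiniteDimensional ℝ E] [DecidableEq ι] in
theorem covDeriv_sum {Γ : E → E →L[ℝ] E →L[ℝ] E} {y : E} {F : ι → E → E}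
    (hF : ∀ a, DifferentiableAt ℝ (F a) y) {φ : ι → E → ℝ} (hφ : ∀ a, DifferentiableAt ℝ (φ a) y)
    (u : E) :
    covDeriv Γ (fun z => ∑ a, φ a z • F a z) y u =
      ∑ a, (fderiv ℝ (φ a) y u • F a y + φ a y • covDeriv Γ (F a) y u) := by
  have h1 : HasFDerivAt (fun z => ∑ a, φ a z • F a z) _ y :=
    HasFDerivAt.fun_sum fun a _ => (hφ a).hasFDerivAt.smul (hF a).hasFDerivAt
  rw [covDeriv_apply, h1.fderiv]
  simp only [covDeriv_apply, map_sum, map_smul, sum_apply, ← Finset.sum_add_distrib]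
  refine Finset.sum_congr rfl fun a _ => ?_
  simp
  abel

/-- The Ricci curvature in a frame, in terms of the connection coefficients. -/
theorem ricciTrace_frame {Γ : E → E →L[ℝ] E →L[ℝ] E} {y : E}
    (hsymm : ∀ u v, Γ y u v = Γ y v u) (hΓ : DifferentiableAt ℝ Γ y)
    {F : ι → E → E} (hF : ∀ a, ContDiffAt ℝ 2 (F a) y) {κ : ι → ι → ι → E → ℝ}
    (hκ : ∀ a b c, DifferentiableAt ℝ (κ a b c) y) {θ : E → ι → E →L[ℝ] ℝ}
    (hθ : ∀ᶠ z in nhds y, ∀ v, v = ∑ a, θ z a v • F a z)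
    (hθF : ∀ᶠ z in nhds y, ∀ a b, θ z a (F b z) = if a = b then 1 else 0)
    (hcov : ∀ a b, ∀ᶠ z in nhds y, covDeriv Γ (F b) z (F a z) = ∑ c, κ a b c z • F c z)
    (b d : ι) :
    ricciTrace Γ y (F d y) (F b y) =
      ∑ c, (fderiv ℝ (κ b d c) y (F c y) + κ b d c y * ∑ a, κ a c a y
        - ∑ a, κ a b c y * κ c d a y) - fderiv ℝ (fun z => ∑ a, κ a d a z) y (F b y) := by
  have hF1 : ∀ a, DifferentiableAt ℝ (F a) y := fun a => (hF a).differentiableAt (by norm_num)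
  have hcy : ∀ a b, covDeriv Γ (F b) y (F a y) = ∑ c, κ a b c y • F c y := fun a b =>
    (hcov a b).self_of_nhds
  have hθy := hθ.self_of_nhds
  have hθFy := hθF.self_of_nhds
  rw [ricciTrace_eq hsymm hΓ (hF1 b) (hF d)]
  have e1 : covDeriv Γ (fun x => covDeriv Γ (F d) x (F b x)) y =
      covDeriv Γ (fun z => ∑ c, κ b d c z • F c z) y := by
    have h1 := hcy b d
    have h2 := Filter.EventuallyEq.fderiv_eq (𝕜 := ℝ) (hcov b d)
    -- A covariant derivative at `y` depends only on the germ of the field, so the frame expansion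
    -- of ∇_b F_d may be inserted before differentiating again.
    unfold covDeriv at h1 h2 ⊢
    rw [h2]
    beta_reduce
    rw [h1]
  have e2 : (fun x => traceCLM E (covDeriv Γ (F d) x)) =ᶠ[nhds y] fun z => ∑ a, κ a d a z := by
    filter_upwards [hθ, hθF, Filter.eventually_all.2 fun a => hcov a d] with z h1 h2 h3
    rw [traceCLM_eq_sum (fun a => F a z) (θ z) h1]
    simp [h3, h2]
  rw [e1, e2.fderiv_eq, traceCLM_eq_sum (fun a => F a y) (θ y) hθy,
    traceCLM_eq_sum (fun a => F a y) (θ y) hθy]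
  simp only [covDeriv_sum hF1 (hκ b d), ContinuousLinearMap.comp_apply, hcy, map_sum, map_add,
    map_smul, hθFy, smul_eq_mul, mul_ite, mul_one, mul_zero, Finset.sum_add_distrib,
    Finset.sum_ite_eq, Finset.mem_univ, if_true, Finset.sum_sub_distrib, Finset.mul_sum]
  rw [Finset.sum_comm (f := fun a c => κ b d c y * κ a c a y),
    Finset.sum_comm (f := fun a c => κ a b c y * κ c d a y)]
  ring

omit [FiniteDimensional ℝ E] [DecidableEq ι] in
-- The connection is recovered from the frame as Γ(v,w) = Σ θ^a(v) θ^b(w) (∇_{F_a} F_b - DF_b(F_a)),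
-- and every factor on the right is differentiable. This avoids any regularity assumption on the
-- matrix of the metric.
theorem differentiableAt_christoffelCLM {Γ : E → E →L[ℝ] E →L[ℝ] E} {y : E}
    {F : ι → E → E} (hF : ∀ a, ContDiffAt ℝ 2 (F a) y) {κ : ι → ι → ι → E → ℝ}
    (hκ : ∀ a b c, DifferentiableAt ℝ (κ a b c) y) {θ : E → ι → E →L[ℝ] ℝ}
    (hθd : ∀ a, DifferentiableAt ℝ (fun z => θ z a) y)
    (hθ : ∀ᶠ z in nhds y, ∀ v, v = ∑ a, θ z a v • F a z)
    (hcov : ∀ a b, ∀ᶠ z in nhds y, covDeriv Γ (F b) z (F a z) = ∑ c, κ a b c z • F c z) :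
    DifferentiableAt ℝ Γ y := by
  have hF1 : ∀ a, DifferentiableAt ℝ (F a) y := fun a => (hF a).differentiableAt (by norm_num)
  have hF2 : ∀ a, DifferentiableAt ℝ (fderiv ℝ (F a)) y := fun a =>
    ((hF a).fderiv_right (m := 1) (by norm_num)).differentiableAt (by norm_num)
  have e : Γ =ᶠ[nhds y] fun z => ∑ a, ∑ b, (θ z a).smulRight ((θ z b).smulRight
      (∑ c, κ a b c z • F c z - fderiv ℝ (F b) z (F a z))) := by
    filter_upwards [hθ, Filter.eventually_all.2 fun a => Filter.eventually_all.2 fun b =>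
      hcov a b] with z h1 h2
    ext v w
    conv_lhs => rw [h1 v, h1 w]
    simp only [map_sum, map_smul, sum_apply, smul_apply, ContinuousLinearMap.smulRight_apply,
      ← h2, covDeriv_apply, add_sub_cancel_left]
    rw [Finset.sum_comm]
    refine Finset.sum_congr rfl fun i _ => ?_
    rw [Finset.smul_sum]
    exact Finset.sum_congr rfl fun j _ => smul_comm _ _ _
  refine DifferentiableAt.congr_of_eventuallyEq ?_ e
  fun_prop

/-- The coframe dual to a frame. -/
noncomputable def dualCoframe (F : ι → E → E) (z : E) (a : ι) : E →L[ℝ] ℝ :=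
  (ContinuousLinearMap.proj a).comp
    (∑ b, (ContinuousLinearMap.proj (R := ℝ) (φ := fun _ : ι => ℝ) b).smulRight (F b z)).inverse

/-- By the dimension count, the map k ↦ Σ k_b F_b is invertible wherever the frame is independent,
and inversion is smooth at an invertible map. Elsewhere `ContinuousLinearMap.inverse` takes its
default value, hence the pointwise hypothesis. -/
theorem dualCoframe_spec {F : ι → E → E} {z : E} (hli : LinearIndependent ℝ fun a => F a z)
    (hcard : Fintype.card ι = Module.finrank ℝ E) :
    (∀ v, v = ∑ a, dualCoframe F z a v • F a z) ∧
    (∀ a b, dualCoframe F z a (F b z) = if a = b then 1 else 0) ∧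
    ((∀ a, ContDiffAt ℝ ∞ (F a) z) → ∀ a, ContDiffAt ℝ ∞ (fun z => dualCoframe F z a) z) := by
  let Φ : E → (ι → ℝ) →L[ℝ] E := fun z =>
    ∑ b, (ContinuousLinearMap.proj (R := ℝ) (φ := fun _ : ι => ℝ) b).smulRight (F b z)
  have hΦ : ∀ k, Φ z k = ∑ b, k b • F b z := fun k => by simp [Φ]
  have hinj : Function.Injective (Φ z) := by
    rw [injective_iff_map_eq_zero]
    intro k hk
    rw [hΦ] at hk
    exact funext fun i => Fintype.linearIndependent_iff.1 hli k hk i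
  have hfr : Module.finrank ℝ (ι → ℝ) = Module.finrank ℝ E := by simpa using hcard
  let e : (ι → ℝ) ≃L[ℝ] E :=
    (LinearEquiv.ofInjectiveOfFinrankEq (Φ z : (ι → ℝ) →ₗ[ℝ] E) hinj hfr).toContinuousLinearEquiv
  have he : (e : (ι → ℝ) →L[ℝ] E) = Φ z := by ext; rfl
  have hinv : (Φ z).inverse = (e.symm : E →L[ℝ] (ι → ℝ)) := by
    rw [← he, ContinuousLinearMap.inverse_equiv]
  have hd : ∀ a v, dualCoframe F z a v = e.symm v a := by
    intro a v
    have : dualCoframe F z a v = (Φ z).inverse v a := rfl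
    rw [this, hinv]
    rfl
  refine ⟨fun v => ?_, fun a b => ?_, fun hF a => ?_⟩
  · have := e.apply_symm_apply v
    rw [show e (e.symm v) = Φ z (e.symm v) from rfl, hΦ] at this
    simp only [hd]
    exact this.symm
  · have : F b z = e (Pi.single b 1) := by
      rw [show e (Pi.single b 1) = Φ z (Pi.single b 1) from rfl, hΦ]
      simp [Pi.single_apply]
    rw [hd, this, e.symm_apply_apply, Pi.single_apply]
  · have h1 : ContDiffAt ℝ ∞ Φ z := by
      refine ContDiffAt.sum fun b _ => ?_
      exact ContDiffAt.smulRight contDiffAt_const (hF b)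
    have h2 : ContDiffAt ℝ ∞ ContinuousLinearMap.inverse (Φ z) := by
      rw [← he]
      exact contDiffAt_map_inverse e
    exact contDiffAt_const.clm_comp (h2.comp z h1)

/-- The Ricci curvature, in a frame, of a metric whose scalar products in the frame are
conformal to constants. -/
theorem ricciCoord_frame
    {G : E → Matrix (Fin (Module.finrank ℝ E)) (Fin (Module.finrank ℝ E)) ℝ}
    (hGs : ∀ y i j, G y i j = G y j i) {O : Set E} (hO : IsOpen O)
    {F : ι → E → E} (hF : ∀ a, ContDiffOn ℝ ∞ (F a) O)
    (hli : ∀ z ∈ O, LinearIndependent ℝ fun a => F a z)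
    (hcard : Fintype.card ι = Module.finrank ℝ E)
    {f : E → ℝ} (hf : ContDiffOn ℝ ∞ f O) {h h' : ι → ι → ℝ}
    (hh' : ∀ a b, ∑ c, h a c * h' c b = if a = b then 1 else 0)
    (hg : ∀ a b, ∀ z ∈ O, formCLM (G z) (F a z) (F b z) = Real.exp (2 * f z) * h a b)
    {C : ι → ι → ι → E → ℝ}
    (hC : ∀ a b, ∀ z ∈ O, lieBracket ℝ (F a) (F b) z = ∑ c, C a b c z • F c z)
    {κ : ι → ι → ι → E → ℝ} (hκd : ∀ a b c, DifferentiableOn ℝ (κ a b c) O)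
    (hκ : ∀ a b c, ∀ z ∈ O, 2 * ∑ d, κ a b d z * h d c =
      ∑ d, C a b d z * h d c - ∑ d, C a c d z * h d b - ∑ d, C b c d z * h d a
      + 2 * (fderiv ℝ f z (F a z) * h b c + fderiv ℝ f z (F b z) * h a c
        - fderiv ℝ f z (F c z) * h a b))
    {y : E} (hy : y ∈ O) (b d : ι) :
    formCLM (ricciCoord G y) (F d y) (F b y) =
      ∑ c, (fderiv ℝ (κ b d c) y (F c y) + κ b d c y * ∑ a, κ a c a y
        - ∑ a, κ a b c y * κ c d a y) - fderiv ℝ (fun z => ∑ a, κ a d a z) y (F b y) := by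
  have hFz : ∀ a, ∀ z ∈ O, ContDiffAt ℝ ∞ (F a) z := fun a z hz =>
    (hF a).contDiffAt (hO.mem_nhds hz)
  have hfz : ∀ z ∈ O, ContDiffAt ℝ ∞ f z := fun z hz => hf.contDiffAt (hO.mem_nhds hz)
  have hev : ∀ {p : E → Prop}, (∀ z ∈ O, p z) → ∀ z ∈ O, ∀ᶠ x in nhds z, p x :=
    fun hp z hz => Filter.eventually_of_mem (hO.mem_nhds hz) hp
  have hθ := fun z hz => (dualCoframe_spec (hli z hz) hcard).1
  have hθF := fun z hz => (dualCoframe_spec (hli z hz) hcard).2.1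
  have hθd := fun z hz => (dualCoframe_spec (hli z hz) hcard).2.2 fun a => hFz a z hz
  -- The metric is rebuilt from the dual coframe. Its differentiability and its non-degeneracy are
  -- both consequences of this, and neither is assumed.
  have hGθ : ∀ z ∈ O, ∀ v w, formCLM (G z) v w = ∑ a, ∑ b, Real.exp (2 * f z) *
      h a b * (dualCoframe F z a v * dualCoframe F z b w) := by
    intro z hz v w
    conv_lhs => rw [hθ z hz v, hθ z hz w]
    simp only [map_sum, map_smul, sum_apply, smul_apply, smul_eq_mul, hg _ _ z hz,
      Finset.mul_sum]
    rw [Finset.sum_comm]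
    exact Finset.sum_congr rfl fun i _ => Finset.sum_congr rfl fun j _ => by ring
  have hGd : ∀ z ∈ O, ∀ i j, DifferentiableAt ℝ (fun x => G x i j) z := by
    intro z hz i j
    have e : (fun x => G x i j) =ᶠ[nhds z] fun x => ∑ a, ∑ b, Real.exp (2 * f x) *
        h a b * (dualCoframe F x a (Module.finBasis ℝ E i) *
          dualCoframe F x b (Module.finBasis ℝ E j)) := by
      refine hev (fun x hx => ?_) z hz
      beta_reduce
      rw [← hGθ x hx, formCLM_basis]
    refine DifferentiableAt.congr_of_eventuallyEq ?_ e
    have h1 : ∀ a, DifferentiableAt ℝ (fun x => dualCoframe F x a) z := fun a =>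
      (hθd z hz a).differentiableAt (by simp)
    have h2 : DifferentiableAt ℝ f z := (hfz z hz).differentiableAt (by simp)
    fun_prop
  have hnd : ∀ z ∈ O, ∀ v, (∀ c, formCLM (G z) v (F c z) = 0) → v = 0 := by
    intro z hz v hv
    have h0 : ∀ b, ∑ a, dualCoframe F z a v * h a b = 0 := by
      intro b
      have := hv b
      rw [hθ z hz v] at this
      simp only [map_sum, map_smul, sum_apply, smul_apply, smul_eq_mul, hg _ _ z hz] at this
      have e : ∑ a, dualCoframe F z a v * (Real.exp (2 * f z) * h a b) =
          Real.exp (2 * f z) * ∑ a, dualCoframe F z a v * h a b := by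
        rw [Finset.mul_sum]
        exact Finset.sum_congr rfl fun a _ => by ring
      rw [e] at this
      exact (mul_eq_zero.1 this).resolve_left (Real.exp_pos _).ne'
    have h1 : ∀ c, dualCoframe F z c v = 0 := by
      intro c
      have : ∑ b, (∑ a, dualCoframe F z a v * h a b) * h' b c = dualCoframe F z c v := by
        simp only [Finset.sum_mul]
        rw [Finset.sum_comm]
        simp only [mul_assoc, ← Finset.mul_sum, hh']
        simp
      rw [← this]
      simp [h0]
    rw [hθ z hz v]
    simp [h1]
  have hdet : ∀ z ∈ O, IsUnit (G z).det := by
    intro z hz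
    rw [isUnit_iff_ne_zero]
    intro h0
    obtain ⟨k, hk0, hk⟩ := Matrix.exists_vecMul_eq_zero_iff.2 h0
    -- A null vector of a singular matrix would be orthogonal to the whole frame.
    have : ∑ i, k i • Module.finBasis ℝ E i = 0 := by
      refine hnd z hz _ fun c => ?_
      have e : ∀ j, ∑ i, k i * G z i j = 0 := fun j => congrFun hk j
      rw [formCLM_apply, Finset.sum_comm]
      refine Finset.sum_eq_zero fun j _ => ?_
      have : ∀ i, coordCLM E i (∑ i, k i • Module.finBasis ℝ E i) = k i := by
        intro i; simp [coordCLM_basis]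
      simp only [this, ← mul_assoc, ← Finset.sum_mul]
      rw [Finset.sum_congr rfl fun i _ => mul_comm (G z i j) (k i), e, zero_mul]
    exact hk0 (funext fun i =>
      Fintype.linearIndependent_iff.1 (Module.finBasis ℝ E).linearIndependent k this i)
  have hcov : ∀ a b, ∀ z ∈ O, covDeriv (christoffelCLM G) (F b) z (F a z) =
      ∑ c, κ a b c z • F c z := by
    intro a b z hz
    exact covDeriv_frame hGs (hGd z hz) (hdet z hz)
      (fun a => (hFz a z hz).differentiableAt (by simp))
      ((hfz z hz).differentiableAt (by simp)) (fun a b => hev (hg a b) z hz) (hnd z hz)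
      (fun a b => hC a b z hz) (fun a b c => hκ a b c z hz) a b
  have hF2 : ∀ a, ContDiffAt ℝ 2 (F a) y := fun a =>
    (hFz a y hy).of_le (by norm_cast)
  have hκy : ∀ a b c, DifferentiableAt ℝ (κ a b c) y := fun a b c =>
    (hκd a b c).differentiableAt (hO.mem_nhds hy)
  have hΓ : DifferentiableAt ℝ (christoffelCLM G) y :=
    differentiableAt_christoffelCLM hF2 hκy
      (fun a => (hθd y hy a).differentiableAt (by simp)) (hev hθ y hy)
      (fun a b => hev (hcov a b) y hy)
  rw [formCLM_ricciCoord hGs y _ _ hΓ]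
  exact ricciTrace_frame (christoffelCLM_symm hGs y) hΓ hF2 hκy (hev hθ y hy) (hev hθF y hy)
    (fun a b => hev (hcov a b) y hy) b d

end FrameRicci

/-! ### The Ricci components of a null frame with the brackets of a quasi-Fefferman metric. -/

section NullFrame

set_option maxSynthPendingDepth 3

/-- The scalar products of the frame `A, B, T, V`, up to a conformal factor. -/
noncomputable def frameForm : Fin 4 → Fin 4 → ℝ :=
  ![![1/2, 0, 0, 0], ![0, 1/2, 0, 0], ![0, 0, 0, 1], ![0, 0, 1, 0]]

theorem frameForm_inverse (a b : Fin 4) :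
    ∑ c, frameForm a c * (![![2, 0, 0, 0], ![0, 2, 0, 0], ![0, 0, 0, 1], ![0, 0, 1, 0]] :
      Fin 4 → Fin 4 → ℝ) c b = if a = b then 1 else 0 := by
  fin_cases a <;> fin_cases b <;> simp [frameForm, Fin.sum_univ_four]

/-- The structure functions of the frame. -/
noncomputable def frameStructure {R : Type*} [CommRing R] [Algebra ℝ R]
    (k c₁ c₂ α β w₁ w₂ h : R) : Fin 4 → Fin 4 → Fin 4 → R :=
  ![![![0, 0, 0, 0], ![0, 0, -algebraMap ℝ R (1/2), k], ![0, 0, -c₁, α], ![0, 0, 0, w₁]],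
    ![![0, 0, algebraMap ℝ R (1/2), -k], ![0, 0, 0, 0], ![0, 0, c₂, β], ![0, 0, 0, -w₂]],
    ![![0, 0, c₁, -α], ![0, 0, -c₂, -β], ![0, 0, 0, 0], ![0, 0, 0, h]],
    ![![0, 0, 0, -w₁], ![0, 0, 0, w₂], ![0, 0, 0, -h], ![0, 0, 0, 0]]]

/-- The connection coefficients of the frame. -/
noncomputable def frameConnection (k c₁ c₂ α β w₁ w₂ h fA fB fT fV : ℝ) :
    Fin 4 → Fin 4 → Fin 4 → ℝ :=
  ![![![fA, -fB, -(1/2) * fV, -(1/2) * fT], ![fB, fA, -(1/4), (1/2) * k],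
      ![fT, -k, fA - (1/2) * c₁ - (1/2) * w₁, 0],
      ![fV, 1/2, 0, fA + (1/2) * c₁ + (1/2) * w₁]],
    ![![fB, fA, 1/4, -(1/2) * k], ![-fA, fB, -(1/2) * fV, -(1/2) * fT],
      ![k, fT, fB + (1/2) * c₂ + (1/2) * w₂, 0],
      ![-(1/2), fV, 0, fB - (1/2) * c₂ - (1/2) * w₂]],
    ![![fT, -k, fA + (1/2) * c₁ - (1/2) * w₁, -α], ![k, fT, fB - (1/2) * c₂ + (1/2) * w₂, -β],
      ![2 * α, 2 * β, 2 * fT - h, 0], ![w₁ - c₁ - 2 * fA, c₂ - 2 * fB - w₂, 0, h]],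
    ![![fV, 1/2, 0, fA + (1/2) * c₁ - (1/2) * w₁], ![-(1/2), fV, 0, fB - (1/2) * c₂ + (1/2) * w₂],
      ![w₁ - c₁ - 2 * fA, c₂ - 2 * fB - w₂, 0, 0], ![0, 0, 0, 2 * fV]]]

/-- The table of coefficients is the solution of Koszul's linear equations for the given brackets
and conformal factor; a finite check of 64 cases certifies it. -/
theorem frameConnection_koszul (k c₁ c₂ α β w₁ w₂ h fA fB fT fV : ℝ) (a b c : Fin 4) :
    2 * ∑ d, frameConnection k c₁ c₂ α β w₁ w₂ h fA fB fT fV a b d * frameForm d c =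
      ∑ d, frameStructure k c₁ c₂ α β w₁ w₂ h a b d * frameForm d c
      - ∑ d, frameStructure k c₁ c₂ α β w₁ w₂ h a c d * frameForm d b
      - ∑ d, frameStructure k c₁ c₂ α β w₁ w₂ h b c d * frameForm d a
      + 2 * (![fA, fB, fT, fV] a * frameForm b c + ![fA, fB, fT, fV] b * frameForm a c
        - ![fA, fB, fT, fV] c * frameForm a b) := by
  fin_cases a <;> fin_cases b <;> fin_cases c <;>
    simp [frameForm, frameStructure, frameConnection, Fin.sum_univ_four] <;> ring

variable {E : Type*} [NormedAddCommGroup E] [NormedSpace ℝ E] [FiniteDimensional ℝ E]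

omit [FiniteDimensional ℝ E] in
/-- Derivations along vector fields commute up to the Lie bracket. -/
theorem fderiv_fderiv_sub {F : Type*} [NormedAddCommGroup F] [NormedSpace ℝ F]
    {f : E → F} {X Y : E → E} {y : E} (hf : ContDiffAt ℝ 2 f y)
    (hX : DifferentiableAt ℝ X y) (hY : DifferentiableAt ℝ Y y) :
    fderiv ℝ (fun z => fderiv ℝ f z (Y z)) y (X y) - fderiv ℝ (fun z => fderiv ℝ f z (X z)) y (Y y) =
      fderiv ℝ f y (lieBracket ℝ X Y y) := by
  have h2 : DifferentiableAt ℝ (fderiv ℝ f) y :=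
    (hf.fderiv_right (m := 1) (by norm_num)).differentiableAt (by norm_num)
  rw [(h2.hasFDerivAt.clm_apply hY.hasFDerivAt).fderiv,
    (h2.hasFDerivAt.clm_apply hX.hasFDerivAt).fderiv]
  have := (hf.isSymmSndFDerivAt (by simp)).eq (X y) (Y y)
  simp [lieBracket, this]

/-- The derivative of `f` along a frame vector. -/
noncomputable def frameDeriv (F : Fin 4 → E → E) (a : Fin 4) (f : E → ℝ) (z : E) : ℝ :=
  fderiv ℝ f z (F a z)

/-- A frame `A, B, T, V` with the brackets of the (real) standard frame of a
quasi-Fefferman metric, with a metric conformal to `frameForm` in this frame. -/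
structure NullFrame (G : E → Matrix (Fin (Module.finrank ℝ E)) (Fin (Module.finrank ℝ E)) ℝ)
    (O : Set E) (F : Fin 4 → E → E) (f k c₁ c₂ α β w₁ w₂ h : E → ℝ) : Prop where
  symm : ∀ y i j, G y i j = G y j i
  isOpen : IsOpen O
  finrank : Module.finrank ℝ E = 4
  smooth_frame : ∀ a, ContDiffOn ℝ ∞ (F a) O
  linearIndependent : ∀ z ∈ O, LinearIndependent ℝ fun a => F a z
  smooth_f : ContDiffOn ℝ ∞ f O
  form : ∀ a b, ∀ z ∈ O, formCLM (G z) (F a z) (F b z) = Real.exp (2 * f z) * frameForm a b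
  smooth_k : ContDiffOn ℝ ∞ k O
  smooth_c₁ : ContDiffOn ℝ ∞ c₁ O
  smooth_c₂ : ContDiffOn ℝ ∞ c₂ O
  smooth_α : ContDiffOn ℝ ∞ α O
  smooth_β : ContDiffOn ℝ ∞ β O
  smooth_w₁ : ContDiffOn ℝ ∞ w₁ O
  smooth_w₂ : ContDiffOn ℝ ∞ w₂ O
  smooth_h : ContDiffOn ℝ ∞ h O
  bracket_AB : ∀ z ∈ O, lieBracket ℝ (F 0) (F 1) z = -(1/2 : ℝ) • F 2 z + k z • F 3 z
  bracket_AT : ∀ z ∈ O, lieBracket ℝ (F 0) (F 2) z = -c₁ z • F 2 z + α z • F 3 z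
  bracket_BT : ∀ z ∈ O, lieBracket ℝ (F 1) (F 2) z = c₂ z • F 2 z + β z • F 3 z
  bracket_AV : ∀ z ∈ O, lieBracket ℝ (F 0) (F 3) z = w₁ z • F 3 z
  bracket_BV : ∀ z ∈ O, lieBracket ℝ (F 1) (F 3) z = -w₂ z • F 3 z
  bracket_TV : ∀ z ∈ O, lieBracket ℝ (F 2) (F 3) z = h z • F 3 z
  V_c₁ : ∀ z ∈ O, fderiv ℝ c₁ z (F 3 z) = 0
  V_c₂ : ∀ z ∈ O, fderiv ℝ c₂ z (F 3 z) = 0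
  V_w₁ : ∀ z ∈ O, fderiv ℝ w₁ z (F 3 z) = w₂ z
  V_w₂ : ∀ z ∈ O, fderiv ℝ w₂ z (F 3 z) = -w₁ z

namespace NullFrame

variable {G : E → Matrix (Fin (Module.finrank ℝ E)) (Fin (Module.finrank ℝ E)) ℝ}
    {O : Set E} {F : Fin 4 → E → E} {f k c₁ c₂ α β w₁ w₂ h : E → ℝ}

theorem lieBracket_frame (N : NullFrame G O F f k c₁ c₂ α β w₁ w₂ h) (a b : Fin 4) {z : E}
    (hz : z ∈ O) : lieBracket ℝ (F a) (F b) z =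
      ∑ c, frameStructure (k z) (c₁ z) (c₂ z) (α z) (β z) (w₁ z) (w₂ z) (h z) a b c • F c z := by
  have swap : ∀ a b, lieBracket ℝ (F a) (F b) z = -lieBracket ℝ (F b) (F a) z := fun a b =>
    lieBracket_swap
  fin_cases a <;> fin_cases b <;>
    simp [frameStructure, Fin.sum_univ_four, N.bracket_AB z hz, N.bracket_AT z hz,
      N.bracket_BT z hz, N.bracket_AV z hz, N.bracket_BV z hz, N.bracket_TV z hz,
      swap 1 0, swap 2 0, swap 2 1, swap 3 0, swap 3 1, swap 3 2, lieBracket_self, add_comm]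

theorem contDiffOn_frameDeriv (N : NullFrame G O F f k c₁ c₂ α β w₁ w₂ h) (a : Fin 4)
    {φ : E → ℝ} (hφ : ContDiffOn ℝ ∞ φ O) : ContDiffOn ℝ ∞ (frameDeriv F a φ) O :=
  (hφ.fderiv_of_isOpen N.isOpen (by simp)).clm_apply (N.smooth_frame a)

theorem frameDeriv_comm (N : NullFrame G O F f k c₁ c₂ α β w₁ w₂ h) (a b : Fin 4)
    {φ : E → ℝ} (hφ : ContDiffOn ℝ ∞ φ O) {y : E} (hy : y ∈ O) :
    frameDeriv F a (frameDeriv F b φ) y - frameDeriv F b (frameDeriv F a φ) y =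
      fderiv ℝ φ y (lieBracket ℝ (F a) (F b) y) :=
  fderiv_fderiv_sub ((hφ.contDiffAt (N.isOpen.mem_nhds hy)).of_le (by norm_cast))
    (((N.smooth_frame a).contDiffAt (N.isOpen.mem_nhds hy)).differentiableAt (by simp))
    (((N.smooth_frame b).contDiffAt (N.isOpen.mem_nhds hy)).differentiableAt (by simp))

/-- The table `frameConnection` is substituted into the general frame formula. In Ric(F_d, F_b) the
field F_d is the one being differentiated, which explains the order of the indices of `κ`. -/
theorem formCLM_ricciCoord (N : NullFrame G O F f k c₁ c₂ α β w₁ w₂ h) {y : E} (hy : y ∈ O)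
    (b d : Fin 4) {κ : Fin 4 → Fin 4 → Fin 4 → E → ℝ}
    (hκ : κ = fun a b c z => frameConnection (k z) (c₁ z) (c₂ z) (α z) (β z) (w₁ z) (w₂ z) (h z)
      (frameDeriv F 0 f z) (frameDeriv F 1 f z) (frameDeriv F 2 f z) (frameDeriv F 3 f z) a b c) :
    formCLM (ricciCoord G y) (F d y) (F b y) =
      ∑ c, (frameDeriv F c (κ b d c) y + κ b d c y * ∑ a, κ a c a y
        - ∑ a, κ a b c y * κ c d a y) - frameDeriv F b (fun z => ∑ a, κ a d a z) y := by
  have d0 := (N.contDiffOn_frameDeriv 0 N.smooth_f).differentiableOn (by simp)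
  have d1 := (N.contDiffOn_frameDeriv 1 N.smooth_f).differentiableOn (by simp)
  have d2 := (N.contDiffOn_frameDeriv 2 N.smooth_f).differentiableOn (by simp)
  have d3 := (N.contDiffOn_frameDeriv 3 N.smooth_f).differentiableOn (by simp)
  have e1 := N.smooth_k.differentiableOn (by simp)
  have e2 := N.smooth_c₁.differentiableOn (by simp)
  have e3 := N.smooth_c₂.differentiableOn (by simp)
  have e4 := N.smooth_α.differentiableOn (by simp)
  have e5 := N.smooth_β.differentiableOn (by simp)
  have e6 := N.smooth_w₁.differentiableOn (by simp)
  have e7 := N.smooth_w₂.differentiableOn (by simp)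
  have e8 := N.smooth_h.differentiableOn (by simp)
  refine ricciCoord_frame N.symm N.isOpen N.smooth_frame N.linearIndependent
    (by rw [N.finrank]; simp) N.smooth_f frameForm_inverse N.form
    (C := fun a b c z =>
      frameStructure (k z) (c₁ z) (c₂ z) (α z) (β z) (w₁ z) (w₂ z) (h z) a b c)
    (fun a b z hz => N.lieBracket_frame a b hz) ?_ ?_ hy b d
  · intro a b c
    subst hκ
    fin_cases a <;> fin_cases b <;> fin_cases c <;> simp [frameConnection] <;> fun_prop
  · intro a b c z hz
    subst hκ
    have := frameConnection_koszul (k z) (c₁ z) (c₂ z) (α z) (β z) (w₁ z) (w₂ z) (h z)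
      (frameDeriv F 0 f z) (frameDeriv F 1 f z) (frameDeriv F 2 f z) (frameDeriv F 3 f z) a b c
    have e : ∀ a, ![frameDeriv F 0 f z, frameDeriv F 1 f z, frameDeriv F 2 f z,
        frameDeriv F 3 f z] a = fderiv ℝ f z (F a z) := by
      intro a; fin_cases a <;> rfl
    rw [e, e, e] at this
    exact this

theorem differentiableAt (N : NullFrame G O F f k c₁ c₂ α β w₁ w₂ h) {y : E} (hy : y ∈ O) :
    DifferentiableAt ℝ (frameDeriv F 0 f) y ∧ DifferentiableAt ℝ (frameDeriv F 1 f) y ∧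
    DifferentiableAt ℝ (frameDeriv F 2 f) y ∧ DifferentiableAt ℝ (frameDeriv F 3 f) y ∧
    DifferentiableAt ℝ k y ∧ DifferentiableAt ℝ c₁ y ∧ DifferentiableAt ℝ c₂ y ∧
    DifferentiableAt ℝ α y ∧ DifferentiableAt ℝ β y ∧ DifferentiableAt ℝ w₁ y ∧
    DifferentiableAt ℝ w₂ y ∧ DifferentiableAt ℝ h y := by
  have key : ∀ {φ : E → ℝ}, ContDiffOn ℝ ∞ φ O → DifferentiableAt ℝ φ y := fun hφ =>
    (hφ.differentiableOn (by simp)).differentiableAt (N.isOpen.mem_nhds hy)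
  have hd := fun a => key (N.contDiffOn_frameDeriv a N.smooth_f)
  exact ⟨hd 0, hd 1, hd 2, hd 3, key N.smooth_k, key N.smooth_c₁, key N.smooth_c₂, key N.smooth_α,
    key N.smooth_β, key N.smooth_w₁, key N.smooth_w₂, key N.smooth_h⟩

/-- The constant 1/2 is the twist of V: it comes from the T-component -1/2 of [A,B], the
pseudoconvexity of the CR structure. All other structure functions cancel. -/
theorem ricci_VV (N : NullFrame G O F f k c₁ c₂ α β w₁ w₂ h) {y : E} (hy : y ∈ O) :
    formCLM (ricciCoord G y) (F 3 y) (F 3 y) =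
      1 / 2 - 2 * frameDeriv F 3 (frameDeriv F 3 f) y + 2 * frameDeriv F 3 f y ^ 2 := by
  obtain ⟨d0, d1, d2, d3, e1, e2, e3, e4, e5, e6, e7, e8⟩ := N.differentiableAt hy
  rw [N.formCLM_ricciCoord hy 3 3 rfl]
  -- The first derivatives of `f` become opaque functions, of which only differentiability and the
  -- commutation relations kept in the context are used.
  generalize frameDeriv F 0 f = fA at *
  generalize frameDeriv F 1 f = fB at *
  generalize frameDeriv F 2 f = fT at *
  generalize frameDeriv F 3 f = fV at *
  simp only [frameConnection, Fin.sum_univ_four, Matrix.cons_val]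
  set_option linter.unusedSimpArgs false in
  simp (disch := fun_prop) only [frameDeriv, fderiv_fun_add, fderiv_fun_sub, fderiv_const_mul,
    fderiv_fun_const, fderiv_fun_neg]
  simp
  ring

/-- Besides AVf the expansion contains VAf, and [A,V] = w₁ V exchanges the two. The derivatives of
w₁ and c₁ along V are known, since w rotates along the fibre and c is constant there. -/
theorem ricci_AV (N : NullFrame G O F f k c₁ c₂ α β w₁ w₂ h) {y : E} (hy : y ∈ O) :
    formCLM (ricciCoord G y) (F 0 y) (F 3 y) =
      3 / 2 * w₂ y - 1 / 2 * c₂ y - 2 * frameDeriv F 0 (frameDeriv F 3 f) y + frameDeriv F 1 f y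
        + (c₁ y + w₁ y + 2 * frameDeriv F 0 f y) * frameDeriv F 3 f y := by
  obtain ⟨d0, d1, d2, d3, e1, e2, e3, e4, e5, e6, e7, e8⟩ := N.differentiableAt hy
  have h3 := N.frameDeriv_comm 0 3 N.smooth_f hy
  rw [N.bracket_AV y hy, map_smul, smul_eq_mul] at h3
  change _ = _ * frameDeriv F 3 f y at h3
  have hc₁ := N.V_c₁ y hy
  have hw₁ := N.V_w₁ y hy
  rw [N.formCLM_ricciCoord hy 3 0 rfl]
  generalize frameDeriv F 0 f = fA at *
  generalize frameDeriv F 1 f = fB at *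
  generalize frameDeriv F 2 f = fT at *
  generalize frameDeriv F 3 f = fV at *
  simp only [frameConnection, Fin.sum_univ_four, Matrix.cons_val]
  set_option linter.unusedSimpArgs false in
  simp (disch := fun_prop) only [frameDeriv, fderiv_fun_add, fderiv_fun_sub, fderiv_const_mul,
    fderiv_fun_const, fderiv_fun_neg] at *
  simp
  eta_reduce
  linear_combination 3 * h3 + (1 / 2) * (hw₁ - hc₁)

/-- The opposite order of arguments is computed separately; comparison of the two gives the symmetry
of the mixed components. -/
theorem ricci_VA (N : NullFrame G O F f k c₁ c₂ α β w₁ w₂ h) {y : E} (hy : y ∈ O) :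
    formCLM (ricciCoord G y) (F 3 y) (F 0 y) =
      3 / 2 * w₂ y - 1 / 2 * c₂ y - 2 * frameDeriv F 0 (frameDeriv F 3 f) y + frameDeriv F 1 f y
        + (c₁ y + w₁ y + 2 * frameDeriv F 0 f y) * frameDeriv F 3 f y := by
  obtain ⟨d0, d1, d2, d3, e1, e2, e3, e4, e5, e6, e7, e8⟩ := N.differentiableAt hy
  have h3 := N.frameDeriv_comm 0 3 N.smooth_f hy
  rw [N.bracket_AV y hy, map_smul, smul_eq_mul] at h3
  change _ = _ * frameDeriv F 3 f y at h3
  have hc₁ := N.V_c₁ y hy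
  have hw₁ := N.V_w₁ y hy
  rw [N.formCLM_ricciCoord hy 0 3 rfl]
  generalize frameDeriv F 0 f = fA at *
  generalize frameDeriv F 1 f = fB at *
  generalize frameDeriv F 2 f = fT at *
  generalize frameDeriv F 3 f = fV at *
  simp only [frameConnection, Fin.sum_univ_four, Matrix.cons_val]
  set_option linter.unusedSimpArgs false in
  simp (disch := fun_prop) only [frameDeriv, fderiv_fun_add, fderiv_fun_sub, fderiv_const_mul,
    fderiv_fun_const, fderiv_fun_neg] at *
  simp
  eta_reduce
  linear_combination -1 * h3 + (1 / 2) * (hw₁ + hc₁)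

theorem ricci_BV (N : NullFrame G O F f k c₁ c₂ α β w₁ w₂ h) {y : E} (hy : y ∈ O) :
    formCLM (ricciCoord G y) (F 1 y) (F 3 y) =
      3 / 2 * w₁ y - 1 / 2 * c₁ y - 2 * frameDeriv F 1 (frameDeriv F 3 f) y - frameDeriv F 0 f y
        + (2 * frameDeriv F 1 f y - c₂ y - w₂ y) * frameDeriv F 3 f y := by
  obtain ⟨d0, d1, d2, d3, e1, e2, e3, e4, e5, e6, e7, e8⟩ := N.differentiableAt hy
  have h3 := N.frameDeriv_comm 1 3 N.smooth_f hy
  rw [N.bracket_BV y hy, map_smul, smul_eq_mul] at h3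
  change _ = _ * frameDeriv F 3 f y at h3
  have hc₂ := N.V_c₂ y hy
  have hw₂ := N.V_w₂ y hy
  rw [N.formCLM_ricciCoord hy 3 1 rfl]
  generalize frameDeriv F 0 f = fA at *
  generalize frameDeriv F 1 f = fB at *
  generalize frameDeriv F 2 f = fT at *
  generalize frameDeriv F 3 f = fV at *
  simp only [frameConnection, Fin.sum_univ_four, Matrix.cons_val]
  set_option linter.unusedSimpArgs false in
  simp (disch := fun_prop) only [frameDeriv, fderiv_fun_add, fderiv_fun_sub, fderiv_const_mul,
    fderiv_fun_const, fderiv_fun_neg] at *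
  simp
  eta_reduce
  linear_combination 3 * h3 + (1 / 2) * (hc₂ - hw₂)

theorem ricci_VB (N : NullFrame G O F f k c₁ c₂ α β w₁ w₂ h) {y : E} (hy : y ∈ O) :
    formCLM (ricciCoord G y) (F 3 y) (F 1 y) =
      3 / 2 * w₁ y - 1 / 2 * c₁ y - 2 * frameDeriv F 1 (frameDeriv F 3 f) y - frameDeriv F 0 f y
        + (2 * frameDeriv F 1 f y - c₂ y - w₂ y) * frameDeriv F 3 f y := by
  obtain ⟨d0, d1, d2, d3, e1, e2, e3, e4, e5, e6, e7, e8⟩ := N.differentiableAt hy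
  have h3 := N.frameDeriv_comm 1 3 N.smooth_f hy
  rw [N.bracket_BV y hy, map_smul, smul_eq_mul] at h3
  change _ = _ * frameDeriv F 3 f y at h3
  have hc₂ := N.V_c₂ y hy
  have hw₂ := N.V_w₂ y hy
  rw [N.formCLM_ricciCoord hy 1 3 rfl]
  generalize frameDeriv F 0 f = fA at *
  generalize frameDeriv F 1 f = fB at *
  generalize frameDeriv F 2 f = fT at *
  generalize frameDeriv F 3 f = fV at *
  simp only [frameConnection, Fin.sum_univ_four, Matrix.cons_val]
  set_option linter.unusedSimpArgs false in
  simp (disch := fun_prop) only [frameDeriv, fderiv_fun_add, fderiv_fun_sub, fderiv_const_mul,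
    fderiv_fun_const, fderiv_fun_neg] at *
  simp
  eta_reduce
  linear_combination -1 * h3 + (-1 / 2) * (hc₂ + hw₂)

/-- Together with `ricci_AB_add_BA` this gives the real and imaginary parts of Ric(A-iB, A-iB). In
these combinations k, α, β and h cancel, so that only c, w and f remain. -/
theorem ricci_AA_sub_BB (N : NullFrame G O F f k c₁ c₂ α β w₁ w₂ h) {y : E} (hy : y ∈ O) :
    formCLM (ricciCoord G y) (F 0 y) (F 0 y) - formCLM (ricciCoord G y) (F 1 y) (F 1 y) =
      frameDeriv F 0 w₁ y - frameDeriv F 0 c₁ y + frameDeriv F 1 w₂ y - frameDeriv F 1 c₂ y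
        - 2 * (frameDeriv F 0 (frameDeriv F 0 f) y - frameDeriv F 1 (frameDeriv F 1 f) y)
        + 2 * (frameDeriv F 0 f y ^ 2 - frameDeriv F 1 f y ^ 2)
        - 1 / 2 * ((w₁ y - c₁ y) ^ 2 - (w₂ y - c₂ y) ^ 2) := by
  obtain ⟨d0, d1, d2, d3, e1, e2, e3, e4, e5, e6, e7, e8⟩ := N.differentiableAt hy
  rw [N.formCLM_ricciCoord hy 0 0 rfl, N.formCLM_ricciCoord hy 1 1 rfl]
  generalize frameDeriv F 0 f = fA at *
  generalize frameDeriv F 1 f = fB at *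
  generalize frameDeriv F 2 f = fT at *
  generalize frameDeriv F 3 f = fV at *
  simp only [frameConnection, Fin.sum_univ_four, Matrix.cons_val]
  set_option linter.unusedSimpArgs false in
  simp (disch := fun_prop) only [frameDeriv, fderiv_fun_add, fderiv_fun_sub, fderiv_const_mul,
    fderiv_fun_const, fderiv_fun_neg]
  simp
  eta_reduce
  ring

theorem ricci_AB_add_BA (N : NullFrame G O F f k c₁ c₂ α β w₁ w₂ h) {y : E} (hy : y ∈ O) :
    formCLM (ricciCoord G y) (F 0 y) (F 1 y) + formCLM (ricciCoord G y) (F 1 y) (F 0 y) =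
      frameDeriv F 0 c₂ y - frameDeriv F 0 w₂ y - frameDeriv F 1 c₁ y + frameDeriv F 1 w₁ y
        - 2 * (frameDeriv F 0 (frameDeriv F 1 f) y + frameDeriv F 1 (frameDeriv F 0 f) y)
        + 4 * (frameDeriv F 0 f y * frameDeriv F 1 f y)
        + (w₁ y - c₁ y) * (w₂ y - c₂ y) := by
  obtain ⟨d0, d1, d2, d3, e1, e2, e3, e4, e5, e6, e7, e8⟩ := N.differentiableAt hy
  rw [N.formCLM_ricciCoord hy 1 0 rfl, N.formCLM_ricciCoord hy 0 1 rfl]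
  generalize frameDeriv F 0 f = fA at *
  generalize frameDeriv F 1 f = fB at *
  generalize frameDeriv F 2 f = fT at *
  generalize frameDeriv F 3 f = fV at *
  simp only [frameConnection, Fin.sum_univ_four, Matrix.cons_val]
  set_option linter.unusedSimpArgs false in
  simp (disch := fun_prop) only [frameDeriv, fderiv_fun_add, fderiv_fun_sub, fderiv_const_mul,
    fderiv_fun_const, fderiv_fun_neg]
  simp
  eta_reduce
  ring

end NullFrame

end NullFrame

/-! ### The quasi-Fefferman frame in a chart, as a null frame. -/

section LocalModel

set_option maxSynthPendingDepth 3

variable {E₀ : Type*} [NormedAddCommGroup E₀] [NormedSpace ℝ E₀]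

theorem lieBracket_prod {X₁ X₂ : E₀ → E₀} {φ₁ φ₂ : E₀ × ℝ → ℝ} {y : E₀ × ℝ}
    (h₁ : DifferentiableAt ℝ X₁ y.1) (h₂ : DifferentiableAt ℝ X₂ y.1)
    (hφ₁ : DifferentiableAt ℝ φ₁ y) (hφ₂ : DifferentiableAt ℝ φ₂ y) :
    lieBracket ℝ (fun y => (X₁ y.1, φ₁ y)) (fun y => (X₂ y.1, φ₂ y)) y =
      (lieBracket ℝ X₁ X₂ y.1,
        fderiv ℝ φ₂ y (X₁ y.1, φ₁ y) - fderiv ℝ φ₁ y (X₂ y.1, φ₂ y)) := by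
  have key : ∀ {X : E₀ → E₀} {φ : E₀ × ℝ → ℝ}, DifferentiableAt ℝ X y.1 →
      DifferentiableAt ℝ φ y → ∀ v, fderiv ℝ (fun y : E₀ × ℝ => (X y.1, φ y)) y v =
        (fderiv ℝ X y.1 v.1, fderiv ℝ φ y v) := by
    intro X φ hX hφ v
    have h : HasFDerivAt (fun y : E₀ × ℝ => (X y.1, φ y)) _ y :=
      (hX.hasFDerivAt.comp y hasFDerivAt_fst).prodMk hφ.hasFDerivAt
    rw [h.fderiv]
    simp
  simp only [lieBracket, key h₁ hφ₁, key h₂ hφ₂, Prod.mk_sub_mk]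

theorem fderiv_vertical {F : Type*} [NormedAddCommGroup F] [NormedSpace ℝ F] {g : E₀ × ℝ → F}
    {y : E₀ × ℝ} (hg : DifferentiableAt ℝ g y) :
    fderiv ℝ g y (0, 1) = deriv (fun r => g (y.1, r)) y.2 := by
  have h : HasDerivAt (fun r : ℝ => (y.1, r)) ((0 : E₀), (1 : ℝ)) y.2 :=
    (hasDerivAt_const y.2 y.1).prodMk (hasDerivAt_id y.2)
  exact (HasFDerivAt.comp_hasDerivAt (l := g) y.2 hg.hasFDerivAt h).deriv.symm

/-- A strictly pseudoconvex CR structure in a chart: `X, Y = JX, T = -2 [X, Y]` in the case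
of a closed form `μ`, with structure function `c`. -/
structure LocalCR (Ω : Set E₀) (X Y T : E₀ → E₀) (c : E₀ → ℂ) : Prop where
  finrank : Module.finrank ℝ E₀ = 3
  isOpen : IsOpen Ω
  smooth_X : ContDiffOn ℝ ∞ X Ω
  smooth_Y : ContDiffOn ℝ ∞ Y Ω
  smooth_T : ContDiffOn ℝ ∞ T Ω
  smooth_c : ContDiffOn ℝ ∞ c Ω
  linearIndependent : ∀ z ∈ Ω, LinearIndependent ℝ ![X z, Y z, T z]
  bracket_XY : ∀ z ∈ Ω, lieBracket ℝ X Y z = -(1/2 : ℝ) • T z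
  bracket_XT : ∀ z ∈ Ω, lieBracket ℝ X T z = -(c z).re • T z
  bracket_YT : ∀ z ∈ Ω, lieBracket ℝ Y T z = (c z).im • T z

/-- The function `w = x e^{-ir}`. -/
noncomputable def localw (x : E₀ → ℂ) (y : E₀ × ℝ) : ℂ := x y.1 * Complex.exp (-(Complex.I * y.2))

/-- The function `W = i x e^{-ir} - (i/3) c`. -/
noncomputable def localW (c x : E₀ → ℂ) (y : E₀ × ℝ) : ℂ :=
  Complex.I * localw x y - Complex.I / 3 * c y.1

/-- The real frame of a quasi-Fefferman metric in a chart. -/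
noncomputable def localFrame (X Y T : E₀ → E₀) (c x : E₀ → ℂ) (H : E₀ × ℝ → ℝ) :
    Fin 4 → E₀ × ℝ → E₀ × ℝ :=
  ![fun y => (X y.1, -(localW c x y).re), fun y => (Y y.1, (localW c x y).im),
    fun y => (T y.1, -H y), fun _ => (0, 1)]

theorem contDiffOn_localw {x : E₀ → ℂ} {Ω : Set E₀} (hx : ContDiffOn ℝ ∞ x Ω) {O : Set (E₀ × ℝ)}
    (hO : ∀ y ∈ O, y.1 ∈ Ω) : ContDiffOn ℝ ∞ (localw x) O := by
  refine (hx.comp contDiff_fst.contDiffOn hO).mul (ContDiff.contDiffOn ?_)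
  refine ContDiff.cexp (ContDiff.neg (contDiff_const.mul ?_))
  exact Complex.ofRealCLM.contDiff.comp contDiff_snd

theorem fderiv_re {E : Type*} [NormedAddCommGroup E] [NormedSpace ℝ E] {g : E → ℂ} {y : E}
    (hg : DifferentiableAt ℝ g y) (v : E) :
    fderiv ℝ (fun y => (g y).re) y v = (fderiv ℝ g y v).re := by
  have h : HasFDerivAt (fun y => (g y).re) _ y := Complex.reCLM.hasFDerivAt.comp y hg.hasFDerivAt
  rw [h.fderiv]
  simp

theorem fderiv_im {E : Type*} [NormedAddCommGroup E] [NormedSpace ℝ E] {g : E → ℂ} {y : E}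
    (hg : DifferentiableAt ℝ g y) (v : E) :
    fderiv ℝ (fun y => (g y).im) y v = (fderiv ℝ g y v).im := by
  have h : HasFDerivAt (fun y => (g y).im) _ y := Complex.imCLM.hasFDerivAt.comp y hg.hasFDerivAt
  rw [h.fderiv]
  simp

theorem fderiv_localw_vertical {x : E₀ → ℂ} {y : E₀ × ℝ} (h : DifferentiableAt ℝ (localw x) y) :
    fderiv ℝ (localw x) y (0, 1) = -Complex.I * localw x y := by
  rw [fderiv_vertical h]
  have h1 : HasDerivAt (fun r : ℝ => -(Complex.I * (r : ℂ))) (-(Complex.I * 1)) y.2 :=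
    ((Complex.ofRealCLM.hasDerivAt (x := y.2)).const_mul Complex.I).neg
  have h2 := (h1.cexp).const_mul (x y.1)
  rw [show (fun r => localw x (y.1, r)) = fun r : ℝ =>
    x y.1 * Complex.exp (-(Complex.I * (r : ℂ))) from rfl, h2.deriv, localw]
  ring

theorem fderiv_comp_fst {F : Type*} [NormedAddCommGroup F] [NormedSpace ℝ F] {g : E₀ → F}
    {y : E₀ × ℝ} (hg : DifferentiableAt ℝ g y.1) (v : E₀ × ℝ) :
    fderiv ℝ (fun y : E₀ × ℝ => g y.1) y v = fderiv ℝ g y.1 v.1 := by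
  have h : HasFDerivAt (fun y : E₀ × ℝ => g y.1) _ y := hg.hasFDerivAt.comp y hasFDerivAt_fst
  rw [h.fderiv]
  simp

variable [FiniteDimensional ℝ E₀]

/-- The horizontal parts of the brackets are those of X, Y, T on the base; the rest is vertical.
Only the brackets with V matter explicitly later, so k, α, β, h stay existentially quantified. -/
theorem LocalCR.nullFrame {Ω : Set E₀} {X Y T : E₀ → E₀} {c : E₀ → ℂ} (L : LocalCR Ω X Y T c)
    {x : E₀ → ℂ} (hx : ContDiffOn ℝ ∞ x Ω) {O : Set (E₀ × ℝ)} (hO : IsOpen O)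
    (hΩ : ∀ y ∈ O, y.1 ∈ Ω) {H f : E₀ × ℝ → ℝ} (hH : ContDiffOn ℝ ∞ H O)
    (hf : ContDiffOn ℝ ∞ f O)
    {G : E₀ × ℝ → Matrix (Fin (Module.finrank ℝ (E₀ × ℝ))) (Fin (Module.finrank ℝ (E₀ × ℝ))) ℝ}
    (hG : ∀ y i j, G y i j = G y j i)
    (hform : ∀ a b, ∀ z ∈ O, formCLM (G z) (localFrame X Y T c x H a z)
      (localFrame X Y T c x H b z) = Real.exp (2 * f z) * frameForm a b) :
    ∃ k α β h, NullFrame G O (localFrame X Y T c x H) f k (fun y => (c y.1).re)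
      (fun y => (c y.1).im) α β (fun y => (localw x y).re) (fun y => (localw x y).im) h := by
  have hw := contDiffOn_localw hx hΩ
  have hc : ContDiffOn ℝ ∞ (fun y : E₀ × ℝ => c y.1) O :=
    L.smooth_c.comp contDiff_fst.contDiffOn hΩ
  have hW : ContDiffOn ℝ ∞ (localW c x) O :=
    (contDiffOn_const.mul hw).sub (contDiffOn_const.mul hc)
  have hWr : ContDiffOn ℝ ∞ (fun y => (localW c x y).re) O :=
    Complex.reCLM.contDiff.comp_contDiffOn hW
  have hWi : ContDiffOn ℝ ∞ (fun y => (localW c x y).im) O :=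
    Complex.imCLM.contDiff.comp_contDiffOn hW
  have hX : ContDiffOn ℝ ∞ (fun y : E₀ × ℝ => X y.1) O :=
    L.smooth_X.comp contDiff_fst.contDiffOn hΩ
  have hY : ContDiffOn ℝ ∞ (fun y : E₀ × ℝ => Y y.1) O :=
    L.smooth_Y.comp contDiff_fst.contDiffOn hΩ
  have hT : ContDiffOn ℝ ∞ (fun y : E₀ × ℝ => T y.1) O :=
    L.smooth_T.comp contDiff_fst.contDiffOn hΩ
  have hA : ContDiffOn ℝ ∞ (fun y : E₀ × ℝ => (X y.1, -(localW c x y).re)) O := hX.prodMk hWr.neg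
  have hB : ContDiffOn ℝ ∞ (fun y : E₀ × ℝ => (Y y.1, (localW c x y).im)) O := hY.prodMk hWi
  have hT' : ContDiffOn ℝ ∞ (fun y : E₀ × ℝ => (T y.1, -H y)) O := hT.prodMk hH.neg
  have hD : ∀ {φ : E₀ × ℝ → ℝ} {V : E₀ × ℝ → E₀ × ℝ}, ContDiffOn ℝ ∞ φ O → ContDiffOn ℝ ∞ V O →
      ContDiffOn ℝ ∞ (fun y => fderiv ℝ φ y (V y)) O := fun h1 h2 =>
    (h1.fderiv_of_isOpen hO (by simp)).clm_apply h2
  have dX : ∀ y ∈ O, DifferentiableAt ℝ X y.1 := fun y hy =>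
    (L.smooth_X.contDiffAt (L.isOpen.mem_nhds (hΩ y hy))).differentiableAt (by simp)
  have dY : ∀ y ∈ O, DifferentiableAt ℝ Y y.1 := fun y hy =>
    (L.smooth_Y.contDiffAt (L.isOpen.mem_nhds (hΩ y hy))).differentiableAt (by simp)
  have dT : ∀ y ∈ O, DifferentiableAt ℝ T y.1 := fun y hy =>
    (L.smooth_T.contDiffAt (L.isOpen.mem_nhds (hΩ y hy))).differentiableAt (by simp)
  have dc : ∀ y ∈ O, DifferentiableAt ℝ c y.1 := fun y hy =>
    (L.smooth_c.contDiffAt (L.isOpen.mem_nhds (hΩ y hy))).differentiableAt (by simp)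
  have dcf : ∀ y ∈ O, DifferentiableAt ℝ (fun y : E₀ × ℝ => c y.1) y := fun y hy =>
    (dc y hy).comp y differentiableAt_fst
  have dWr : ∀ y ∈ O, DifferentiableAt ℝ (fun y => (localW c x y).re) y := fun y hy =>
    (hWr.contDiffAt (hO.mem_nhds hy)).differentiableAt (by simp)
  have dWi : ∀ y ∈ O, DifferentiableAt ℝ (fun y => (localW c x y).im) y := fun y hy =>
    (hWi.contDiffAt (hO.mem_nhds hy)).differentiableAt (by simp)
  have dH : ∀ y ∈ O, DifferentiableAt ℝ H y := fun y hy =>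
    (hH.contDiffAt (hO.mem_nhds hy)).differentiableAt (by simp)
  have dw : ∀ y ∈ O, DifferentiableAt ℝ (localw x) y := fun y hy =>
    (hw.contDiffAt (hO.mem_nhds hy)).differentiableAt (by simp)
  -- Since ∂_r(i x e^{-ir}) = x e^{-ir} and c does not depend on r, the brackets of A and B with V
  -- have coefficients given by w.
  have VW : ∀ y ∈ O, fderiv ℝ (localW c x) y (0, 1) = localw x y := by
    intro y hy
    have h : HasFDerivAt (localW c x) _ y := ((dw y hy).hasFDerivAt.const_mul Complex.I).sub
      (((dc y hy).hasFDerivAt.comp y hasFDerivAt_fst).const_mul (Complex.I / 3))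
    rw [h.fderiv]
    simp only [sub_apply, smul_apply, fderiv_localw_vertical (dw y hy),
      ContinuousLinearMap.comp_apply, ContinuousLinearMap.coe_fst', map_zero, smul_eq_mul, mul_zero,
      sub_zero]
    linear_combination -localw x y * Complex.I_mul_I
  have dW : ∀ y ∈ O, DifferentiableAt ℝ (localW c x) y := fun y hy =>
    (hW.contDiffAt (hO.mem_nhds hy)).differentiableAt (by simp)
  have hA' : localFrame X Y T c x H 0 = fun y => (X y.1, -(localW c x y).re) := rfl
  have hB' : localFrame X Y T c x H 1 = fun y => (Y y.1, (localW c x y).im) := rfl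
  have hT'' : localFrame X Y T c x H 2 = fun y => (T y.1, -H y) := rfl
  have hV' : localFrame X Y T c x H 3 = fun y => ((fun _ => 0 : E₀ → E₀) y.1, (fun _ => 1) y) := rfl
  -- These are the vertical components of the brackets. The terms with H compensate the vertical
  -- part -H of T in the multiples of T that occur in [A,B], [A,T] and [B,T].
  refine ⟨fun y => fderiv ℝ (fun y => (localW c x y).im) y (X y.1, -(localW c x y).re)
      + fderiv ℝ (fun y => (localW c x y).re) y (Y y.1, (localW c x y).im) - 1 / 2 * H y,
    fun y => -fderiv ℝ H y (X y.1, -(localW c x y).re)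
      + fderiv ℝ (fun y => (localW c x y).re) y (T y.1, -H y) - (c y.1).re * H y,
    fun y => -fderiv ℝ H y (Y y.1, (localW c x y).im)
      - fderiv ℝ (fun y => (localW c x y).im) y (T y.1, -H y) + (c y.1).im * H y,
    fun y => fderiv ℝ H y (0, 1), ?_⟩
  have neg_fderiv : ∀ (φ : E₀ × ℝ → ℝ) (y v : E₀ × ℝ), fderiv ℝ (fun y => -φ y) y v =
      -fderiv ℝ φ y v := fun φ y v => by rw [fderiv_fun_neg]; rfl
  have zero_right : ∀ (Z : E₀ → E₀) (z : E₀), lieBracket ℝ Z (fun _ => 0) z = 0 := fun Z z => by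
    simp [lieBracket]
  constructor
  · exact hG
  · exact hO
  · rw [Module.finrank_prod, L.finrank, Module.finrank_self]
  · intro a
    fin_cases a
    · exact hA
    · exact hB
    · exact hT'
    · exact contDiffOn_const
  · intro z hz
    have hl := Fintype.linearIndependent_iff.1 (L.linearIndependent z.1 (hΩ z hz))
    refine Fintype.linearIndependent_iff.2 fun g hg => ?_
    simp only [Fin.sum_univ_four, hA', hB', hT'', hV'] at hg
    have h1 := congrArg Prod.fst hg
    have h2 := congrArg Prod.snd hg
    simp at h1 h2
    have h3 := hl ![g 0, g 1, g 2] (by simpa [Fin.sum_univ_three] using h1)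
    have g0 : g 0 = 0 := h3 0
    have g1 : g 1 = 0 := h3 1
    have g2 : g 2 = 0 := h3 2
    simp [g0, g1, g2] at h2
    intro i
    fin_cases i
    exacts [g0, g1, g2, h2]
  · exact hf
  · exact hform
  · exact ((hD hWi hA).add (hD hWr hB)).sub (contDiffOn_const.mul hH)
  · exact Complex.reCLM.contDiff.comp_contDiffOn hc
  · exact Complex.imCLM.contDiff.comp_contDiffOn hc
  · exact ((hD hH hA).neg.add (hD hWr hT')).sub
      ((Complex.reCLM.contDiff.comp_contDiffOn hc).mul hH)
  · exact ((hD hH hB).neg.sub (hD hWi hT')).add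
      ((Complex.imCLM.contDiff.comp_contDiffOn hc).mul hH)
  · exact Complex.reCLM.contDiff.comp_contDiffOn hw
  · exact Complex.imCLM.contDiff.comp_contDiffOn hw
  · exact hD hH contDiffOn_const
  · intro z hz
    rw [hA', hB', lieBracket_prod (dX z hz) (dY z hz) (dWr z hz).fun_neg (dWi z hz),
      L.bracket_XY z.1 (hΩ z hz), neg_fderiv, hT'', hV']
    ext <;> simp
  · intro z hz
    rw [hA', hT'', lieBracket_prod (dX z hz) (dT z hz) (dWr z hz).fun_neg (dH z hz).fun_neg,
      L.bracket_XT z.1 (hΩ z hz), neg_fderiv, neg_fderiv, hV']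
    ext <;> simp
  · intro z hz
    rw [hB', hT'', lieBracket_prod (dY z hz) (dT z hz) (dWi z hz) (dH z hz).fun_neg,
      L.bracket_YT z.1 (hΩ z hz), neg_fderiv, hV']
    ext <;> simp
  · intro z hz
    rw [hA', hV', lieBracket_prod (dX z hz) (differentiableAt_const _) (dWr z hz).fun_neg
      (differentiableAt_const _), zero_right, neg_fderiv, fderiv_re (dW z hz)]
    ext <;> simp [VW z hz]
  · intro z hz
    rw [hB', hV', lieBracket_prod (dY z hz) (differentiableAt_const _) (dWi z hz)
      (differentiableAt_const _), zero_right, fderiv_im (dW z hz)]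
    ext <;> simp [VW z hz]
  · intro z hz
    rw [hT'', hV', lieBracket_prod (dT z hz) (differentiableAt_const _) (dH z hz).fun_neg
      (differentiableAt_const _), zero_right, neg_fderiv]
    ext <;> simp
  · intro z hz
    rw [fderiv_re (dcf z hz), fderiv_comp_fst (dc z hz)]
    simp [hV']
  · intro z hz
    rw [fderiv_im (dcf z hz), fderiv_comp_fst (dc z hz)]
    simp [hV']
  · intro z hz
    rw [fderiv_re (dw z hz), hV']
    simp [fderiv_localw_vertical (dw z hz)]
  · intro z hz
    rw [fderiv_im (dw z hz), hV']
    simp [fderiv_localw_vertical (dw z hz)]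

end LocalModel

/-! ### The Ricci formulas in complex form. -/

section ComplexFormulas

set_option maxSynthPendingDepth 3

variable {E : Type*} [NormedAddCommGroup E] [NormedSpace ℝ E]

/-- The derivative of a complex function along the complex vector field `X - i Y`. -/
noncomputable def cdir (X Y : E → E) (φ : E → ℂ) (y : E) : ℂ :=
  fderiv ℝ φ y (X y) - Complex.I * fderiv ℝ φ y (Y y)

theorem fderiv_ofReal {φ : E → ℝ} {y : E} (h : DifferentiableAt ℝ φ y) (v : E) :
    fderiv ℝ (fun y => (φ y : ℂ)) y v = (fderiv ℝ φ y v : ℝ) := by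
  have h : HasFDerivAt (fun y => (φ y : ℂ)) _ y :=
    Complex.ofRealCLM.hasFDerivAt.comp y h.hasFDerivAt
  rw [h.fderiv]
  simp

theorem cdir_ofReal {X Y : E → E} {φ : E → ℝ} {y : E} (h : DifferentiableAt ℝ φ y) :
    cdir X Y (fun y => (φ y : ℂ)) y =
      (fderiv ℝ φ y (X y) : ℝ) - Complex.I * (fderiv ℝ φ y (Y y) : ℝ) := by
  simp only [cdir, fderiv_ofReal h]

theorem cdir_congr {X Y : E → E} {φ ψ : E → ℂ} {y : E} (h : φ =ᶠ[nhds y] ψ) :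
    cdir X Y φ y = cdir X Y ψ y := by
  simp only [cdir, h.fderiv_eq]

theorem cdir_add {X Y : E → E} {φ ψ : E → ℂ} {y : E} (h : DifferentiableAt ℝ φ y)
    (h' : DifferentiableAt ℝ ψ y) :
    cdir X Y (fun y => φ y + ψ y) y = cdir X Y φ y + cdir X Y ψ y := by
  simp only [cdir, fderiv_fun_add h h', add_apply]
  ring

theorem cdir_sub {X Y : E → E} {φ ψ : E → ℂ} {y : E} (h : DifferentiableAt ℝ φ y)
    (h' : DifferentiableAt ℝ ψ y) :
    cdir X Y (fun y => φ y - ψ y) y = cdir X Y φ y - cdir X Y ψ y := by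
  simp only [cdir, fderiv_fun_sub h h', sub_apply]
  ring

theorem cdir_mul {X Y : E → E} {φ ψ : E → ℂ} {y : E} (h : DifferentiableAt ℝ φ y)
    (h' : DifferentiableAt ℝ ψ y) :
    cdir X Y (fun y => φ y * ψ y) y = φ y * cdir X Y ψ y + ψ y * cdir X Y φ y := by
  simp only [cdir, fderiv_fun_mul h h', add_apply, smul_apply, smul_eq_mul]
  ring

theorem cdir_const {X Y : E → E} {y : E} (a : ℂ) : cdir X Y (fun _ => a) y = 0 := by
  simp [cdir]

theorem cdir_const_mul {X Y : E → E} {φ : E → ℂ} {y : E} (a : ℂ) (h : DifferentiableAt ℝ φ y) :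
    cdir X Y (fun y => a * φ y) y = a * cdir X Y φ y := by
  rw [cdir_mul (differentiableAt_const a) h, cdir_const]
  ring

variable [FiniteDimensional ℝ E]

namespace NullFrame

variable {G : E → Matrix (Fin (Module.finrank ℝ E)) (Fin (Module.finrank ℝ E)) ℝ}
    {O : Set E} {F : Fin 4 → E → E} {f k α β h : E → ℝ} {c w : E → ℂ}

/-- The signs c₂, -w₂ in the real brackets are those for which the two real components assemble into
one expression, polynomial in c, w and the derivatives along A - iB without conjugates. -/
theorem ricci_e₁_V (N : NullFrame G O F f k (fun y => (c y).re) (fun y => (c y).im) α β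
      (fun y => (w y).re) (fun y => (w y).im) h) {y : E} (hy : y ∈ O) :
    (formCLM (ricciCoord G y) (F 0 y) (F 3 y) : ℂ)
      - Complex.I * formCLM (ricciCoord G y) (F 1 y) (F 3 y) =
      -2 * cdir (F 0) (F 1) (fun z => (frameDeriv F 3 f z : ℂ)) y
      + Complex.I * cdir (F 0) (F 1) (fun z => (f z : ℂ)) y
      + (2 * cdir (F 0) (F 1) (fun z => (f z : ℂ)) y + c y + w y) * frameDeriv F 3 f y
      + Complex.I / 2 * (c y - 3 * w y) := by
  have hf := (N.smooth_f.differentiableOn (by simp)).differentiableAt (N.isOpen.mem_nhds hy)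
  rw [N.ricci_AV hy, N.ricci_BV hy, cdir_ofReal (N.differentiableAt hy).2.2.2.1, cdir_ofReal hf]
  simp only [frameDeriv]
  apply Complex.ext <;> simp <;> ring

theorem ricci_e₁_e₁ (N : NullFrame G O F f k (fun y => (c y).re) (fun y => (c y).im) α β
      (fun y => (w y).re) (fun y => (w y).im) h) (hc : ContDiffOn ℝ ∞ c O)
    (hw : ContDiffOn ℝ ∞ w O) {y : E} (hy : y ∈ O) :
    ((formCLM (ricciCoord G y) (F 0 y) (F 0 y) - formCLM (ricciCoord G y) (F 1 y) (F 1 y) : ℝ) : ℂ)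
      - Complex.I * (formCLM (ricciCoord G y) (F 0 y) (F 1 y)
        + formCLM (ricciCoord G y) (F 1 y) (F 0 y) : ℝ) =
      cdir (F 0) (F 1) (fun z => w z - c z) y
      - 2 * cdir (F 0) (F 1) (cdir (F 0) (F 1) (fun z => (f z : ℂ))) y
      + 2 * cdir (F 0) (F 1) (fun z => (f z : ℂ)) y ^ 2 - 1 / 2 * (w y - c y) ^ 2 := by
  have hn := N.isOpen.mem_nhds hy
  have dc : DifferentiableAt ℝ c y := (hc.differentiableOn (by simp)).differentiableAt hn
  have dw : DifferentiableAt ℝ w y := (hw.differentiableOn (by simp)).differentiableAt hn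
  have hf : ∀ z ∈ O, DifferentiableAt ℝ f z := fun z hz =>
    (N.smooth_f.differentiableOn (by simp)).differentiableAt (N.isOpen.mem_nhds hz)
  have e : cdir (F 0) (F 1) (fun z => (f z : ℂ)) =ᶠ[nhds y] fun z =>
      (frameDeriv F 0 f z : ℂ) - Complex.I * frameDeriv F 1 f z :=
    Filter.eventually_of_mem hn fun z hz => cdir_ofReal (hf z hz)
  have d0 : DifferentiableAt ℝ (fun z => (frameDeriv F 0 f z : ℂ)) y :=
    Complex.ofRealCLM.differentiableAt.comp y (N.differentiableAt hy).1
  have d1 : DifferentiableAt ℝ (fun z => (frameDeriv F 1 f z : ℂ)) y :=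
    Complex.ofRealCLM.differentiableAt.comp y (N.differentiableAt hy).2.1
  rw [N.ricci_AA_sub_BB hy, N.ricci_AB_add_BA hy, cdir_congr e, cdir_sub d0 (d1.const_mul _),
    cdir_const_mul _ d1, cdir_ofReal (hf y hy), cdir_sub dw dc, cdir_ofReal (N.differentiableAt hy).1,
    cdir_ofReal (N.differentiableAt hy).2.1]
  simp only [cdir, frameDeriv, fderiv_re dc, fderiv_im dc, fderiv_re dw, fderiv_im dw]
  apply Complex.ext <;> simp [pow_two] <;> ring

end NullFrame

end ComplexFormulas

/-! ### Insertion of the profile f = (1/2) log a² - log cos((r+s)/2). -/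

section LocalProfile

set_option maxSynthPendingDepth 3

variable {E₀ : Type*} [NormedAddCommGroup E₀] [NormedSpace ℝ E₀]

/-- The function `tan ((r + s) / 2)`. -/
noncomputable def halfTan (s : E₀ → ℝ) (y : E₀ × ℝ) : ℝ := Real.tan ((y.2 + s y.1) / 2)

theorem hasFDerivAt_halfAngle {s : E₀ → ℝ} {y : E₀ × ℝ} (hs : DifferentiableAt ℝ s y.1) :
    HasFDerivAt (fun y : E₀ × ℝ => (y.2 + s y.1) / 2)
      ((1 / 2 : ℝ) • (ContinuousLinearMap.snd ℝ E₀ ℝ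
        + (fderiv ℝ s y.1).comp (ContinuousLinearMap.fst ℝ E₀ ℝ))) y := by
  have h := (hasFDerivAt_snd (𝕜 := ℝ) (p := y)).add (hs.hasFDerivAt.comp y hasFDerivAt_fst)
  have h2 := h.const_mul (1 / 2 : ℝ)
  refine h2.congr_of_eventuallyEq (Filter.Eventually.of_forall fun z => ?_)
  simp
  ring

theorem fderiv_halfTan {s : E₀ → ℝ} {y : E₀ × ℝ} (hs : DifferentiableAt ℝ s y.1)
    (hc : Real.cos ((y.2 + s y.1) / 2) ≠ 0) :
    DifferentiableAt ℝ (halfTan s) y ∧ ∀ v, fderiv ℝ (halfTan s) y v =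
      (1 + halfTan s y ^ 2) / 2 * (v.2 + fderiv ℝ s y.1 v.1) := by
  have h : HasFDerivAt (halfTan s) _ y :=
    (Real.hasDerivAt_tan hc).comp_hasFDerivAt y (hasFDerivAt_halfAngle hs)
  refine ⟨h.differentiableAt, fun v => ?_⟩
  rw [h.fderiv, halfTan, ← Real.inv_one_add_tan_sq hc]
  simp
  ring

theorem fderiv_profile {s b : E₀ → ℝ} {y : E₀ × ℝ} (hs : DifferentiableAt ℝ s y.1)
    (hb : DifferentiableAt ℝ b y.1) (hc : Real.cos ((y.2 + s y.1) / 2) ≠ 0) (v : E₀ × ℝ) :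
    fderiv ℝ (fun y : E₀ × ℝ => 1 / 2 * b y.1 - Real.log (Real.cos ((y.2 + s y.1) / 2))) y v =
      1 / 2 * fderiv ℝ b y.1 v.1 + halfTan s y / 2 * (v.2 + fderiv ℝ s y.1 v.1) := by
  have h : HasFDerivAt
      (fun y : E₀ × ℝ => 1 / 2 * b y.1 - Real.log (Real.cos ((y.2 + s y.1) / 2))) _ y :=
    ((hb.hasFDerivAt.comp y hasFDerivAt_fst).const_mul (1 / 2)).sub
      (((Real.hasDerivAt_cos _).comp_hasFDerivAt y (hasFDerivAt_halfAngle hs)).log hc)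
  rw [h.fderiv, halfTan, Real.tan_eq_sin_div_cos]
  simp
  field_simp
  ring

omit [NormedAddCommGroup E₀] [NormedSpace ℝ E₀] in
-- With φ = (r+s)/2 one has τ - i = -i e^{iφ}/cos φ, τ + i = i e^{-iφ}/cos φ and e^{-ir} = e^{is}
-- e^{-2iφ}. This identity separates the fibre variable from the functions on the base in (ii) and
-- (iii).
theorem halfTan_sub_I_mul_exp {s : E₀ → ℝ} {y : E₀ × ℝ}
    (hc : Real.cos ((y.2 + s y.1) / 2) ≠ 0) :
    ((halfTan s y : ℂ) - Complex.I) * Complex.exp (-(Complex.I * y.2)) =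
      -((halfTan s y : ℂ) + Complex.I) * Complex.exp (Complex.I * s y.1) := by
  set φ := (y.2 + s y.1) / 2 with hφ
  have hc' : (Real.cos φ : ℂ) ≠ 0 := by exact_mod_cast hc
  have e1 : Complex.exp (-(Complex.I * y.2)) =
      Complex.exp (Complex.I * s y.1) * Complex.exp (-(Complex.I * φ)) ^ 2 := by
    rw [← Complex.exp_nat_mul, ← Complex.exp_add]
    congr 1
    rw [hφ]
    push_cast
    ring
  have e2 : Complex.exp (-(Complex.I * φ)) = Real.cos φ - Complex.I * Real.sin φ := by
    rw [show -(Complex.I * (φ : ℂ)) = ((-φ : ℝ) : ℂ) * Complex.I by push_cast; ring,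
      Complex.exp_mul_I]
    push_cast
    rw [Complex.cos_neg, Complex.sin_neg]
    ring
  have hT : (halfTan s y : ℂ) = Real.sin φ / Real.cos φ := by
    rw [halfTan, ← hφ, Real.tan_eq_sin_div_cos]
    push_cast
    rfl
  have h1 : (Real.cos φ : ℂ) ^ 2 + (Real.sin φ : ℂ) ^ 2 = 1 := by
    exact_mod_cast Real.cos_sq_add_sin_sq φ
  have hI := Complex.I_sq
  have key : ((Real.sin φ : ℂ) - Complex.I * Real.cos φ) *
      (Real.cos φ - Complex.I * Real.sin φ) ^ 2 = -(Real.sin φ + Complex.I * Real.cos φ) := by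
    linear_combination (-Complex.I) * (Real.cos φ - Complex.I * Real.sin φ) * h1
      + ((Real.cos φ - Complex.I * Real.sin φ) * Real.sin φ * Real.cos φ + Real.sin φ) * hI
  have k1 : (Real.sin φ : ℂ) / Real.cos φ - Complex.I =
      (Real.sin φ - Complex.I * Real.cos φ) / Real.cos φ := by field_simp
  have k2 : (Real.sin φ : ℂ) / Real.cos φ + Complex.I =
      (Real.sin φ + Complex.I * Real.cos φ) / Real.cos φ := by field_simp
  rw [e1, e2, hT, k1, k2]
  linear_combination Complex.exp (Complex.I * s y.1) / Real.cos φ * key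

/-- The vertical part of A - iB is -Re W - i Im W = -W. The differential of `φ` is split as for a
function of l and r + σ, which covers both f and tan((r+s)/2). -/
theorem cdir_localFrame {X Y T : E₀ → E₀} {c x : E₀ → ℂ} {H φ : E₀ × ℝ → ℝ} {y : E₀ × ℝ}
    (hφ : DifferentiableAt ℝ φ y) {l σ : E₀ → ℝ} {A B : ℝ} (hl : DifferentiableAt ℝ l y.1)
    (hσ : DifferentiableAt ℝ σ y.1)
    (h : ∀ v, fderiv ℝ φ y v = A * fderiv ℝ l y.1 v.1 + B * (v.2 + fderiv ℝ σ y.1 v.1)) :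
    cdir (localFrame X Y T c x H 0) (localFrame X Y T c x H 1) (fun y => (φ y : ℂ)) y =
      A * cdir X Y (fun z => (l z : ℂ)) y.1
        + B * (cdir X Y (fun z => (σ z : ℂ)) y.1 - localW c x y) := by
  rw [cdir_ofReal hφ, cdir_ofReal hl, cdir_ofReal hσ, h, h]
  simp only [localFrame, Matrix.cons_val]
  push_cast
  linear_combination -(B : ℂ) * Complex.re_add_im (localW c x y)

theorem cdir_localFrame_fst {X Y T : E₀ → E₀} {c x : E₀ → ℂ} {H : E₀ × ℝ → ℝ} {φ : E₀ → ℂ}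
    {y : E₀ × ℝ} (hφ : DifferentiableAt ℝ φ y.1) :
    cdir (localFrame X Y T c x H 0) (localFrame X Y T c x H 1) (fun y => φ y.1) y =
      cdir X Y φ y.1 := by
  simp only [cdir, fderiv_comp_fst hφ]
  rfl

/-- The left-hand side of the equation `∂ log a² + i ∂s - 2 x e^{is} = -2c/3`. -/
noncomputable def localEq (X Y : E₀ → E₀) (x : E₀ → ℂ) (a s : E₀ → ℝ) (z : E₀) : ℂ :=
  cdir X Y (fun z => ((Real.log (a z ^ 2) : ℝ) : ℂ)) z
    + Complex.I * cdir X Y (fun z => (s z : ℂ)) z - 2 * x z * Complex.exp (Complex.I * s z)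

/-- The function `t = c + ∂ log a² - x e^{is}`. -/
noncomputable def localT (X Y : E₀ → E₀) (c x : E₀ → ℂ) (a s : E₀ → ℝ) (z : E₀) : ℂ :=
  c z + cdir X Y (fun z => ((Real.log (a z ^ 2) : ℝ) : ℂ)) z - x z * Complex.exp (Complex.I * s z)

/-- The algebra behind (iii): here t = C + L - ψ, `h₁` is the equation of (ii), `h₂` the rotation
identity for w, and δf has been written as (1/2)(1 + iτ) t + (1/2)(w - C). The derivatives `Dg` of w
- c cancel and the factor 1 + iτ splits off. -/
theorem profile_identity {C L ψ S w τ Dt Dg : ℂ}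
    (h₁ : L + Complex.I * S - 2 * ψ = -(2 * C / 3))
    (h₂ : (τ - Complex.I) * w = -(τ + Complex.I) * ψ) :
    Dg - 2 * (1 / 2 * ((1 + Complex.I * τ) * Dt + (C + L - ψ) * (Complex.I * ((1 + τ ^ 2) / 2 *
      (S - (Complex.I * w - Complex.I / 3 * C))))) + 1 / 2 * Dg)
      + 2 * (1 / 2 * ((1 + Complex.I * τ) * (C + L - ψ)) + 1 / 2 * (w - C)) ^ 2
      - 1 / 2 * (w - C) ^ 2 =
    -(1 + Complex.I * τ) * (Dt + (C + L - ψ) * (C - (C + L - ψ))) := by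
  linear_combination (-1 / 2 * (C + L - ψ) * (1 + Complex.I * τ) * (1 - Complex.I * τ)) * h₁
    + 1 / 2 * Complex.I * (C + L - ψ) * (1 + Complex.I * τ) * h₂
    + ((C + L - ψ) * (1 + Complex.I * τ) * (1 / 2 * (1 - Complex.I * τ) * (w - C / 3)
        - 1 / 2 * (ψ - w))
      - (C + L - ψ) * Complex.I / 2 * τ ^ 2
        * (S - (Complex.I * w - Complex.I / 3 * C))) * Complex.I_sq

variable [FiniteDimensional ℝ E₀]

/-- The metric of a chart: scalar products in the frame of a quasi-Fefferman metric. -/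
structure LocalMetric (Ω : Set E₀) (X Y T : E₀ → E₀) (c x : E₀ → ℂ) (O : Set (E₀ × ℝ))
    (H f : E₀ × ℝ → ℝ)
    (G : E₀ × ℝ → Matrix (Fin (Module.finrank ℝ (E₀ × ℝ))) (Fin (Module.finrank ℝ (E₀ × ℝ))) ℝ) :
    Prop extends LocalCR Ω X Y T c where
  smooth_x : ContDiffOn ℝ ∞ x Ω
  isOpen_O : IsOpen O
  fst_mem : ∀ y ∈ O, y.1 ∈ Ω
  smooth_H : ContDiffOn ℝ ∞ H O
  smooth_f : ContDiffOn ℝ ∞ f O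
  symm : ∀ y i j, G y i j = G y j i
  form : ∀ a b, ∀ z ∈ O, formCLM (G z) (localFrame X Y T c x H a z)
      (localFrame X Y T c x H b z) = Real.exp (2 * f z) * frameForm a b


namespace LocalMetric

variable {Ω : Set E₀} {X Y T : E₀ → E₀} {c x : E₀ → ℂ} {O : Set (E₀ × ℝ)} {H f : E₀ × ℝ → ℝ}
  {G : E₀ × ℝ → Matrix (Fin (Module.finrank ℝ (E₀ × ℝ))) (Fin (Module.finrank ℝ (E₀ × ℝ))) ℝ}

theorem nullFrame (D : LocalMetric Ω X Y T c x O H f G) :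
    ∃ k α β h, NullFrame G O (localFrame X Y T c x H) f k (fun y => (c y.1).re)
      (fun y => (c y.1).im) α β (fun y => (localw x y).re) (fun y => (localw x y).im) h :=
  D.toLocalCR.nullFrame D.smooth_x D.isOpen_O D.fst_mem D.smooth_H D.smooth_f D.symm D.form

theorem ricci_VV (D : LocalMetric Ω X Y T c x O H f G) {y : E₀ × ℝ} (hy : y ∈ O) :
    formCLM (ricciCoord G y) (0, 1) (0, 1) =
      1 / 2 - 2 * deriv (deriv fun r => f (y.1, r)) y.2 + 2 * deriv (fun r => f (y.1, r)) y.2 ^ 2 := by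
  obtain ⟨k, α, β, h, N⟩ := D.nullFrame
  have df : ∀ z ∈ O, DifferentiableAt ℝ f z := fun z hz =>
    (D.smooth_f.contDiffAt (D.isOpen_O.mem_nhds hz)).differentiableAt (by simp)
  have e1 : ∀ z ∈ O, frameDeriv (localFrame X Y T c x H) 3 f z = deriv (fun r => f (z.1, r)) z.2 :=
    fun z hz => fderiv_vertical (df z hz)
  have e2 : frameDeriv (localFrame X Y T c x H) 3 (frameDeriv (localFrame X Y T c x H) 3 f) y =
      deriv (deriv fun r => f (y.1, r)) y.2 := by
    refine (fderiv_vertical (N.differentiableAt hy).2.2.2.1).trans ?_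
    refine Filter.EventuallyEq.deriv_eq ?_
    have hc : ContinuousAt (fun r : ℝ => (y.1, r)) y.2 := by fun_prop
    filter_upwards [hc (D.isOpen_O.mem_nhds hy)] with r hr
    exact e1 _ hr
  have := N.ricci_VV hy
  rw [e1 y hy, e2] at this
  exact this

variable {a s : E₀ → ℝ}

omit [NormedAddCommGroup E₀] [NormedSpace ℝ E₀] [FiniteDimensional ℝ E₀] in
theorem localw_eq {y : E₀ × ℝ} (hc : Real.cos ((y.2 + s y.1) / 2) ≠ 0) :
    ((halfTan s y : ℂ) - Complex.I) * localw x y =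
      -((halfTan s y : ℂ) + Complex.I) * (x y.1 * Complex.exp (Complex.I * s y.1)) := by
  rw [localw]
  linear_combination x y.1 * halfTan_sub_I_mul_exp hc

omit [FiniteDimensional ℝ E₀] in
theorem smooth_log_sq (ha : ContDiffOn ℝ ∞ a Ω) (ha0 : ∀ z ∈ Ω, a z ≠ 0) :
    ContDiffOn ℝ ∞ (fun z => Real.log (a z ^ 2)) Ω :=
  (ha.pow 2).log fun z hz => pow_ne_zero 2 (ha0 z hz)

theorem fderiv_f (D : LocalMetric Ω X Y T c x O H f G) (ha : ContDiffOn ℝ ∞ a Ω)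
    (ha0 : ∀ z ∈ Ω, a z ≠ 0) (hs : ContDiffOn ℝ ∞ s Ω)
    (hc : ∀ y ∈ O, Real.cos ((y.2 + s y.1) / 2) ≠ 0)
    (hf : ∀ y ∈ O, f y = 1 / 2 * Real.log (a y.1 ^ 2) - Real.log (Real.cos ((y.2 + s y.1) / 2)))
    {y : E₀ × ℝ} (hy : y ∈ O) (v : E₀ × ℝ) :
    fderiv ℝ f y v = 1 / 2 * fderiv ℝ (fun z => Real.log (a z ^ 2)) y.1 v.1
      + halfTan s y / 2 * (v.2 + fderiv ℝ s y.1 v.1) := by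
  have hn := D.isOpen.mem_nhds (D.fst_mem y hy)
  rw [← fderiv_profile ((hs.contDiffAt hn).differentiableAt (by simp))
    (((smooth_log_sq ha ha0).contDiffAt hn).differentiableAt (by simp)) (hc y hy)]
  rw [Filter.EventuallyEq.fderiv_eq (Filter.eventually_of_mem (D.isOpen_O.mem_nhds hy) hf)]

theorem cdir_f (D : LocalMetric Ω X Y T c x O H f G) (ha : ContDiffOn ℝ ∞ a Ω)
    (ha0 : ∀ z ∈ Ω, a z ≠ 0) (hs : ContDiffOn ℝ ∞ s Ω)
    (hc : ∀ y ∈ O, Real.cos ((y.2 + s y.1) / 2) ≠ 0)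
    (hf : ∀ y ∈ O, f y = 1 / 2 * Real.log (a y.1 ^ 2) - Real.log (Real.cos ((y.2 + s y.1) / 2)))
    {y : E₀ × ℝ} (hy : y ∈ O) :
    cdir (localFrame X Y T c x H 0) (localFrame X Y T c x H 1) (fun y => (f y : ℂ)) y =
      1 / 2 * cdir X Y (fun z => ((Real.log (a z ^ 2) : ℝ) : ℂ)) y.1
        + halfTan s y / 2 * (cdir X Y (fun z => (s z : ℂ)) y.1 - localW c x y) := by
  have hn := D.isOpen.mem_nhds (D.fst_mem y hy)
  have := cdir_localFrame (X := X) (Y := Y) (T := T) (c := c) (x := x) (H := H)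
    ((D.smooth_f.contDiffAt (D.isOpen_O.mem_nhds hy)).differentiableAt (by simp))
    (((smooth_log_sq ha ha0).contDiffAt hn).differentiableAt (by simp))
    ((hs.contDiffAt hn).differentiableAt (by simp)) (D.fderiv_f ha ha0 hs hc hf hy)
  rw [this]
  push_cast
  ring

/-- Substituting Vf = τ/2, the terms with w occur only through (τ - i)w, which equals -(τ + i) x
e^{is}. Hence τ + i divides the whole expression and the cofactor lives on the base. -/
theorem ricci_e₁_V (D : LocalMetric Ω X Y T c x O H f G) (ha : ContDiffOn ℝ ∞ a Ω)
    (ha0 : ∀ z ∈ Ω, a z ≠ 0) (hs : ContDiffOn ℝ ∞ s Ω)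
    (hc : ∀ y ∈ O, Real.cos ((y.2 + s y.1) / 2) ≠ 0)
    (hf : ∀ y ∈ O, f y = 1 / 2 * Real.log (a y.1 ^ 2) - Real.log (Real.cos ((y.2 + s y.1) / 2)))
    {y : E₀ × ℝ} (hy : y ∈ O) :
    (formCLM (ricciCoord G y) (localFrame X Y T c x H 0 y) (0, 1) : ℂ)
      - Complex.I * formCLM (ricciCoord G y) (localFrame X Y T c x H 1 y) (0, 1) =
      1 / 2 * (halfTan s y + Complex.I) * (localEq X Y x a s y.1 + 2 * c y.1 / 3) := by
  obtain ⟨k, α, β, h, N⟩ := D.nullFrame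
  have hn := D.isOpen.mem_nhds (D.fst_mem y hy)
  have hf' := fun y hy => D.fderiv_f ha ha0 hs hc hf (y := y) hy
  have ds := (hs.contDiffAt hn).differentiableAt (by simp)
  have dl := ((smooth_log_sq ha ha0).contDiffAt hn).differentiableAt (by simp)
  have hV : ∀ z ∈ O, frameDeriv (localFrame X Y T c x H) 3 f z = halfTan s z / 2 := by
    intro z hz
    refine (hf' z hz (0, 1)).trans ?_
    simp
  have hT := fderiv_halfTan ds (hc y hy)
  have hT2 : HasFDerivAt (fun z => halfTan s z / 2) ((1 / 2 : ℝ) • fderiv ℝ (halfTan s) y) y := by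
    have := hT.1.hasFDerivAt.const_mul (1 / 2 : ℝ)
    refine this.congr_of_eventuallyEq (Filter.Eventually.of_forall fun z => ?_)
    ring
  have h1 : cdir (localFrame X Y T c x H 0) (localFrame X Y T c x H 1)
      (fun z => (frameDeriv (localFrame X Y T c x H) 3 f z : ℂ)) y =
      (1 + halfTan s y ^ 2) / 4 * (cdir X Y (fun z => (s z : ℂ)) y.1 - localW c x y) := by
    have e : (fun z => (frameDeriv (localFrame X Y T c x H) 3 f z : ℂ)) =ᶠ[nhds y]
        fun z => ((halfTan s z / 2 : ℝ) : ℂ) :=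
      Filter.eventually_of_mem (D.isOpen_O.mem_nhds hy) fun z hz => by
        simp only [hV z hz]
    -- The function τ/2 depends on r + s alone, hence `A := 0`; the factor B is half of the
    -- derivative (1 + τ²)/2 of the half-angle tangent.
    rw [cdir_congr e, cdir_localFrame (A := 0) (B := (1 + halfTan s y ^ 2) / 4)
      hT2.differentiableAt dl ds ?_]
    · push_cast
      ring
    · intro v
      rw [hT2.fderiv, smul_apply, hT.2]
      simp
      ring
  have key := N.ricci_e₁_V (c := fun y => c y.1) (w := localw x) hy
  rw [h1, D.cdir_f ha ha0 hs hc hf hy, hV y hy] at key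
  refine Eq.trans key ?_
  have hw := localw_eq (x := x) (hc y hy)
  simp only [localEq, localW]
  push_cast
  linear_combination hw - (1 / 2 * cdir X Y (fun z => (s z : ℂ)) y.1
    + halfTan s y / 2 * (localw x y - c y.1 / 3)) * Complex.I_sq

/-- The equation of (ii) eliminates ∂s from δf, giving 2δf = (1 + iτ) t + w - c. This is why t is
the natural unknown; the second derivative then follows by the product rule and `profile_identity`
finishes. -/
theorem ricci_e₁_e₁ (D : LocalMetric Ω X Y T c x O H f G) (ha : ContDiffOn ℝ ∞ a Ω)
    (ha0 : ∀ z ∈ Ω, a z ≠ 0) (hs : ContDiffOn ℝ ∞ s Ω)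
    (hc : ∀ y ∈ O, Real.cos ((y.2 + s y.1) / 2) ≠ 0)
    (hf : ∀ y ∈ O, f y = 1 / 2 * Real.log (a y.1 ^ 2) - Real.log (Real.cos ((y.2 + s y.1) / 2)))
    (heq : ∀ z ∈ Ω, localEq X Y x a s z = -(2 * c z / 3)) {y : E₀ × ℝ} (hy : y ∈ O) :
    ((formCLM (ricciCoord G y) (localFrame X Y T c x H 0 y) (localFrame X Y T c x H 0 y)
      - formCLM (ricciCoord G y) (localFrame X Y T c x H 1 y) (localFrame X Y T c x H 1 y) : ℝ) : ℂ)
      - Complex.I * (formCLM (ricciCoord G y) (localFrame X Y T c x H 0 y)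
          (localFrame X Y T c x H 1 y)
        + formCLM (ricciCoord G y) (localFrame X Y T c x H 1 y)
          (localFrame X Y T c x H 0 y) : ℝ) =
      -(1 + Complex.I * halfTan s y) * (cdir X Y (localT X Y c x a s) y.1
        + localT X Y c x a s y.1 * (c y.1 - localT X Y c x a s y.1)) := by
  obtain ⟨k, α, β, h, N⟩ := D.nullFrame
  have hn := D.isOpen.mem_nhds (D.fst_mem y hy)
  have ds := (hs.contDiffAt hn).differentiableAt (by simp)
  have dl := ((smooth_log_sq ha ha0).contDiffAt hn).differentiableAt (by simp)
  have hw' := contDiffOn_localw D.smooth_x D.fst_mem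
  have hc' : ContDiffOn ℝ ∞ (fun y : E₀ × ℝ => c y.1) O :=
    D.smooth_c.comp contDiff_fst.contDiffOn D.fst_mem
  have hcd : ∀ {φ : E₀ → ℝ}, ContDiffOn ℝ ∞ φ Ω →
      ContDiffOn ℝ ∞ (cdir X Y (fun z => (φ z : ℂ))) Ω := by
    intro φ hφ
    have h1 := (Complex.ofRealCLM.contDiff.comp_contDiffOn hφ).fderiv_of_isOpen D.isOpen
      (m := ∞) (by simp)
    exact (h1.clm_apply D.smooth_X).sub (contDiffOn_const.mul (h1.clm_apply D.smooth_Y))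
  have ht : ContDiffOn ℝ ∞ (localT X Y c x a s) Ω :=
    (D.smooth_c.add (hcd (smooth_log_sq ha ha0))).sub (D.smooth_x.mul
      (contDiffOn_const.mul (Complex.ofRealCLM.contDiff.comp_contDiffOn hs)).cexp)
  have dt : DifferentiableAt ℝ (localT X Y c x a s) y.1 :=
    (ht.contDiffAt hn).differentiableAt (by simp)
  have dtf : DifferentiableAt ℝ (fun y : E₀ × ℝ => localT X Y c x a s y.1) y :=
    dt.comp y differentiableAt_fst
  have hT := fderiv_halfTan ds (hc y hy)
  have dT : DifferentiableAt ℝ (fun z => (halfTan s z : ℂ)) y :=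
    Complex.ofRealCLM.differentiableAt.comp y hT.1
  -- the first derivative of `f` in terms of `t`
  have e : cdir (localFrame X Y T c x H 0) (localFrame X Y T c x H 1) (fun y => (f y : ℂ))
      =ᶠ[nhds y] fun z => 1 / 2 * ((1 + Complex.I * halfTan s z) * localT X Y c x a s z.1)
        + 1 / 2 * (localw x z - c z.1) := by
    refine Filter.eventually_of_mem (D.isOpen_O.mem_nhds hy) fun z hz => ?_
    have h1 := heq z.1 (D.fst_mem z hz)
    have h2 := localw_eq (x := x) (hc z hz)
    beta_reduce
    rw [D.cdir_f ha ha0 hs hc hf hz]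
    simp only [localEq, localT, localW] at h1 ⊢
    linear_combination (-1 / 2 * Complex.I * halfTan s z) * h1 - 1 / 2 * Complex.I * h2
      + (halfTan s z / 2 * cdir X Y (fun z => (s z : ℂ)) z.1
        + 1 / 2 * (x z.1 * Complex.exp (Complex.I * s z.1) - localw x z)) * Complex.I_sq
  have hTd : cdir (localFrame X Y T c x H 0) (localFrame X Y T c x H 1)
      (fun z => (halfTan s z : ℂ)) y =
      (1 + halfTan s y ^ 2) / 2 * (cdir X Y (fun z => (s z : ℂ)) y.1 - localW c x y) := by
    rw [cdir_localFrame (A := 0) (B := (1 + halfTan s y ^ 2) / 2) hT.1 dl ds fun v => ?_]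
    · push_cast
      ring
    · rw [hT.2]
      ring
  have key := N.ricci_e₁_e₁ (c := fun y => c y.1) (w := localw x) hc' hw' hy
  have dwc : DifferentiableAt ℝ (fun z : E₀ × ℝ => localw x z - c z.1) y :=
    ((hw'.sub hc').contDiffAt (D.isOpen_O.mem_nhds hy)).differentiableAt (by simp)
  have d1 : DifferentiableAt ℝ (fun z => 1 + Complex.I * (halfTan s z : ℂ)) y :=
    (dT.const_mul _).const_add _
  have hdd : cdir (localFrame X Y T c x H 0) (localFrame X Y T c x H 1)
      (cdir (localFrame X Y T c x H 0) (localFrame X Y T c x H 1) (fun y => (f y : ℂ))) y =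
      1 / 2 * ((1 + Complex.I * halfTan s y) * cdir X Y (localT X Y c x a s) y.1
        + localT X Y c x a s y.1 * (Complex.I * ((1 + halfTan s y ^ 2) / 2 *
          (cdir X Y (fun z => (s z : ℂ)) y.1 - localW c x y))))
      + 1 / 2 * cdir (localFrame X Y T c x H 0) (localFrame X Y T c x H 1)
        (fun z => localw x z - c z.1) y := by
    rw [cdir_congr e, cdir_add ((d1.fun_mul dtf).const_mul _) (dwc.const_mul _),
      cdir_const_mul _ (d1.fun_mul dtf), cdir_const_mul _ dwc, cdir_mul d1 dtf,
      cdir_localFrame_fst dt, cdir_add (differentiableAt_const _) (dT.const_mul _), cdir_const,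
      cdir_const_mul _ dT, hTd, zero_add]
  rw [hdd, e.self_of_nhds] at key
  refine Eq.trans key ?_
  have h₁ := heq y.1 (D.fst_mem y hy)
  rw [localEq] at h₁
  exact profile_identity (by linear_combination h₁)
    (localw_eq (x := x) (hc y hy))

end LocalMetric

end LocalProfile

/-! ### Brackets of the CR frame when μ is exact. -/

section LocalCoframe

set_option maxSynthPendingDepth 3

variable {E₀ : Type*} [NormedAddCommGroup E₀] [NormedSpace ℝ E₀] [FiniteDimensional ℝ E₀]

/-- As dζ is constant on X, Y and T, it vanishes on [X,T] and [Y,T]. The kernel of dζ is spanned by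
T, so both brackets are multiples of T, with coefficients given by the definition of c. -/
theorem LocalCR.of_coframe {Ω : Set E₀} {X Y T : E₀ → E₀} {c : E₀ → ℂ}
    (hE : Module.finrank ℝ E₀ = 3) (hΩ : IsOpen Ω) (hX : ContDiffOn ℝ ∞ X Ω)
    (hY : ContDiffOn ℝ ∞ Y Ω) (hT : ContDiffOn ℝ ∞ T Ω)
    (hXY : ∀ z ∈ Ω, lieBracket ℝ X Y z = -(1/2 : ℝ) • T z)
    {ζ : E₀ → ℂ} (hζ : ContDiffOn ℝ ∞ ζ Ω) {lam : E₀ → E₀ →ₗ[ℝ] ℝ}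
    (muX : ∀ z ∈ Ω, fderiv ℝ ζ z (X z) = 1 / 2)
    (muY : ∀ z ∈ Ω, fderiv ℝ ζ z (Y z) = Complex.I / 2)
    (muT : ∀ z ∈ Ω, fderiv ℝ ζ z (T z) = 0)
    (lamX : ∀ z ∈ Ω, lam z (X z) = 0) (lamY : ∀ z ∈ Ω, lam z (Y z) = 0)
    (lamT : ∀ z ∈ Ω, lam z (T z) = 1)
    (hc : ∀ z ∈ Ω, c z = -((lam z (lieBracket ℝ X T z) : ℂ)
      - Complex.I * (lam z (lieBracket ℝ Y T z) : ℂ))) : LocalCR Ω X Y T c := by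
  have hli : ∀ z ∈ Ω, LinearIndependent ℝ ![X z, Y z, T z] := by
    intro z hz
    refine Fintype.linearIndependent_iff.2 fun g hg => ?_
    simp only [Fin.sum_univ_three, Matrix.cons_val] at hg
    have h1 := congrArg (fderiv ℝ ζ z) hg
    have h2 := congrArg (lam z) hg
    simp only [map_add, map_smul, muX z hz, muY z hz, muT z hz, lamX z hz, lamY z hz, lamT z hz,
      map_zero] at h1 h2
    have h3 := congrArg Complex.re h1
    have h4 := congrArg Complex.im h1
    simp at h2 h3 h4
    intro i
    fin_cases i
    exacts [h3, h4, h2]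
  have hcard : Fintype.card (Fin 3) = Module.finrank ℝ E₀ := by simp [hE]
  let F : Fin 3 → E₀ → E₀ := ![X, Y, T]
  have hF : ∀ z, (fun a => F a z) = ![X z, Y z, T z] := fun z => by
    funext a
    fin_cases a <;> rfl
  have hFs : ∀ z ∈ Ω, ∀ a, ContDiffAt ℝ ∞ (F a) z := by
    intro z hz a
    have hn := hΩ.mem_nhds hz
    fin_cases a
    exacts [hX.contDiffAt hn, hY.contDiffAt hn, hT.contDiffAt hn]
  have dual : ∀ z ∈ Ω, ∀ v, v = dualCoframe F z 0 v • X z + dualCoframe F z 1 v • Y z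
      + dualCoframe F z 2 v • T z := by
    intro z hz v
    have := (dualCoframe_spec (F := F) (z := z) (by rw [hF]; exact hli z hz) hcard).1 v
    rwa [Fin.sum_univ_three] at this
  have kerζ : ∀ z ∈ Ω, ∀ v, fderiv ℝ ζ z v = 0 → v = lam z v • T z := by
    intro z hz v hv
    have h0 := dual z hz v
    have h1 := congrArg (fderiv ℝ ζ z) h0
    have h2 := congrArg (lam z) h0
    simp only [map_add, map_smul, muX z hz, muY z hz, muT z hz, lamX z hz, lamY z hz, lamT z hz,
      hv] at h1 h2
    have h3 := congrArg Complex.re h1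
    have h4 := congrArg Complex.im h1
    simp at h2 h3 h4
    rw [h2]
    rw [h3, h4, zero_smul, zero_smul, zero_add, zero_add] at h0
    exact h0
  -- No smoothness of `lam` is assumed. It follows from this identification with a member of the
  -- dual coframe, and gives the smoothness of `c`.
  have lam_eq : ∀ z ∈ Ω, ∀ v, lam z v = dualCoframe F z 2 v := by
    intro z hz v
    have h2 := congrArg (lam z) (dual z hz v)
    simpa [lamX z hz, lamY z hz, lamT z hz] using h2
  have dζ : ∀ {Z : E₀ → E₀} {k : ℂ} {z : E₀}, z ∈ Ω → ContDiffOn ℝ ∞ Z Ω →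
      (∀ z ∈ Ω, fderiv ℝ ζ z (Z z) = k) → fderiv ℝ ζ z (lieBracket ℝ Z T z) = 0 := by
    intro Z k z hz hZ hk
    have hn := hΩ.mem_nhds hz
    rw [← fderiv_fderiv_sub ((hζ.contDiffAt hn).of_le (by norm_cast))
      ((hZ.contDiffAt hn).differentiableAt (by simp))
      ((hT.contDiffAt hn).differentiableAt (by simp)),
      Filter.EventuallyEq.fderiv_eq (𝕜 := ℝ) (f := fun _ => (0 : ℂ))
        (Filter.eventually_of_mem hn muT),
      Filter.EventuallyEq.fderiv_eq (𝕜 := ℝ) (f := fun _ => k) (Filter.eventually_of_mem hn hk)]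
    simp
  have hbr : ∀ {Z : E₀ → E₀}, ContDiffOn ℝ ∞ Z Ω → ContDiffOn ℝ ∞ (lieBracket ℝ Z T) Ω := by
    intro Z hZ
    exact ((hT.fderiv_of_isOpen hΩ (m := ∞) (by simp)).clm_apply hZ).sub
      ((hZ.fderiv_of_isOpen hΩ (m := ∞) (by simp)).clm_apply hT)
  have hls : ∀ {Z : E₀ → E₀}, ContDiffOn ℝ ∞ Z Ω →
      ContDiffOn ℝ ∞ (fun z => ((lam z (lieBracket ℝ Z T z) : ℝ) : ℂ)) Ω := by
    intro Z hZ
    refine Complex.ofRealCLM.contDiff.comp_contDiffOn ?_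
    refine ContDiffOn.congr (f := fun z => dualCoframe F z 2 (lieBracket ℝ Z T z)) ?_
      fun z hz => lam_eq z hz _
    refine ContDiffOn.clm_apply (fun z hz => ContDiffAt.contDiffWithinAt ?_) (hbr hZ)
    exact (dualCoframe_spec (F := F) (z := z) (by rw [hF]; exact hli z hz) hcard).2.2 (hFs z hz) 2
  refine ⟨hE, hΩ, hX, hY, hT, ?_, hli, hXY, fun z hz => ?_, fun z hz => ?_⟩
  · exact ((hls hX).sub (contDiffOn_const.mul (hls hY))).neg.congr hc
  · rw [hc z hz]
    simpa using kerζ z hz _ (dζ hz hX muX)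
  · rw [hc z hz]
    simpa using kerζ z hz _ (dζ hz hY muY)

end LocalCoframe

/-! ### Vector fields, functions and metrics of a manifold read in a preferred chart. -/

section ChartFields

variable {E : Type*} [NormedAddCommGroup E] [NormedSpace ℝ E]
  {H : Type*} [TopologicalSpace H] {I : ModelWithCorners ℝ E H} [I.Boundaryless]
  {N : Type*} [TopologicalSpace N] [ChartedSpace H N] [IsManifold I ∞ N]

theorem mfderiv_extChartAt_mfderiv_symm {p : N} {y : E} (hy : y ∈ (extChartAt I p).target)
    (v : E) : mfderiv I 𝓘(ℝ, E) (extChartAt I p) ((extChartAt I p).symm y)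
      (mfderiv 𝓘(ℝ, E) I (extChartAt I p).symm y v) = v := by
  have h := mfderiv_extChartAt_comp_mfderivWithin_extChartAt_symm (I := I) hy
  rw [I.range_eq_univ, mfderivWithin_univ] at h
  exact congrArg (fun L => L v) h

theorem isInvertible_mfderiv_extChartAt_symm {p : N} {y : E} (hy : y ∈ (extChartAt I p).target) :
    (mfderiv 𝓘(ℝ, E) I (extChartAt I p).symm y).IsInvertible := by
  have h := isInvertible_mfderivWithin_extChartAt_symm (I := I) hy
  rwa [I.range_eq_univ, mfderivWithin_univ] at h

theorem contMDiffAt_extChartAt_symm {p : N} {y : E} (hy : y ∈ (extChartAt I p).target) :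
    ContMDiffAt 𝓘(ℝ, E) I ∞ (extChartAt I p).symm y :=
  (contMDiffOn_extChartAt_symm (n := ∞) p).contMDiffAt ((isOpen_extChartAt_target p).mem_nhds hy)

variable [FiniteDimensional ℝ E]

/-- A vector field in the preferred chart at `p`. -/
noncomputable def chartField (p : N) (V : ∀ p : N, TangentSpace I p) (y : E) : E :=
  mpullback 𝓘(ℝ, E) I (extChartAt I p).symm V y

omit [FiniteDimensional ℝ E] in
theorem mfderiv_chartField {p : N} (V : ∀ p : N, TangentSpace I p) {y : E}
    (hy : y ∈ (extChartAt I p).target) :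
    mfderiv 𝓘(ℝ, E) I (extChartAt I p).symm y (chartField (E := E) p V y) =
      V ((extChartAt I p).symm y) := by
  obtain ⟨A, hA⟩ := isInvertible_mfderiv_extChartAt_symm hy
  have h : chartField p V y = A.symm (V ((extChartAt I p).symm y)) := by
    rw [chartField, mpullback_apply, ← hA, ContinuousLinearMap.inverse_equiv]
    rfl
  rw [h, ← hA]
  exact A.apply_symm_apply _

theorem contDiffOn_chartField {p : N} {V : ∀ p : N, TangentSpace I p}
    (hV : ContMDiff I I.tangent ∞ (fun p => (⟨p, V p⟩ : TangentBundle I N))) :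
    ContDiffOn ℝ ∞ (chartField p V) (extChartAt I p).target := by
  intro y hy
  have h := ContMDiffAt.mpullback_vectorField_preimage (m := ∞) (n := ∞)
    (hV ((extChartAt I p).symm y)) (contMDiffAt_extChartAt_symm hy)
    (isInvertible_mfderiv_extChartAt_symm hy) (by simp)
  exact (contMDiffAt_vectorSpace_iff_contDiffAt.1 h).contDiffWithinAt

theorem chartField_mlieBracket {p : N} {V W : ∀ p : N, TangentSpace I p}
    (hV : ContMDiff I I.tangent ∞ (fun p => (⟨p, V p⟩ : TangentBundle I N)))
    (hW : ContMDiff I I.tangent ∞ (fun p => (⟨p, W p⟩ : TangentBundle I N))) {y : E}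
    (hy : y ∈ (extChartAt I p).target) :
    chartField p (mlieBracket I V W) y = lieBracket ℝ (chartField p V) (chartField p W) y := by
  have : IsManifold I (minSmoothness ℝ 2) N := by
    rw [minSmoothness_of_isRCLikeNormedField]
    infer_instance
  refine (mpullback_mlieBracket (n := ∞) ((hV _).mdifferentiableAt (by simp))
    ((hW _).mdifferentiableAt (by simp)) (contMDiffAt_extChartAt_symm hy)
    (by rw [minSmoothness_of_isRCLikeNormedField]; norm_cast)).trans ?_
  rw [← mlieBracketWithin_univ, mlieBracketWithin_eq_lieBracketWithin]
  exact congrFun (lieBracketWithin_univ (𝕜 := ℝ) (V := chartField p V) (W := chartField p W)) y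

omit [I.Boundaryless] in
theorem contMDiff_mlieBracket {V W : ∀ p : N, TangentSpace I p}
    (hV : ContMDiff I I.tangent ∞ (fun p => (⟨p, V p⟩ : TangentBundle I N)))
    (hW : ContMDiff I I.tangent ∞ (fun p => (⟨p, W p⟩ : TangentBundle I N))) :
    ContMDiff I I.tangent ∞ (fun p => (⟨p, mlieBracket I V W p⟩ : TangentBundle I N)) := by
  have : IsManifold I (minSmoothness ℝ 2) N := by
    rw [minSmoothness_of_isRCLikeNormedField]
    infer_instance
  have : IsManifold I ((⊤ : ℕ∞) + 1) N := by
    rw [show ((⊤ : ℕ∞) : WithTop ℕ∞) + 1 = ∞ from rfl]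
    infer_instance
  exact fun p => ContMDiffAt.mlieBracket_vectorField (n := ⊤) (m := ⊤) (hV p) (hW p) (by simp)

omit [FiniteDimensional ℝ E] in
theorem differential_eq_fderiv {F : Type*} [NormedAddCommGroup F] [NormedSpace ℝ F] {f : N → F}
    {p : N} {y : E} (hy : y ∈ (extChartAt I p).target)
    (hf : MDifferentiableAt I 𝓘(ℝ, F) f ((extChartAt I p).symm y)) (v : E) :
    differential I f ((extChartAt I p).symm y)
      (mfderiv 𝓘(ℝ, E) I (extChartAt I p).symm y v) =
      fderiv ℝ (fun y => f ((extChartAt I p).symm y)) y v := by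
  have h := mfderiv_comp_apply y hf
    ((contMDiffAt_extChartAt_symm hy).mdifferentiableAt (by simp)) v
  rw [← mfderiv_eq_fderiv]
  exact h.symm

omit [FiniteDimensional ℝ E] in
theorem contDiffOn_comp_symm {F : Type*} [NormedAddCommGroup F] [NormedSpace ℝ F] {f : N → F}
    {U : Set N} (hU : IsOpen U) (hf : ContMDiffOn I 𝓘(ℝ, F) ∞ f U) (p : N) :
    ContDiffOn ℝ ∞ (fun y => f ((extChartAt I p).symm y))
      ((extChartAt I p).target ∩ (extChartAt I p).symm ⁻¹' U) := by
  intro y hy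
  have h := ((hf _ hy.2).contMDiffAt (hU.mem_nhds hy.2)).comp y (contMDiffAt_extChartAt_symm hy.1)
  exact (contMDiffAt_iff_contDiffAt.1 h).contDiffWithinAt

omit [FiniteDimensional ℝ E] [IsManifold I ∞ N] in
theorem isOpen_symm_preimage {U : Set N} (hU : IsOpen U) (p : N) :
    IsOpen ((extChartAt I p).target ∩ (extChartAt I p).symm ⁻¹' U) :=
  (continuousOn_extChartAt_symm p).isOpen_inter_preimage (isOpen_extChartAt_target p) hU

omit [I.Boundaryless] [IsManifold I ∞ N] in
/-- The form with the components of a metric in a chart. -/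
theorem formCLM_metricInChart (g : ∀ q : N, LinearMap.BilinForm ℝ (TangentSpace I q)) (p : N)
    (y v w : E) : formCLM (metricInChart I g p y) v w = g ((extChartAt I p).symm y)
      (mfderiv 𝓘(ℝ, E) I (extChartAt I p).symm y v)
      (mfderiv 𝓘(ℝ, E) I (extChartAt I p).symm y w) := by
  let B : LinearMap.BilinForm ℝ E := LinearMap.compl₁₂ (g ((extChartAt I p).symm y))
    (mfderiv 𝓘(ℝ, E) I (extChartAt I p).symm y).toLinearMap
    (mfderiv 𝓘(ℝ, E) I (extChartAt I p).symm y).toLinearMap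
  change _ = B v w
  have hB : ∀ i j, metricInChart I g p y i j =
    B (Module.finBasis ℝ E i) (Module.finBasis ℝ E j) := fun i j => rfl
  rw [formCLM_apply, ← LinearMap.sum_repr_mul_repr_mul (Module.finBasis ℝ E) (Module.finBasis ℝ E)
    v w]
  simp only [hB, coordCLM_apply]
  rw [Finsupp.sum_fintype _ _ (by simp)]
  refine Finset.sum_congr rfl fun i _ => ?_
  rw [Finsupp.sum_fintype _ _ (by simp)]
  refine Finset.sum_congr rfl fun j _ => ?_
  simp only [smul_eq_mul]
  ring

omit [I.Boundaryless] [IsManifold I ∞ N] in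
theorem ricciTensor_apply (g : ∀ q : N, LinearMap.BilinForm ℝ (TangentSpace I q)) (q : N)
    (v w : TangentSpace I q) : ricciTensor I g q v w =
      formCLM (ricciCoord (metricInChart I g q) (extChartAt I q q))
        (mfderiv I 𝓘(ℝ, E) (extChartAt I q) q v) (mfderiv I 𝓘(ℝ, E) (extChartAt I q) q w) := by
  refine (Matrix.toBilin_apply (Module.finBasis ℝ E) _ _ _).trans (Eq.trans ?_ (formCLM_apply (E := E) _ _ _).symm)
  refine Finset.sum_congr rfl fun i _ => Finset.sum_congr rfl fun j _ => ?_
  exact (mul_assoc _ _ _).trans (mul_left_comm _ _ _)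

end ChartFields

/-! ### The real frame on M × ℝ and its scalar products. -/

section ManifoldFrame

variable {M : Type*} [TopologicalSpace M] [ChartedSpace (EuclideanSpace ℝ (Fin 3)) M]

theorem horizontal_apply (q : M × ℝ) (v : TangentSpace (𝓡 3) q.1) : horizontal q v = (v, 0) := by
  have h := mfderiv_prod_left (I := 𝓡 3) (I' := 𝓘(ℝ, ℝ)) (x₀ := q.1) (y₀ := q.2)
  exact congrArg (fun L => L v) h

theorem vertical_eq (q : M × ℝ) : vertical q = ((0, 1) : EuclideanSpace ℝ (Fin 3) × ℝ) := by
  have h := mfderiv_prod_right (I := 𝓡 3) (I' := 𝓘(ℝ, ℝ)) (x₀ := q.1) (y₀ := q.2)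
  exact congrArg (fun L => L (1 : ℝ)) h

theorem mfderiv_fst_horizontal (q : M × ℝ) (v : TangentSpace (𝓡 3) q.1) :
    mfderiv lineModel (𝓡 3) (Prod.fst : M × ℝ → M) q (horizontal q v) = v := by
  rw [horizontal_apply, mfderiv_fst]
  rfl

theorem mfderiv_fst_vertical (q : M × ℝ) :
    mfderiv lineModel (𝓡 3) (Prod.fst : M × ℝ → M) q (vertical q) = 0 := by
  rw [vertical_eq, mfderiv_fst]
  rfl

theorem differential_snd_horizontal (q : M × ℝ) (v : TangentSpace (𝓡 3) q.1) :
    differential lineModel (Prod.snd : M × ℝ → ℝ) q (horizontal q v) = 0 := by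
  rw [horizontal_apply, differential, mfderiv_snd]
  rfl

theorem differential_snd_vertical (q : M × ℝ) :
    differential lineModel (Prod.snd : M × ℝ → ℝ) q (vertical q) = 1 := by
  rw [vertical_eq, differential, mfderiv_snd]
  rfl

variable [IsManifold (𝓡 3) ∞ M] {C : CRStructure M} {η : DistinguishedCoframe C}

namespace DistinguishedCoframe

variable (η)

theorem mu_del0 (p : M) : η.mu p (η.del0 p) = 0 := η.mu_T p

theorem lam_del0 (p : M) : η.lam p (η.del0 p) = 1 := η.lam_T p

theorem contMDiff_X :
    ContMDiff (𝓡 3) (𝓡 3).tangent ∞ (fun p => (⟨p, η.X p⟩ : TangentBundle (𝓡 3) M)) :=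
  contMDiffOn_univ.1 η.frame.1

theorem contMDiff_Y :
    ContMDiff (𝓡 3) (𝓡 3).tangent ∞ (fun p => (⟨p, η.Y p⟩ : TangentBundle (𝓡 3) M)) :=
  contMDiffOn_univ.1 η.frame.2.1

theorem contMDiff_del0 :
    ContMDiff (𝓡 3) (𝓡 3).tangent ∞ (fun p => (⟨p, η.del0 p⟩ : TangentBundle (𝓡 3) M)) :=
  (contMDiff_mlieBracket η.contMDiff_X η.contMDiff_Y).const_smul_section

theorem d_eq (f : M → ℂ) (p : M) : η.d f p =
    differential (𝓡 3) f p (η.X p) - Complex.I * differential (𝓡 3) f p (η.Y p) := by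
  simp [d, cderiv, del]

theorem d_chart {f : M → ℂ} (hf : ContMDiff (𝓡 3) 𝓘(ℝ, ℂ) ∞ f) {p : M}
    {z : EuclideanSpace ℝ (Fin 3)} (hz : z ∈ (extChartAt (𝓡 3) p).target) :
    η.d f ((extChartAt (𝓡 3) p).symm z) = cdir (chartField p η.X) (chartField p η.Y)
      (fun z => f ((extChartAt (𝓡 3) p).symm z)) z := by
  have hf' := (hf ((extChartAt (𝓡 3) p).symm z)).mdifferentiableAt (by simp)
  rw [d_eq, cdir, ← differential_eq_fderiv hz hf', ← differential_eq_fderiv hz hf',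
    mfderiv_chartField _ hz, mfderiv_chartField _ hz]

theorem localCR {ζ : M → ℂ} (hζ : ContMDiff (𝓡 3) 𝓘(ℝ, ℂ) ∞ ζ)
    (hμ : ∀ p, η.mu p = differential (𝓡 3) ζ p) (p : M) :
    LocalCR (extChartAt (𝓡 3) p).target (chartField p η.X) (chartField p η.Y)
      (chartField p η.del0) (fun z => η.c ((extChartAt (𝓡 3) p).symm z)) := by
  have hζ' : ContDiffOn ℝ ∞ (fun z => ζ ((extChartAt (𝓡 3) p).symm z))
      (extChartAt (𝓡 3) p).target := by
    simpa using contDiffOn_comp_symm isOpen_univ hζ.contMDiffOn p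
  have hd : ∀ z ∈ (extChartAt (𝓡 3) p).target, ∀ V : ∀ p : M, TangentSpace (𝓡 3) p,
      fderiv ℝ (fun z => ζ ((extChartAt (𝓡 3) p).symm z)) z (chartField p V z) =
        η.mu ((extChartAt (𝓡 3) p).symm z) (V ((extChartAt (𝓡 3) p).symm z)) := by
    intro z hz V
    rw [← differential_eq_fderiv hz ((hζ _).mdifferentiableAt (by simp)),
      mfderiv_chartField _ hz, hμ]
  refine LocalCR.of_coframe (by simp) (isOpen_extChartAt_target p)
    (contDiffOn_chartField η.contMDiff_X) (contDiffOn_chartField η.contMDiff_Y)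
    (contDiffOn_chartField η.contMDiff_del0) (fun z hz => ?_) hζ'
    (lam := fun z => η.lam ((extChartAt (𝓡 3) p).symm z) ∘ₗ
      (mfderiv 𝓘(ℝ, EuclideanSpace ℝ (Fin 3)) (𝓡 3) (extChartAt (𝓡 3) p).symm z).toLinearMap)
    (fun z hz => ?_) (fun z hz => ?_) (fun z hz => ?_) (fun z hz => ?_) (fun z hz => ?_)
    (fun z hz => ?_) (fun z hz => ?_)
  · rw [← chartField_mlieBracket η.contMDiff_X η.contMDiff_Y hz]
    have : chartField p η.del0 z = (-2 : ℝ) • chartField p (mlieBracket (𝓡 3) η.X η.Y) z :=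
      map_smul (mfderiv 𝓘(ℝ, EuclideanSpace ℝ (Fin 3)) (𝓡 3)
        (extChartAt (𝓡 3) p).symm z).inverse (-2 : ℝ) _
    rw [this, smul_smul]
    norm_num
  · rw [hd z hz, η.mu_X]
  · rw [hd z hz, η.mu_Y]
  · rw [hd z hz, η.mu_del0]
  · exact (congrArg _ (mfderiv_chartField _ hz)).trans (η.lam_X _)
  · exact (congrArg _ (mfderiv_chartField _ hz)).trans (η.lam_Y _)
  · exact (congrArg _ (mfderiv_chartField _ hz)).trans (η.lam_del0 _)
  · rw [← chartField_mlieBracket η.contMDiff_X η.contMDiff_del0 hz,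
      ← chartField_mlieBracket η.contMDiff_Y η.contMDiff_del0 hz]
    exact (congrArg₂ (fun a b : ℝ => -((a : ℂ) - Complex.I * (b : ℂ)))
      (congrArg (η.lam _) (mfderiv_chartField _ hz))
      (congrArg (η.lam _) (mfderiv_chartField _ hz))).symm

end DistinguishedCoframe

namespace QuasiFefferman

variable {U : Set (M × ℝ)} (D : QuasiFefferman η U)

/-- The real frame underlying the standard frame. -/
noncomputable def realFrame (q : M × ℝ) : Fin 4 → TangentSpace lineModel q :=
  ![horizontal q (η.X q.1) - (D.W q).re • vertical q,
    horizontal q (η.Y q.1) + (D.W q).im • vertical q,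
    horizontal q (η.del0 q.1) - D.H q • vertical q, vertical q]

theorem mu_horizontal (q : M × ℝ) (v : TangentSpace (𝓡 3) q.1) :
    D.mu q (horizontal q v) = η.mu q.1 v := congrArg (η.mu q.1) (mfderiv_fst_horizontal q v)

theorem mu_vertical (q : M × ℝ) : D.mu q (vertical q) = 0 :=
  (congrArg (η.mu q.1) (mfderiv_fst_vertical q)).trans (map_zero _)

theorem lam_horizontal (q : M × ℝ) (v : TangentSpace (𝓡 3) q.1) :
    D.lam q (horizontal q v) = η.lam q.1 v := congrArg (η.lam q.1) (mfderiv_fst_horizontal q v)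

theorem lam_vertical (q : M × ℝ) : D.lam q (vertical q) = 0 :=
  (congrArg (η.lam q.1) (mfderiv_fst_vertical q)).trans (map_zero _)

theorem kappa_horizontal (q : M × ℝ) (v : TangentSpace (𝓡 3) q.1) :
    D.kappa q (horizontal q v) = 2 * (D.W q * η.mu q.1 v).re + D.H q * η.lam q.1 v := by
  simp [kappa, differential_snd_horizontal, mu_horizontal, lam_horizontal]

theorem kappa_vertical (q : M × ℝ) : D.kappa q (vertical q) = 1 := by
  simp [kappa, differential_snd_vertical, mu_vertical, lam_vertical]

theorem mu_realFrame (q : M × ℝ) (i : Fin 4) :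
    D.mu q (D.realFrame q i) = (![1 / 2, Complex.I / 2, 0, 0] : Fin 4 → ℂ) i := by
  fin_cases i <;>
    simp [realFrame, mu_horizontal, mu_vertical, η.mu_X, η.mu_Y, η.mu_del0]

theorem lam_realFrame (q : M × ℝ) (i : Fin 4) :
    D.lam q (D.realFrame q i) = (![0, 0, 1, 0] : Fin 4 → ℝ) i := by
  fin_cases i <;>
    simp [realFrame, lam_horizontal, lam_vertical, η.lam_X, η.lam_Y, η.lam_del0]

theorem kappa_realFrame (q : M × ℝ) (i : Fin 4) :
    D.kappa q (D.realFrame q i) = (![0, 0, 0, 1] : Fin 4 → ℝ) i := by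
  fin_cases i <;>
    simp [realFrame, kappa_horizontal, kappa_vertical, η.mu_X, η.mu_Y, η.mu_del0, η.lam_X, η.lam_Y,
      η.lam_del0] <;> ring

theorem metric_apply (q : M × ℝ) (v w : TangentSpace lineModel q) :
    D.metric q v w = 2 * D.P q ^ 2 * ((D.mu q v).re * (D.mu q w).re
      + (D.mu q v).im * (D.mu q w).im
      + (D.lam q v * D.kappa q w + D.kappa q v * D.lam q w) / 2) := by
  change 2 * D.P q ^ 2 * ((D.mu q v * (starRingEnd ℂ) (D.mu q w)).re
        + (D.lam q v * D.kappa q w + D.kappa q v * D.lam q w) / 2) = _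
  simp only [Complex.mul_re, Complex.conj_re, Complex.conj_im]
  ring

theorem metric_realFrame (q : M × ℝ) (i j : Fin 4) :
    D.metric q (D.realFrame q i) (D.realFrame q j) = D.P q ^ 2 * frameForm i j := by
  simp only [metric_apply, mu_realFrame, lam_realFrame, kappa_realFrame, frameForm]
  fin_cases i <;> fin_cases j <;> norm_num
  all_goals ring

theorem metric_comm (q : M × ℝ) (v w : TangentSpace lineModel q) :
    D.metric q v w = D.metric q w v := by
  rw [metric_apply, metric_apply]
  ring

end QuasiFefferman

end ManifoldFrame

/-! ### Identification of the frame on M × ℝ with the local model. -/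

section RicciChart

variable {M : Type*} [TopologicalSpace M] [ChartedSpace (EuclideanSpace ℝ (Fin 3)) M]

theorem horizontal_add_smul_vertical (q : M × ℝ) (v : TangentSpace (𝓡 3) q.1) (a : ℝ) :
    horizontal q v + a • vertical q = (v, a) := by
  rw [horizontal_apply, vertical_eq]
  have h : ∀ v : EuclideanSpace ℝ (Fin 3), (v, (0 : ℝ)) + a • (0, 1) = (v, a) := by simp
  exact h v

theorem horizontal_sub_smul_vertical (q : M × ℝ) (v : TangentSpace (𝓡 3) q.1) (a : ℝ) :
    horizontal q v - a • vertical q = (v, -a) := by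
  rw [← horizontal_add_smul_vertical, neg_smul, sub_eq_add_neg]

theorem extChartAt_lineModel_symm (q : M × ℝ) (y : EuclideanSpace ℝ (Fin 3) × ℝ) :
    (extChartAt lineModel q).symm y = ((extChartAt (𝓡 3) q.1).symm y.1, y.2) := by
  rw [extChartAt_prod, extChartAt_model_space_eq_id]
  rfl

theorem mem_extChartAt_lineModel_target {q : M × ℝ} {y : EuclideanSpace ℝ (Fin 3) × ℝ} :
    y ∈ (extChartAt lineModel q).target ↔ y.1 ∈ (extChartAt (𝓡 3) q.1).target := by
  rw [extChartAt_prod, extChartAt_model_space_eq_id]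
  simp [PartialEquiv.prod]

theorem extChartAt_lineModel_self (q : M × ℝ) :
    extChartAt lineModel q q = (extChartAt (𝓡 3) q.1 q.1, q.2) := by
  rw [extChartAt_prod, extChartAt_model_space_eq_id]
  rfl

variable [IsManifold (𝓡 3) ∞ M] {C : CRStructure M} {η : DistinguishedCoframe C}

theorem mfderiv_extChartAt_lineModel_symm {q : M × ℝ} {y : EuclideanSpace ℝ (Fin 3) × ℝ}
    (hy : y.1 ∈ (extChartAt (𝓡 3) q.1).target) (v : EuclideanSpace ℝ (Fin 3) × ℝ) :
    mfderiv 𝓘(ℝ, EuclideanSpace ℝ (Fin 3) × ℝ) lineModel (extChartAt lineModel q).symm y v =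
      (mfderiv 𝓘(ℝ, EuclideanSpace ℝ (Fin 3)) (𝓡 3) (extChartAt (𝓡 3) q.1).symm y.1 v.1, v.2) := by
  have e : ((extChartAt lineModel q).symm : EuclideanSpace ℝ (Fin 3) × ℝ → M × ℝ) =
      fun y => ((extChartAt (𝓡 3) q.1).symm y.1, y.2) :=
    funext fun y => extChartAt_lineModel_symm q y
  have h1 : HasMFDerivAt 𝓘(ℝ, EuclideanSpace ℝ (Fin 3) × ℝ) 𝓘(ℝ, EuclideanSpace ℝ (Fin 3))
      (Prod.fst : EuclideanSpace ℝ (Fin 3) × ℝ → EuclideanSpace ℝ (Fin 3)) y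
      (ContinuousLinearMap.fst ℝ (EuclideanSpace ℝ (Fin 3)) ℝ) :=
    hasMFDerivAt_iff_hasFDerivAt.2 hasFDerivAt_fst
  have h2 : HasMFDerivAt 𝓘(ℝ, EuclideanSpace ℝ (Fin 3) × ℝ) 𝓘(ℝ, ℝ)
      (Prod.snd : EuclideanSpace ℝ (Fin 3) × ℝ → ℝ) y
      (ContinuousLinearMap.snd ℝ (EuclideanSpace ℝ (Fin 3)) ℝ) :=
    hasMFDerivAt_iff_hasFDerivAt.2 hasFDerivAt_snd
  have h3 := ((contMDiffAt_extChartAt_symm hy).mdifferentiableAt (by simp)).hasMFDerivAt.comp y h1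
  have h4 := (h3.prodMk h2).mfderiv
  rw [e]
  exact congrArg (fun L => L v) h4

namespace QuasiFefferman

variable {U : Set (M × ℝ)} (D : QuasiFefferman η U)

/-- The real frame in the chart at `q`. -/
noncomputable def chartFrame (q : M × ℝ) :
    Fin 4 → EuclideanSpace ℝ (Fin 3) × ℝ → EuclideanSpace ℝ (Fin 3) × ℝ :=
  localFrame (chartField q.1 η.X) (chartField q.1 η.Y) (chartField q.1 η.del0)
    (fun z => η.c ((extChartAt (𝓡 3) q.1).symm z)) (fun z => D.x ((extChartAt (𝓡 3) q.1).symm z))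
    (fun y => D.H ((extChartAt lineModel q).symm y))

/-- The chart of M × ℝ is the chart of M times the identity, so the fibre coordinate and the
vertical components are unchanged and only the base fields are transported. -/
theorem mfderiv_chartFrame {q : M × ℝ} {y : EuclideanSpace ℝ (Fin 3) × ℝ}
    (hy : y.1 ∈ (extChartAt (𝓡 3) q.1).target) (i : Fin 4) :
    mfderiv 𝓘(ℝ, EuclideanSpace ℝ (Fin 3) × ℝ) lineModel (extChartAt lineModel q).symm y
      (D.chartFrame q i y) = D.realFrame ((extChartAt lineModel q).symm y) i := by
  rw [mfderiv_extChartAt_lineModel_symm hy, extChartAt_lineModel_symm]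
  have hW : localW (fun z => η.c ((extChartAt (𝓡 3) q.1).symm z))
      (fun z => D.x ((extChartAt (𝓡 3) q.1).symm z)) y =
      D.W ((extChartAt (𝓡 3) q.1).symm y.1, y.2) := by
    simp only [localW, localw, W]
    ring
  have hX := mfderiv_chartField η.X hy
  have hY := mfderiv_chartField η.Y hy
  have hT := mfderiv_chartField η.del0 hy
  fin_cases i
  · exact (congrArg₂ Prod.mk hX (congrArg (fun w : ℂ => -w.re) hW)).trans
      (horizontal_sub_smul_vertical ((extChartAt (𝓡 3) q.1).symm y.1, y.2) (η.X _) _).symm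
  · exact (congrArg₂ Prod.mk hY (congrArg Complex.im hW)).trans
      (horizontal_add_smul_vertical ((extChartAt (𝓡 3) q.1).symm y.1, y.2) (η.Y _) _).symm
  · exact (congrArg₂ Prod.mk hT
      (congrArg (fun q => -D.H q) (extChartAt_lineModel_symm q y))).trans
      (horizontal_sub_smul_vertical ((extChartAt (𝓡 3) q.1).symm y.1, y.2) (η.del0 _) _).symm
  · exact (congrArg₂ Prod.mk (map_zero (mfderiv 𝓘(ℝ, EuclideanSpace ℝ (Fin 3)) (𝓡 3)
      (extChartAt (𝓡 3) q.1).symm y.1)) rfl).trans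
      (vertical_eq ((extChartAt (𝓡 3) q.1).symm y.1, y.2)).symm

theorem mfderiv_realFrame {q q' : M × ℝ} {y : EuclideanSpace ℝ (Fin 3) × ℝ}
    (hy : y.1 ∈ (extChartAt (𝓡 3) q.1).target) (hq : (extChartAt lineModel q).symm y = q')
    (i : Fin 4) :
    mfderiv lineModel 𝓘(ℝ, EuclideanSpace ℝ (Fin 3) × ℝ) (extChartAt lineModel q) q'
      (D.realFrame q' i) = D.chartFrame q i y := by
  subst hq
  rw [← D.mfderiv_chartFrame hy]
  exact mfderiv_extChartAt_mfderiv_symm (mem_extChartAt_lineModel_target.2 hy) _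

theorem localMetric {ζ : M → ℂ} (hζ : ContMDiff (𝓡 3) 𝓘(ℝ, ℂ) ∞ ζ)
    (hμ : ∀ p, η.mu p = differential (𝓡 3) ζ p) (hU : IsOpen U) (q : M × ℝ) :
    LocalMetric (extChartAt (𝓡 3) q.1).target (chartField q.1 η.X) (chartField q.1 η.Y)
      (chartField q.1 η.del0) (fun z => η.c ((extChartAt (𝓡 3) q.1).symm z))
      (fun z => D.x ((extChartAt (𝓡 3) q.1).symm z))
      ((extChartAt lineModel q).target ∩ (extChartAt lineModel q).symm ⁻¹' U)
      (fun y => D.H ((extChartAt lineModel q).symm y))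
      (fun y => Real.log (D.P ((extChartAt lineModel q).symm y)))
      (metricInChart lineModel D.metric q) where
  toLocalCR := η.localCR hζ hμ q.1
  smooth_x := by simpa using contDiffOn_comp_symm isOpen_univ D.smooth_x.contMDiffOn q.1
  isOpen_O := isOpen_symm_preimage hU q
  fst_mem y hy := mem_extChartAt_lineModel_target.1 hy.1
  smooth_H := contDiffOn_comp_symm hU D.smooth_H q
  smooth_f := (contDiffOn_comp_symm hU D.smooth_P q).log fun y hy => D.P_ne_zero _ hy.2
  symm y i j := D.metric_comm _ _ _
  form a b z hz := by
    have h1 := mem_extChartAt_lineModel_target.1 hz.1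
    refine (formCLM_metricInChart D.metric q z _ _).trans ?_
    have h2 := D.mfderiv_chartFrame h1
    refine (congrArg₂ (fun v w => D.metric ((extChartAt lineModel q).symm z) v w)
      (h2 a) (h2 b)).trans ?_
    -- For negative P the value of `Real.log` is log |P|, so e^{2f} = P² for either sign.
    rw [D.metric_realFrame, mul_comm 2, Real.exp_mul, Real.exp_log_eq_abs (D.P_ne_zero _ hz.2)]
    simp

theorem ricciTensor_realFrame (q : M × ℝ) (i j : Fin 4) :
    ricciTensor lineModel D.metric q (D.realFrame q i) (D.realFrame q j) =
      formCLM (ricciCoord (metricInChart lineModel D.metric q) (extChartAt lineModel q q))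
        (D.chartFrame q i (extChartAt lineModel q q))
        (D.chartFrame q j (extChartAt lineModel q q)) := by
  rw [ricciTensor_apply]
  have h : (extChartAt lineModel q q).1 ∈ (extChartAt (𝓡 3) q.1).target := by
    rw [extChartAt_lineModel_self]
    exact mem_extChartAt_target q.1
  have h2 := D.mfderiv_realFrame h (extChartAt_to_inv q)
  exact congrArg₂ (fun v w => formCLM (ricciCoord (metricInChart lineModel D.metric q)
    (extChartAt lineModel q q)) v w) (h2 i) (h2 j)

end QuasiFefferman

end RicciChart

/-- The expansion of Ric(e₂, e₂) contains the mixed components in both orders; this lets the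
vanishing of R₂₄ remove all of them. -/
theorem LocalMetric.ricci_comm_V {E₀ : Type*} [NormedAddCommGroup E₀] [NormedSpace ℝ E₀]
    [FiniteDimensional ℝ E₀] {Ω : Set E₀} {X Y T : E₀ → E₀} {c x : E₀ → ℂ} {O : Set (E₀ × ℝ)}
    {H f : E₀ × ℝ → ℝ}
    {G : E₀ × ℝ → Matrix (Fin (Module.finrank ℝ (E₀ × ℝ))) (Fin (Module.finrank ℝ (E₀ × ℝ))) ℝ}
    (D : LocalMetric Ω X Y T c x O H f G) {y : E₀ × ℝ} (hy : y ∈ O) :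
    formCLM (ricciCoord G y) (0, 1) (localFrame X Y T c x H 0 y) =
        formCLM (ricciCoord G y) (localFrame X Y T c x H 0 y) (0, 1) ∧
      formCLM (ricciCoord G y) (0, 1) (localFrame X Y T c x H 1 y) =
        formCLM (ricciCoord G y) (localFrame X Y T c x H 1 y) (0, 1) := by
  obtain ⟨k, α, β, h, N⟩ := D.nullFrame
  exact ⟨(N.ricci_VA hy).trans (N.ricci_AV hy).symm, (N.ricci_VB hy).trans (N.ricci_BV hy).symm⟩

/-! ### The three Ricci formulas on the manifold. -/

section RicciFormulas

variable {M : Type*} [TopologicalSpace M] [ChartedSpace (EuclideanSpace ℝ (Fin 3)) M]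
  [IsManifold (𝓡 3) ∞ M] {C : CRStructure M} {η : DistinguishedCoframe C}

omit [IsManifold (𝓡 3) ∞ M] in
theorem contMDiff_ofReal {N E H : Type*} [NormedAddCommGroup E] [NormedSpace ℝ E]
    [TopologicalSpace H] {I : ModelWithCorners ℝ E H} [TopologicalSpace N] [ChartedSpace H N]
    {f : N → ℝ} (hf : ContMDiff I 𝓘(ℝ, ℝ) ∞ f) : ContMDiff I 𝓘(ℝ, ℂ) ∞ (fun p => (f p : ℂ)) :=
  Complex.ofRealCLM.contDiff.contMDiff.comp hf

omit [IsManifold (𝓡 3) ∞ M] in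
theorem contMDiff_complex_mul {f g : M → ℂ} (hf : ContMDiff (𝓡 3) 𝓘(ℝ, ℂ) ∞ f)
    (hg : ContMDiff (𝓡 3) 𝓘(ℝ, ℂ) ∞ g) : ContMDiff (𝓡 3) 𝓘(ℝ, ℂ) ∞ (fun p => f p * g p) :=
  (contDiff_fst.mul contDiff_snd : ContDiff ℝ ∞ fun z : ℂ × ℂ => z.1 * z.2).contMDiff.comp
    (hf.prodMk_space hg)

omit [IsManifold (𝓡 3) ∞ M] in
theorem contMDiff_of_chart {f : M → ℂ}
    (h : ∀ p, ContDiffOn ℝ ∞ (fun z => f ((extChartAt (𝓡 3) p).symm z))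
      (extChartAt (𝓡 3) p).target) : ContMDiff (𝓡 3) 𝓘(ℝ, ℂ) ∞ f := by
  intro p
  have h1 := ((h p).contDiffAt (extChartAt_target_mem_nhds p)).contMDiffAt
  refine (h1.comp p contMDiffAt_extChartAt).congr_of_eventuallyEq ?_
  filter_upwards [extChartAt_source_mem_nhds (I := 𝓡 3) p] with q hq
  exact (congrArg f ((extChartAt (𝓡 3) p).left_inv hq)).symm

namespace DistinguishedCoframe

variable (η)

theorem contMDiff_c {ζ : M → ℂ} (hζ : ContMDiff (𝓡 3) 𝓘(ℝ, ℂ) ∞ ζ)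
    (hμ : ∀ p, η.mu p = differential (𝓡 3) ζ p) : ContMDiff (𝓡 3) 𝓘(ℝ, ℂ) ∞ η.c := by
  exact contMDiff_of_chart fun p => (η.localCR hζ hμ p).smooth_c

theorem contMDiff_d {f : M → ℂ} (hf : ContMDiff (𝓡 3) 𝓘(ℝ, ℂ) ∞ f) :
    ContMDiff (𝓡 3) 𝓘(ℝ, ℂ) ∞ (η.d f) := by
  refine contMDiff_of_chart fun p => ?_
  have hf' : ContDiffOn ℝ ∞ (fun z => f ((extChartAt (𝓡 3) p).symm z))
      (extChartAt (𝓡 3) p).target := by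
    simpa using contDiffOn_comp_symm isOpen_univ hf.contMDiffOn p
  have h1 := hf'.fderiv_of_isOpen (isOpen_extChartAt_target p) (m := ∞) (by simp)
  refine ContDiffOn.congr ?_ fun z hz => η.d_chart hf hz
  exact (h1.clm_apply (contDiffOn_chartField η.contMDiff_X)).sub
    (contDiffOn_const.mul (h1.clm_apply (contDiffOn_chartField η.contMDiff_Y)))

end DistinguishedCoframe

namespace QuasiFefferman

variable {U : Set (M × ℝ)} {D : QuasiFefferman η U}

omit [IsManifold (𝓡 3) ∞ M] in
theorem mem_chart (q : M × ℝ) (hq : q ∈ U) : extChartAt lineModel q q ∈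
    (extChartAt lineModel q).target ∩ (extChartAt lineModel q).symm ⁻¹' U :=
  ⟨mem_extChartAt_target q, by rwa [Set.mem_preimage, extChartAt_to_inv]⟩

theorem ricci_vertical {ζ : M → ℂ} (hζ : ContMDiff (𝓡 3) 𝓘(ℝ, ℂ) ∞ ζ)
    (hμ : ∀ p, η.mu p = differential (𝓡 3) ζ p) (hU : IsOpen U) {q : M × ℝ} (hq : q ∈ U) :
    ricciTensor lineModel D.metric q (vertical q) (vertical q) =
      1 / 2 - 2 * deriv (deriv fun r => Real.log (D.P (q.1, r))) q.2
        + 2 * deriv (fun r => Real.log (D.P (q.1, r))) q.2 ^ 2 := by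
  refine (D.ricciTensor_realFrame q 3 3).trans ?_
  refine ((D.localMetric hζ hμ hU q).ricci_VV (mem_chart q hq)).trans ?_
  simp only [extChartAt_lineModel_symm, extChartAt_lineModel_self, extChartAt_to_inv]

theorem ricci_vertical_comm {ζ : M → ℂ} (hζ : ContMDiff (𝓡 3) 𝓘(ℝ, ℂ) ∞ ζ)
    (hμ : ∀ p, η.mu p = differential (𝓡 3) ζ p) (hU : IsOpen U) {q : M × ℝ} (hq : q ∈ U) :
    ricciTensor lineModel D.metric q (vertical q) (D.realFrame q 0) =
        ricciTensor lineModel D.metric q (D.realFrame q 0) (vertical q) ∧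
      ricciTensor lineModel D.metric q (vertical q) (D.realFrame q 1) =
        ricciTensor lineModel D.metric q (D.realFrame q 1) (vertical q) := by
  have h := (D.localMetric hζ hμ hU q).ricci_comm_V (mem_chart q hq)
  exact ⟨(D.ricciTensor_realFrame q 3 0).trans (h.1.trans (D.ricciTensor_realFrame q 0 3).symm),
    (D.ricciTensor_realFrame q 3 1).trans (h.2.trans (D.ricciTensor_realFrame q 1 3).symm)⟩

theorem log_profile {a s : M → ℝ} (h : D.HasProfile a s) (ha : ∀ p, a p ≠ 0) {q : M × ℝ}
    (hq : q ∈ U) : Real.log (D.P q) =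
      1 / 2 * Real.log (a q.1 ^ 2) - Real.log (Real.cos ((q.2 + s q.1) / 2)) := by
  rw [(h.2.2 q hq).2, Real.log_div (ha _) (h.2.2 q hq).1, Real.log_pow]
  push_cast
  ring

/-- The left-hand side of the equation `∂ log a² + i ∂s - 2 x e^{is} = -2c/3`. -/
noncomputable def profileEq (D : QuasiFefferman η U) (a s : M → ℝ) (p : M) : ℂ :=
  η.d (fun p' => ((Real.log (a p' ^ 2) : ℝ) : ℂ)) p + Complex.I * η.d (fun p' => (s p' : ℂ)) p
    - 2 * D.x p * Complex.exp (Complex.I * s p)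

omit [IsManifold (𝓡 3) ∞ M] in
theorem contMDiff_real_log_sq {a : M → ℝ} (h : ContMDiff (𝓡 3) 𝓘(ℝ, ℝ) ∞ a) (ha : ∀ p, a p ≠ 0) :
    ContMDiff (𝓡 3) 𝓘(ℝ, ℝ) ∞ fun p => Real.log (a p ^ 2) := fun p =>
  ((Real.contDiffAt_log.2 (pow_ne_zero 2 (ha p))).contMDiffAt).comp p ((h p).pow 2)

omit [IsManifold (𝓡 3) ∞ M] in
theorem contMDiff_log_sq {a : M → ℝ} (h : ContMDiff (𝓡 3) 𝓘(ℝ, ℝ) ∞ a) (ha : ∀ p, a p ≠ 0) :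
    ContMDiff (𝓡 3) 𝓘(ℝ, ℂ) ∞ (fun p => ((Real.log (a p ^ 2) : ℝ) : ℂ)) :=
  contMDiff_ofReal (contMDiff_real_log_sq h ha)

section Profile

variable {a s : M → ℝ} (h : D.HasProfile a s) (ha : ∀ p, a p ≠ 0)

include h in
theorem contDiffOn_profile (p : M) :
    ContDiffOn ℝ ∞ (fun z => a ((extChartAt (𝓡 3) p).symm z)) (extChartAt (𝓡 3) p).target ∧
    ContDiffOn ℝ ∞ (fun z => s ((extChartAt (𝓡 3) p).symm z)) (extChartAt (𝓡 3) p).target :=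
  ⟨by simpa using contDiffOn_comp_symm isOpen_univ h.1.contMDiffOn p,
    by simpa using contDiffOn_comp_symm isOpen_univ h.2.1.contMDiffOn p⟩

include h in
theorem contMDiff_exp_profile :
    ContMDiff (𝓡 3) 𝓘(ℝ, ℂ) ∞ (fun p => Complex.exp (Complex.I * s p)) :=
  (Complex.contDiff_exp (𝕜 := ℝ)).contMDiff.comp 
    (contMDiff_complex_mul contMDiff_const (contMDiff_ofReal h.2.1))

include h ha in
theorem contMDiff_t {ζ : M → ℂ} (hζ : ContMDiff (𝓡 3) 𝓘(ℝ, ℂ) ∞ ζ)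
    (hμ : ∀ p, η.mu p = differential (𝓡 3) ζ p) :
    ContMDiff (𝓡 3) 𝓘(ℝ, ℂ) ∞ (η.t D.x a s) :=
  ((η.contMDiff_c hζ hμ).add (η.contMDiff_d (contMDiff_log_sq h.1 ha))).sub
    (contMDiff_complex_mul D.smooth_x (contMDiff_exp_profile h))

include h ha in
theorem localEq_chart (p : M) {z : EuclideanSpace ℝ (Fin 3)}
    (hz : z ∈ (extChartAt (𝓡 3) p).target) :
    localEq (chartField p η.X) (chartField p η.Y) (fun z => D.x ((extChartAt (𝓡 3) p).symm z))
      (fun z => a ((extChartAt (𝓡 3) p).symm z)) (fun z => s ((extChartAt (𝓡 3) p).symm z)) z =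
    D.profileEq a s ((extChartAt (𝓡 3) p).symm z) := by
  rw [localEq, profileEq, η.d_chart (contMDiff_log_sq h.1 ha) hz,
    η.d_chart (contMDiff_ofReal h.2.1) hz]

include h ha in
theorem localT_chart (p : M) {z : EuclideanSpace ℝ (Fin 3)}
    (hz : z ∈ (extChartAt (𝓡 3) p).target) :
    localT (chartField p η.X) (chartField p η.Y) (fun z => η.c ((extChartAt (𝓡 3) p).symm z))
      (fun z => D.x ((extChartAt (𝓡 3) p).symm z))
      (fun z => a ((extChartAt (𝓡 3) p).symm z)) (fun z => s ((extChartAt (𝓡 3) p).symm z)) z =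
    η.t D.x a s ((extChartAt (𝓡 3) p).symm z) := by
  rw [localT, DistinguishedCoframe.t, η.d_chart (contMDiff_log_sq h.1 ha) hz]

include h in
theorem cos_chart (q : M × ℝ) : ∀ y ∈ (extChartAt lineModel q).target ∩
    (extChartAt lineModel q).symm ⁻¹' U,
    Real.cos ((y.2 + s ((extChartAt (𝓡 3) q.1).symm y.1)) / 2) ≠ 0 := by
  intro y hy
  have := (h.2.2 _ hy.2).1
  rwa [extChartAt_lineModel_symm] at this

include h ha in
theorem log_chart (q : M × ℝ) : ∀ y ∈ (extChartAt lineModel q).target ∩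
    (extChartAt lineModel q).symm ⁻¹' U,
    Real.log (D.P ((extChartAt lineModel q).symm y)) =
      1 / 2 * Real.log (a ((extChartAt (𝓡 3) q.1).symm y.1) ^ 2)
        - Real.log (Real.cos ((y.2 + s ((extChartAt (𝓡 3) q.1).symm y.1)) / 2)) := by
  intro y hy
  rw [log_profile h ha hy.2, extChartAt_lineModel_symm]

variable {ζ : M → ℂ} (hζ : ContMDiff (𝓡 3) 𝓘(ℝ, ℂ) ∞ ζ)
  (hμ : ∀ p, η.mu p = differential (𝓡 3) ζ p) (hU : IsOpen U)

include h ha hζ hμ hU in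
theorem ricci_e₁_V {q : M × ℝ} (hq : q ∈ U) :
    (ricciTensor lineModel D.metric q (D.realFrame q 0) (vertical q) : ℂ)
      - Complex.I * ricciTensor lineModel D.metric q (D.realFrame q 1) (vertical q) =
      1 / 2 * (Real.tan ((q.2 + s q.1) / 2) + Complex.I)
        * (D.profileEq a s q.1 + 2 * η.c q.1 / 3) := by
  have h1 := (D.localMetric hζ hμ hU q).ricci_e₁_V (contDiffOn_profile h q.1).1
    (fun z _ => ha _) (contDiffOn_profile h q.1).2 (cos_chart h q) (log_chart h ha q)
    (mem_chart q hq)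
  rw [localEq_chart h ha q.1 (mem_extChartAt_lineModel_target.1 (mem_chart q hq).1)] at h1
  have e0 := D.ricciTensor_realFrame q 0 3
  have e1 := D.ricciTensor_realFrame q 1 3
  refine (congrArg₂ (fun a b : ℝ => (a : ℂ) - Complex.I * b) e0 e1).trans (h1.trans ?_)
  simp only [halfTan, extChartAt_lineModel_self, extChartAt_to_inv]

include h ha hζ hμ hU in
theorem ricci_e₁_e₁ (heq : ∀ p, D.profileEq a s p = -(2 * η.c p / 3)) {q : M × ℝ} (hq : q ∈ U) :
    ((ricciTensor lineModel D.metric q (D.realFrame q 0) (D.realFrame q 0)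
      - ricciTensor lineModel D.metric q (D.realFrame q 1) (D.realFrame q 1) : ℝ) : ℂ)
      - Complex.I * (ricciTensor lineModel D.metric q (D.realFrame q 0) (D.realFrame q 1)
        + ricciTensor lineModel D.metric q (D.realFrame q 1) (D.realFrame q 0) : ℝ) =
      -(1 + Complex.I * Real.tan ((q.2 + s q.1) / 2)) *
        (η.d (η.t D.x a s) q.1 + η.t D.x a s q.1 * (η.c q.1 - η.t D.x a s q.1)) := by
  have hz := mem_extChartAt_lineModel_target.1 (mem_chart q hq).1
  have h1 := (D.localMetric hζ hμ hU q).ricci_e₁_e₁ (contDiffOn_profile h q.1).1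
    (fun z _ => ha _) (contDiffOn_profile h q.1).2 (cos_chart h q) (log_chart h ha q)
    (fun z hz => (localEq_chart h ha q.1 hz).trans (heq _)) (mem_chart q hq)
  rw [cdir_congr (Filter.eventually_of_mem ((isOpen_extChartAt_target q.1).mem_nhds hz)
    fun z hz => localT_chart h ha q.1 hz), ← η.d_chart (contMDiff_t h ha hζ hμ) hz,
    localT_chart h ha q.1 hz] at h1
  simp only [D.ricciTensor_realFrame]
  refine h1.trans ?_
  simp only [halfTan, extChartAt_lineModel_self, extChartAt_to_inv]

end Profile

end QuasiFefferman

end RicciFormulas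

/-! ### Part (i): the Riccati equation along the fibres. -/

section FibreEquation

theorem deriv_log_profile {g : ℝ → ℝ} {J : Set ℝ} (hJ : IsOpen J) {a s : ℝ} (ha : a ≠ 0)
    (hg : ∀ r ∈ J, Real.cos ((r + s) / 2) ≠ 0 ∧ g r = a / Real.cos ((r + s) / 2)) {r : ℝ}
    (hr : r ∈ J) :
    1 / 2 - 2 * deriv (deriv fun r => Real.log (g r)) r
      + 2 * deriv (fun r => Real.log (g r)) r ^ 2 = 0 := by
  have hφ : ∀ r, HasDerivAt (fun r : ℝ => (r + s) / 2) (1 / 2) r := fun r =>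
    ((hasDerivAt_id r).add_const s).div_const 2
  have h1 : ∀ r ∈ J, deriv (fun r => Real.log (g r)) r = Real.tan ((r + s) / 2) / 2 := by
    intro r hr
    have e : (fun r => Real.log (g r)) =ᶠ[nhds r]
        fun r => Real.log a - Real.log (Real.cos ((r + s) / 2)) :=
      Filter.eventually_of_mem (hJ.mem_nhds hr) fun r hr => by
        simp only [(hg r hr).2, Real.log_div ha (hg r hr).1]
    have h : HasDerivAt (fun r => Real.log a - Real.log (Real.cos ((r + s) / 2))) _ r :=
      (((Real.hasDerivAt_cos _).comp r (hφ r)).log (hg r hr).1).const_sub _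
    rw [e.deriv_eq, h.deriv, Real.tan_eq_sin_div_cos]
    simp only [Function.comp_apply]
    ring
  have e2 : deriv (fun r => Real.log (g r)) =ᶠ[nhds r] fun r => Real.tan ((r + s) / 2) / 2 :=
    Filter.eventually_of_mem (hJ.mem_nhds hr) h1
  have h2 : HasDerivAt (fun r => Real.tan ((r + s) / 2) / 2) _ r :=
    (HasDerivAt.comp (h := fun r => (r + s) / 2) r (Real.hasDerivAt_tan (hg r hr).1)
      (hφ r)).div_const 2
  rw [e2.deriv_eq, h2.deriv, h1 r hr, ← Real.inv_one_add_tan_sq (hg r hr).1]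
  simp only [one_div, inv_inv]
  ring

/-- Two first integrals on the interval: 2 arctan(2u) - r with u = (log g)', whose value is s, and g
cos((r+s)/2), whose value is a. -/
theorem profile_of_ode {g : ℝ → ℝ} {J : Set ℝ} (hJ : IsOpen J) (hc : IsPreconnected J)
    (hg0 : ∀ r ∈ J, g r ≠ 0) (hg : ∀ r ∈ J, DifferentiableAt ℝ g r)
    (hu : ∀ r ∈ J, DifferentiableAt ℝ (deriv fun r => Real.log (g r)) r)
    (ode : ∀ r ∈ J, 1 / 2 - 2 * deriv (deriv fun r => Real.log (g r)) r
      + 2 * deriv (fun r => Real.log (g r)) r ^ 2 = 0) {r r₀ : ℝ} (hr : r ∈ J) (hr₀ : r₀ ∈ J)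
    {s : ℝ} (hs : s = 2 * Real.arctan (2 * deriv (fun r => Real.log (g r)) r₀) - r₀) :
    s = 2 * Real.arctan (2 * deriv (fun r => Real.log (g r)) r) - r ∧
      Real.cos ((r + s) / 2) ≠ 0 ∧ g r = g r₀ * Real.cos ((r₀ + s) / 2) / Real.cos ((r + s) / 2) := by
  set u := deriv fun r => Real.log (g r) with hu'
  -- The equation reads u' = 1/4 + u², so 2 arctan(2u) has derivative 1.
  have hS : ∀ r ∈ J, HasDerivAt (fun r => 2 * Real.arctan (2 * u r) - r) 0 r := by
    intro r hr
    have h := ((((hu r hr).hasDerivAt.const_mul 2).arctan).const_mul 2).sub (hasDerivAt_id r)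
    refine h.congr_deriv ?_
    have h1 : deriv u r = 1 / 4 + u r ^ 2 := by linear_combination -1 / 2 * ode r hr
    have h2 : 1 + (2 * u r) ^ 2 ≠ 0 := by positivity
    rw [h1]
    field_simp
    ring
  have hs' : ∀ r ∈ J, s = 2 * Real.arctan (2 * u r) - r := fun r hr =>
    hs.trans (hJ.is_const_of_deriv_eq_zero hc
      (fun r hr => (hS r hr).differentiableAt.differentiableWithinAt)
      (fun r hr => (hS r hr).deriv) hr₀ hr)
  have hφ : ∀ r ∈ J, (r + s) / 2 = Real.arctan (2 * u r) := fun r hr => by rw [hs' r hr]; ring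
  -- The half-angle is a value of arctan, so its cosine is positive on the whole interval.
  have hcos : ∀ r ∈ J, Real.cos ((r + s) / 2) ≠ 0 := fun r hr => by
    rw [hφ r hr]
    exact (Real.cos_arctan_pos _).ne'
  have hK : ∀ r ∈ J, HasDerivAt (fun r => g r * Real.cos ((r + s) / 2)) 0 r := by
    intro r hr
    have h := (hg r hr).hasDerivAt.mul ((Real.hasDerivAt_cos _).comp r
      (((hasDerivAt_id r).add_const s).div_const 2))
    refine h.congr_deriv ?_
    have h1 : u r = deriv g r / g r := ((hg r hr).hasDerivAt.log (hg0 r hr)).deriv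
    have h2 : Real.sin ((r + s) / 2) = 2 * u r * Real.cos ((r + s) / 2) := by
      have := Real.tan_mul_cos (hcos r hr)
      rw [← this, hφ r hr, Real.tan_arctan]
    have h3 : deriv g r = u r * g r := by
      rw [h1]
      field_simp [hg0 r hr]
    simp only [id_eq, Function.comp_apply]
    rw [h2, h3]
    ring
  refine ⟨hs' r hr, hcos r hr, ?_⟩
  rw [eq_div_iff (hcos r hr)]
  exact hJ.is_const_of_deriv_eq_zero hc
      (fun r hr => (hK r hr).differentiableAt.differentiableWithinAt)
      (fun r hr => (hK r hr).deriv) hr hr₀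

variable {M : Type*} [TopologicalSpace M] [ChartedSpace (EuclideanSpace ℝ (Fin 3)) M]
  [IsManifold (𝓡 3) ∞ M]

omit [IsManifold (𝓡 3) ∞ M] in
theorem contMDiff_prod_left (p : M) : ContMDiff 𝓘(ℝ, ℝ) lineModel ∞ fun r : ℝ => (p, r) :=
  contMDiff_const.prodMk contMDiff_id

omit [IsManifold (𝓡 3) ∞ M] in
theorem contMDiff_prod_right (r : ℝ) : ContMDiff (𝓡 3) lineModel ∞ fun p : M => (p, r) :=
  contMDiff_id.prodMk contMDiff_const

/-- In a chart the derivative along the fibre is the differential in the direction (0, 1), hence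
smooth jointly in all variables. -/
theorem contMDiffOn_deriv_fibre {f : M × ℝ → ℝ} {U : Set (M × ℝ)} (hU : IsOpen U)
    (hf : ContMDiffOn lineModel 𝓘(ℝ, ℝ) ∞ f U) :
    ContMDiffOn lineModel 𝓘(ℝ, ℝ) ∞ (fun q : M × ℝ => deriv (fun r => f (q.1, r)) q.2) U := by
  intro q hq
  have hO := isOpen_symm_preimage (I := lineModel) hU q
  have h1 := contDiffOn_comp_symm hU hf q
  have h2 := (h1.fderiv_of_isOpen hO (m := ∞) (by simp)).clm_apply
    (contDiffOn_const (c := ((0, 1) : EuclideanSpace ℝ (Fin 3) × ℝ)))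
  have h3 := (h2.contDiffAt (hO.mem_nhds (QuasiFefferman.mem_chart q hq))).contMDiffAt
  refine ContMDiffAt.contMDiffWithinAt ?_
  refine (h3.comp q contMDiffAt_extChartAt).congr_of_eventuallyEq ?_
  filter_upwards [extChartAt_source_mem_nhds (I := lineModel) q, hU.mem_nhds hq] with q' hq' hq''
  have h4 : extChartAt lineModel q q' ∈
      (extChartAt lineModel q).target ∩ (extChartAt lineModel q).symm ⁻¹' U :=
    ⟨(extChartAt lineModel q).map_source hq', by
      rwa [Set.mem_preimage, (extChartAt lineModel q).left_inv hq']⟩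
  have h5 := fderiv_vertical ((h1.contDiffAt (hO.mem_nhds h4)).differentiableAt (by simp))
  refine Eq.trans ?_ h5.symm
  have h6 := (extChartAt lineModel q).left_inv hq'
  rw [extChartAt_lineModel_symm] at h6
  simp only [extChartAt_lineModel_symm]
  exact congrArg (fun q : M × ℝ => deriv (fun r => f (q.1, r)) q.2) h6.symm

namespace QuasiFefferman

variable {C : CRStructure M} {η : DistinguishedCoframe C} {U : Set (M × ℝ)}
  {D : QuasiFefferman η U}

theorem HasProfile.ne_zero {a s : M → ℝ} (h : D.HasProfile a s)
    (hfib : ∀ p : M, IsConnected {r : ℝ | (p, r) ∈ U}) (p : M) : a p ≠ 0 := by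
  obtain ⟨r, hr⟩ := (hfib p).nonempty
  intro h0
  have h1 := (h.2.2 _ hr).2
  simp only [h0, zero_div] at h1
  exact D.P_ne_zero _ hr h1

omit [ChartedSpace (EuclideanSpace ℝ (Fin 3)) M] [IsManifold (𝓡 3) ∞ M] in
theorem isOpen_fibre (hU : IsOpen U) (p : M) : IsOpen {r : ℝ | (p, r) ∈ U} :=
  hU.preimage (by fun_prop : Continuous fun r : ℝ => (p, r))

theorem contMDiffOn_log (D : QuasiFefferman η U) :
    ContMDiffOn lineModel 𝓘(ℝ, ℝ) ∞ (fun q => Real.log (D.P q)) U := by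
  intro q hq
  have h : ContMDiffAt 𝓘(ℝ, ℝ) 𝓘(ℝ, ℝ) ∞ Real.log (D.P q) :=
    (Real.contDiffAt_log.2 (D.P_ne_zero q hq)).contMDiffAt
  exact ContMDiffAt.comp_contMDiffWithinAt (g := Real.log) (f := D.P) q h (D.smooth_P q hq)

theorem contMDiffOn_deriv_log (D : QuasiFefferman η U) (hU : IsOpen U) :
    ContMDiffOn lineModel 𝓘(ℝ, ℝ) ∞
      (fun q : M × ℝ => deriv (fun r => Real.log (D.P (q.1, r))) q.2) U :=
  contMDiffOn_deriv_fibre hU D.contMDiffOn_log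

theorem vertical_equation_iff (hU : IsOpen U)
    (hfib : ∀ p : M, IsConnected {r : ℝ | (p, r) ∈ U}) :
    (∀ q ∈ U, 1 / 2 - 2 * deriv (deriv fun r => Real.log (D.P (q.1, r))) q.2
        + 2 * deriv (fun r => Real.log (D.P (q.1, r))) q.2 ^ 2 = 0) ↔
      ∃ a s : M → ℝ, D.HasProfile a s := by
  constructor
  swap
  · rintro ⟨a, s, h⟩ q hq
    exact deriv_log_profile (g := fun r => D.P (q.1, r)) (isOpen_fibre hU q.1)
      (h.ne_zero hfib q.1) (s := s q.1) (fun r hr => h.2.2 (q.1, r) hr) hq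
  intro ode
  let u : M × ℝ → ℝ := fun q => deriv (fun r => Real.log (D.P (q.1, r))) q.2
  have hu : ContMDiffOn lineModel 𝓘(ℝ, ℝ) ∞ u U := D.contMDiffOn_deriv_log hU
  have hat : ∀ {f : M × ℝ → ℝ}, ContMDiffOn lineModel 𝓘(ℝ, ℝ) ∞ f U → ∀ q ∈ U,
      ContMDiffAt lineModel 𝓘(ℝ, ℝ) ∞ f q := fun hf q hq => (hf q hq).contMDiffAt (hU.mem_nhds hq)
  have hdiff : ∀ {f : M × ℝ → ℝ}, ContMDiffOn lineModel 𝓘(ℝ, ℝ) ∞ f U → ∀ p r, (p, r) ∈ U →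
      DifferentiableAt ℝ (fun r => f (p, r)) r := fun hf p r hr =>
    (contMDiffAt_iff_contDiffAt.1 ((hat hf (p, r) hr).comp r
      (contMDiff_prod_left p r))).differentiableAt (by simp)
  -- The chosen points need not depend continuously on `p`; the definitions of `s` and `a` turn out
  -- not to depend on them.
  choose ρ hρ using fun p => (hfib p).nonempty
  let s : M → ℝ := fun p => 2 * Real.arctan (2 * u (p, ρ p)) - ρ p
  let a : M → ℝ := fun p => D.P (p, ρ p) * Real.cos ((ρ p + s p) / 2)
  have key : ∀ p r₀ r, (p, r₀) ∈ U → (p, r) ∈ U →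
      s p = 2 * Real.arctan (2 * u (p, r)) - r ∧ Real.cos ((r + s p) / 2) ≠ 0 ∧
      D.P (p, r) = D.P (p, r₀) * Real.cos ((r₀ + s p) / 2) / Real.cos ((r + s p) / 2) := by
    intro p r₀ r hr₀ hr
    have hk := fun r' (hr' : (p, r') ∈ U) {r₁ : ℝ} (hr₁ : (p, r₁) ∈ U) => profile_of_ode
      (isOpen_fibre hU p) (hfib p).isPreconnected (g := fun r => D.P (p, r))
      (fun r hr => D.P_ne_zero _ hr) (fun r hr => hdiff D.smooth_P p r hr)
      (fun r hr => hdiff hu p r hr) (fun r hr => ode (p, r) hr) (r := r') hr' hr₁ (s := s p)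
    exact hk r hr hr₀ (hk r₀ hr₀ (hρ p) rfl).1
  have hev : ∀ p₀, ∀ᶠ p in nhds p₀, (p, ρ p₀) ∈ U := fun p₀ =>
    (by fun_prop : Continuous fun p : M => (p, ρ p₀)).continuousAt (hU.mem_nhds (hρ p₀))
  have hs : ContMDiff (𝓡 3) 𝓘(ℝ, ℝ) ∞ s := by
    intro p₀
    have h1 := (hat hu _ (hρ p₀)).comp p₀ (contMDiff_prod_right (ρ p₀) p₀)
    have h2 : ContDiff ℝ ∞ fun t : ℝ => 2 * Real.arctan (2 * t) - ρ p₀ :=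
      (contDiff_const.mul (Real.contDiff_arctan.comp (contDiff_const.mul contDiff_id))).sub
        contDiff_const
    -- Near `p₀` the constant value `ρ p₀` of the fibre coordinate still lies in the fibre, and s
    -- may be computed there because it is a first integral. The same device gives the smoothness of
    -- `a`.
    refine (h2.contMDiff.contMDiffAt.comp p₀ h1).congr_of_eventuallyEq ?_
    filter_upwards [hev p₀] with p hp
    exact (key p (ρ p) (ρ p₀) (hρ p) hp).1
  refine ⟨a, s, ?_, hs, fun q hq => (key q.1 (ρ q.1) q.2 (hρ q.1) hq).2⟩
  intro p₀
  have h1 := (hat D.smooth_P _ (hρ p₀)).comp p₀ (contMDiff_prod_right (ρ p₀) p₀)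
  have h2 : ContDiff ℝ ∞ fun t : ℝ × ℝ => t.1 * Real.cos ((ρ p₀ + t.2) / 2) := by fun_prop
  refine (h2.contMDiff.contMDiffAt.comp p₀ (h1.prodMk_space (hs p₀))).congr_of_eventuallyEq ?_
  filter_upwards [hev p₀] with p hp
  have h3 := key p (ρ p₀) (ρ p) hp (hρ p)
  exact (eq_div_iff h3.2.1).1 h3.2.2

end QuasiFefferman

end FibreEquation

/-! ### Adapted frames and the vanishing of complex components. -/

section AdaptedFrames

variable {V : Type*} [AddCommGroup V] [Module ℝ V]

theorem exists_eq_tmul_add (e : ℂ ⊗[ℝ] V) :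
    ∃ u v : V, e = (1 : ℂ) ⊗ₜ[ℝ] u + Complex.I ⊗ₜ[ℝ] v := by
  induction e with
  | zero => exact ⟨0, 0, by simp⟩
  | tmul z w =>
    refine ⟨z.re • w, z.im • w, ?_⟩
    rw [← TensorProduct.smul_tmul, ← TensorProduct.smul_tmul, ← TensorProduct.add_tmul]
    congr 1
    apply Complex.ext <;> simp
  | add a b ha hb =>
    obtain ⟨u, v, rfl⟩ := ha
    obtain ⟨u', v', rfl⟩ := hb
    exact ⟨u + u', v + v', by simp only [TensorProduct.tmul_add]; abel⟩

theorem conjTensor_tmul (z : ℂ) (v : V) :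
    conjTensor V (z ⊗ₜ[ℝ] v) = (starRingEnd ℂ) z ⊗ₜ[ℝ] v := rfl

theorem baseChange_apply (g : LinearMap.BilinForm ℝ V) (a b : ℂ) (v w : V) :
    LinearMap.BilinForm.baseChange ℂ g (a ⊗ₜ[ℝ] v) (b ⊗ₜ[ℝ] w) = a * b * g v w := by
  rw [LinearMap.BilinForm.baseChange_tmul, mul_comm a b]
  simp [Complex.real_smul]
  ring

/-- A real frame `A, B, T, V` with scalar products proportional to `frameForm`. -/
theorem eq_sum_of_gram (hV : Module.finrank ℝ V = 4) {g : LinearMap.BilinForm ℝ V} {F : Fin 4 → V}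
    {m : ℝ} (hm : m ≠ 0) (hF : ∀ i j, g (F i) (F j) = m * frameForm i j) (w : V) :
    ∃ k : Fin 4 → ℝ, w = k 0 • F 0 + k 1 • F 1 + k 2 • F 2 + k 3 • F 3 := by
  have hli : LinearIndependent ℝ F := by
    refine Fintype.linearIndependent_iff.2 fun k hk => ?_
    have h : ∀ j, g (∑ i, k i • F i) (F j) = 0 := fun j => by rw [hk]; simp
    have h0 := h 0
    have h1 := h 1
    have h2 := h 2
    have h3 := h 3
    simp [Fin.sum_univ_four, hF, frameForm, hm] at h0 h1 h2 h3
    intro i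
    fin_cases i
    exacts [h0, h1, h3, h2]
  have hb := (basisOfLinearIndependentOfCardEqFinrank hli (by simp [hV])).sum_repr w
  rw [Fin.sum_univ_four] at hb
  simp only [coe_basisOfLinearIndependentOfCardEqFinrank] at hb
  exact ⟨_, hb.symm⟩

theorem exists_rotation {α β α' β' n : ℝ} (hn : n ≠ 0) (h : α ^ 2 + β ^ 2 = n)
    (h' : α' ^ 2 + β' ^ 2 = n) (h0 : α * α' + β * β' = 0) :
    ∃ ε : ℝ, ε ^ 2 = 1 ∧ α' = -(ε * β) ∧ β' = ε * α := by
  -- Two orthogonal vectors of equal length in the plane differ by a quarter turn; the sign of the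
  -- turn is their determinant divided by the squared length.
  refine ⟨(α * β' - β * α') / n, ?_, ?_, ?_⟩
  · rw [div_pow, div_eq_one_iff_eq (pow_ne_zero 2 hn)]
    linear_combination α' ^ 2 * h + β' ^ 2 * h + n * h' - (α * α' + β * β') * h0
  · field_simp
    linear_combination -α' * h + α * h0
  · field_simp
    linear_combination -β' * h + β * h0

/-- An adapted frame in terms of a real frame. -/
theorem IsAdaptedFrame.exists_rotation (hV : Module.finrank ℝ V = 4) {g : LinearMap.BilinForm ℝ V}
    {F : Fin 4 → V} {m : ℝ} (hm : m ≠ 0) (hF : ∀ i j, g (F i) (F j) = m * frameForm i j) {ρ : ℝ}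
    (hρ : ρ ≠ 0) {e : Fin 4 → ℂ ⊗[ℝ] V} (he : IsAdaptedFrame g (ρ • F 3) e) :
    ∃ α β γ γ' ε : ℝ, α ^ 2 + β ^ 2 ≠ 0 ∧ ε ^ 2 = 1 ∧
      e 1 = (1 : ℂ) ⊗ₜ[ℝ] (α • F 0 + β • F 1 + γ • F 3)
        - Complex.I ⊗ₜ[ℝ] (-(ε * β) • F 0 + (ε * α) • F 1 + γ' • F 3) := by
  obtain ⟨h3, h1, -, hG⟩ := he
  obtain ⟨u, v, huv⟩ := exists_eq_tmul_add (e 0)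
  have h1' : e 1 = (1 : ℂ) ⊗ₜ[ℝ] u - Complex.I ⊗ₜ[ℝ] v := by
    rw [h1, huv, map_add, conjTensor_tmul, conjTensor_tmul, map_one, Complex.conj_I,
      TensorProduct.neg_tmul, sub_eq_add_neg]
  obtain ⟨k, hk⟩ := eq_sum_of_gram hV hm hF u
  obtain ⟨l, hl⟩ := eq_sum_of_gram hV hm hF v
  have g03 := hG 0 3
  have g00 := hG 0 0
  have g01 := hG 0 1
  rw [h3, huv] at g03
  rw [huv] at g00
  rw [huv, h1'] at g01
  simp only [map_add, map_sub, LinearMap.add_apply, baseChange_apply] at g03 g00 g01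
  have guu : g u u = m * (1 / 2 * (k 0 ^ 2 + k 1 ^ 2) + 2 * k 2 * k 3) := by
    rw [hk]
    simp [hF, frameForm]
    ring
  have gvv : g v v = m * (1 / 2 * (l 0 ^ 2 + l 1 ^ 2) + 2 * l 2 * l 3) := by
    rw [hl]
    simp [hF, frameForm]
    ring
  have guv : g u v = m * (1 / 2 * (k 0 * l 0 + k 1 * l 1) + k 2 * l 3 + k 3 * l 2) := by
    rw [hk, hl]
    simp [hF, frameForm]
    ring
  have gvu : g v u = m * (1 / 2 * (k 0 * l 0 + k 1 * l 1) + k 2 * l 3 + k 3 * l 2) := by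
    rw [hk, hl]
    simp [hF, frameForm]
    ring
  have gu3 : g u (ρ • F 3) = ρ * (m * k 2) := by
    rw [map_smul, smul_eq_mul, hk]
    congr 1
    simp [hF, frameForm]
    ring
  have gv3 : g v (ρ • F 3) = ρ * (m * l 2) := by
    rw [map_smul, smul_eq_mul, hl]
    congr 1
    simp [hF, frameForm]
    ring
  rw [gu3, gv3] at g03
  rw [guu, gvv, guv, gvu] at g00 g01
  -- Orthogonality to e₄ excludes a component along F 2, the only frame vector not orthogonal to F
  -- 3.
  have hk2 : k 2 = 0 := by simpa [hρ, hm] using congrArg Complex.re g03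
  have hl2 : l 2 = 0 := by simpa [hρ, hm] using congrArg Complex.im g03
  rw [hk2, hl2] at g00 g01
  have r00 := congrArg Complex.re g00
  have i00 := congrArg Complex.im g00
  have r01 := congrArg Complex.re g01
  simp only [Complex.add_re, Complex.add_im, Complex.sub_re, Complex.mul_re, Complex.mul_im,
    Complex.I_re, Complex.I_im, Complex.ofReal_re, Complex.ofReal_im, Complex.one_re,
    Complex.one_im, Matrix.of_apply, Matrix.cons_val, Complex.zero_re, Complex.zero_im]
    at r00 i00 r01
  have hn : k 0 ^ 2 + k 1 ^ 2 = 1 / m := by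
    field_simp
    linarith
  have hn' : l 0 ^ 2 + l 1 ^ 2 = 1 / m := by
    field_simp
    linarith
  have h0 : k 0 * l 0 + k 1 * l 1 = 0 := by
    refine (mul_eq_zero.1 (?_ : m * (k 0 * l 0 + k 1 * l 1) = 0)).resolve_left hm
    linarith
  -- Nullity of e₁ makes the screen parts of its real and imaginary parts orthogonal and equally
  -- long, and g(e₁, e₂) = 1 fixes the length. Both orientations of the screen remain possible,
  -- whence ε = ±1.
  obtain ⟨ε, hε, e0, e1⟩ := _root_.exists_rotation (one_div_ne_zero hm) hn hn' h0
  refine ⟨k 0, k 1, k 3, l 3, ε, by rw [hn]; exact one_div_ne_zero hm, hε, ?_⟩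
  rw [h1', hk, hl, hk2, hl2, e0, e1, zero_smul, add_zero, add_zero]

section

variable {F : Fin 4 → V} {R : LinearMap.BilinForm ℝ V} {α β γ γ' ε : ℝ} {e₁ : ℂ ⊗[ℝ] V}

/-- Modulo F 3 the vector is (α + iεβ)(F 0 - iε F 1), so the component is ρ(α + iεβ)(R₀₃ - iε R₁₃).
As R is real, the sign ε does not affect its vanishing. -/
theorem baseChange_e₂_e₄ (hε : ε ^ 2 = 1) (hn : α ^ 2 + β ^ 2 ≠ 0) {ρ : ℝ} (hρ : ρ ≠ 0)
    (he : e₁ = (1 : ℂ) ⊗ₜ[ℝ] (α • F 0 + β • F 1 + γ • F 3)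
        - Complex.I ⊗ₜ[ℝ] (-(ε * β) • F 0 + (ε * α) • F 1 + γ' • F 3))
    (hVV : R (F 3) (F 3) = 0) :
    LinearMap.BilinForm.baseChange ℂ R e₁ ((1 : ℂ) ⊗ₜ[ℝ] (ρ • F 3)) = 0 ↔
      R (F 0) (F 3) = 0 ∧ R (F 1) (F 3) = 0 := by
  have h : LinearMap.BilinForm.baseChange ℂ R e₁ ((1 : ℂ) ⊗ₜ[ℝ] (ρ • F 3)) =
      ((ρ * (α * R (F 0) (F 3) + β * R (F 1) (F 3)) : ℝ) : ℂ)
        - ((ρ * ε * (α * R (F 1) (F 3) - β * R (F 0) (F 3)) : ℝ) : ℂ) * Complex.I := by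
    rw [he]
    simp only [map_sub, LinearMap.sub_apply, baseChange_apply, map_add, map_smul,
      LinearMap.add_apply, LinearMap.smul_apply, smul_eq_mul, hVV]
    push_cast
    ring
  rw [h]
  constructor
  · intro h0
    have hr := congrArg Complex.re h0
    have hi := congrArg Complex.im h0
    have hε0 : ε ≠ 0 := fun h => by simp [h] at hε
    simp [-Complex.ofReal_mul, hρ, hε0] at hr hi
    constructor
    · refine (mul_eq_zero.1 (?_ : (α ^ 2 + β ^ 2) * R (F 0) (F 3) = 0)).resolve_left hn
      linear_combination α * hr - β * hi
    · refine (mul_eq_zero.1 (?_ : (α ^ 2 + β ^ 2) * R (F 1) (F 3) = 0)).resolve_left hn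
      linear_combination β * hr + α * hi
  · rintro ⟨h1, h2⟩
    simp [h1, h2]

/-- Once the components involving F 3 are gone, the value is (α + iεβ)² (S - iεN), with S and N as
set in the proof, and the prefactor is non-zero. -/
theorem baseChange_e₂_e₂ (hε : ε ^ 2 = 1) (hn : α ^ 2 + β ^ 2 ≠ 0)
    (he : e₁ = (1 : ℂ) ⊗ₜ[ℝ] (α • F 0 + β • F 1 + γ • F 3)
        - Complex.I ⊗ₜ[ℝ] (-(ε * β) • F 0 + (ε * α) • F 1 + γ' • F 3))
    (hVV : R (F 3) (F 3) = 0) (h0 : R (F 0) (F 3) = 0) (h0' : R (F 3) (F 0) = 0)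
    (h1 : R (F 1) (F 3) = 0) (h1' : R (F 3) (F 1) = 0) :
    LinearMap.BilinForm.baseChange ℂ R e₁ e₁ = 0 ↔
      R (F 0) (F 0) - R (F 1) (F 1) = 0 ∧ R (F 0) (F 1) + R (F 1) (F 0) = 0 := by
  set S := R (F 0) (F 0) - R (F 1) (F 1) with hS
  set N := R (F 0) (F 1) + R (F 1) (F 0) with hN
  have h : LinearMap.BilinForm.baseChange ℂ R e₁ e₁ =
      (((α ^ 2 - β ^ 2) * S + 2 * α * β * N : ℝ) : ℂ)
        - ((ε * ((α ^ 2 - β ^ 2) * N - 2 * α * β * S) : ℝ) : ℂ) * Complex.I := by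
    rw [he, hS, hN]
    simp only [map_sub, LinearMap.sub_apply, baseChange_apply, map_add, map_smul,
      LinearMap.add_apply, LinearMap.smul_apply, smul_eq_mul, hVV, h0, h0', h1, h1']
    have hεc : (ε : ℂ) ^ 2 = 1 := by exact_mod_cast hε
    push_cast
    linear_combination (Complex.I ^ 2 * (β ^ 2 * R (F 0) (F 0) - α * β * (R (F 0) (F 1)
      + R (F 1) (F 0)) + α ^ 2 * R (F 1) (F 1))) * hεc + (β ^ 2 * R (F 0) (F 0)
      - α * β * (R (F 0) (F 1) + R (F 1) (F 0)) + α ^ 2 * R (F 1) (F 1)) * Complex.I_sq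
  rw [h]
  constructor
  · intro hz
    have hr := congrArg Complex.re hz
    have hi := congrArg Complex.im hz
    have hε0 : ε ≠ 0 := fun h => by simp [h] at hε
    simp only [Complex.sub_re, Complex.sub_im, Complex.ofReal_re, Complex.ofReal_im,
      Complex.mul_re, Complex.mul_im, Complex.I_re, Complex.I_im, Complex.zero_re,
      Complex.zero_im] at hr hi
    have hi' : (α ^ 2 - β ^ 2) * N - 2 * α * β * S = 0 :=
      (mul_eq_zero.1 (by linarith)).resolve_left hε0
    constructor
    · refine (mul_eq_zero.1 (?_ : (α ^ 2 + β ^ 2) ^ 2 * S = 0)).resolve_left (pow_ne_zero 2 hn)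
      linear_combination (α ^ 2 - β ^ 2) * hr - 2 * α * β * hi'
    · refine (mul_eq_zero.1 (?_ : (α ^ 2 + β ^ 2) ^ 2 * N = 0)).resolve_left (pow_ne_zero 2 hn)
      linear_combination (α ^ 2 - β ^ 2) * hi' + 2 * α * β * hr
  · rintro ⟨h1, h2⟩
    simp [h1, h2]

end

end AdaptedFrames

/-! ### The standard frame, and Ricci components in an arbitrary adapted frame. -/

section StandardFrame

variable {M : Type*} [TopologicalSpace M] [ChartedSpace (EuclideanSpace ℝ (Fin 3)) M]
  [IsManifold (𝓡 3) ∞ M] {C : CRStructure M} {η : DistinguishedCoframe C}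

omit [IsManifold (𝓡 3) ∞ M] in
theorem finrank_tangentSpace_lineModel (q : M × ℝ) :
    Module.finrank ℝ (TangentSpace lineModel q) = 4 := by
  change Module.finrank ℝ (EuclideanSpace ℝ (Fin 3) × ℝ) = 4
  simp

/-- A real frame gives a complex adapted frame. -/
theorem isAdaptedFrame_of_gram {V : Type*} [AddCommGroup V] [Module ℝ V]
    {g : LinearMap.BilinForm ℝ V} {F : Fin 4 → V} {m : ℝ} (hm : m ≠ 0)
    (hF : ∀ i j, g (F i) (F j) = m ^ 2 * frameForm i j) :
    IsAdaptedFrame g (m⁻¹ • F 3) ![(m⁻¹ : ℂ) • ((1 : ℂ) ⊗ₜ[ℝ] F 0 - Complex.I ⊗ₜ[ℝ] F 1),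
      (m⁻¹ : ℂ) • ((1 : ℂ) ⊗ₜ[ℝ] F 0 + Complex.I ⊗ₜ[ℝ] F 1), (1 : ℂ) ⊗ₜ[ℝ] (m⁻¹ • F 2),
      (1 : ℂ) ⊗ₜ[ℝ] (m⁻¹ • F 3)] := by
  have hmc : (m : ℂ) ≠ 0 := by exact_mod_cast hm
  have e : ∀ (z : ℂ) (v : V), (m⁻¹ : ℂ) • (z ⊗ₜ[ℝ] v) = ((m⁻¹ : ℂ) * z) ⊗ₜ[ℝ] v := fun z v => rfl
  refine ⟨rfl, ?_, ?_, fun i j => ?_⟩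
  · simp only [Matrix.cons_val, smul_sub, smul_add, e, map_sub, conjTensor_tmul, map_mul,
      map_inv₀, Complex.conj_ofReal, Complex.conj_I, map_one, mul_neg, TensorProduct.neg_tmul,
      sub_neg_eq_add]
  · simp [conjTensor_tmul]
  · fin_cases i <;> fin_cases j <;>
      simp [-LinearMap.BilinForm.baseChange_tmul, baseChange_apply, hF, frameForm] <;>
      field_simp <;> norm_num

namespace QuasiFefferman

variable {U : Set (M × ℝ)} (D : QuasiFefferman η U)

theorem standardFrame_eq (q : M × ℝ) : D.standardFrame q =
    ![((D.P q)⁻¹ : ℂ) • ((1 : ℂ) ⊗ₜ[ℝ] D.realFrame q 0 - Complex.I ⊗ₜ[ℝ] D.realFrame q 1),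
      ((D.P q)⁻¹ : ℂ) • ((1 : ℂ) ⊗ₜ[ℝ] D.realFrame q 0 + Complex.I ⊗ₜ[ℝ] D.realFrame q 1),
      (1 : ℂ) ⊗ₜ[ℝ] ((D.P q)⁻¹ • D.realFrame q 2),
      (1 : ℂ) ⊗ₜ[ℝ] ((D.P q)⁻¹ • D.realFrame q 3)] := by
  have hW : ∀ z : ℂ, z ⊗ₜ[ℝ] vertical q =
      (1 : ℂ) ⊗ₜ[ℝ] (z.re • vertical q) + Complex.I ⊗ₜ[ℝ] (z.im • vertical q) := by
    intro z
    rw [← TensorProduct.smul_tmul, ← TensorProduct.smul_tmul, ← TensorProduct.add_tmul]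
    congr 1
    apply Complex.ext <;> simp
  have h0 : (horizontal q).baseChange ℂ (η.del q.1) - D.W q ⊗ₜ[ℝ] vertical q =
      (1 : ℂ) ⊗ₜ[ℝ] D.realFrame q 0 - Complex.I ⊗ₜ[ℝ] D.realFrame q 1 := by
    rw [hW, DistinguishedCoframe.del]
    simp only [map_sub, LinearMap.baseChange_tmul, realFrame, Matrix.cons_val,
      TensorProduct.tmul_sub, TensorProduct.tmul_add]
    abel
  have h1 : (horizontal q).baseChange ℂ (η.delbar q.1)
      - (starRingEnd ℂ) (D.W q) ⊗ₜ[ℝ] vertical q =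
      (1 : ℂ) ⊗ₜ[ℝ] D.realFrame q 0 + Complex.I ⊗ₜ[ℝ] D.realFrame q 1 := by
    rw [hW, DistinguishedCoframe.delbar]
    simp only [map_add, LinearMap.baseChange_tmul, realFrame, Matrix.cons_val,
      TensorProduct.tmul_sub, TensorProduct.tmul_add, Complex.conj_re, Complex.conj_im, neg_smul,
      TensorProduct.tmul_neg]
    abel
  rw [standardFrame, h0, h1]
  rfl

theorem isAdaptedFrame_standardFrame {q : M × ℝ} (hq : q ∈ U) :
    IsAdaptedFrame (D.metric q) ((D.P q)⁻¹ • vertical q) (D.standardFrame q) := by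
  rw [standardFrame_eq]
  exact isAdaptedFrame_of_gram (D.P_ne_zero q hq) (D.metric_realFrame q)

variable {D}

theorem ofReal_sub_I_mul_eq_zero {a b : ℝ} : (a : ℂ) - Complex.I * b = 0 ↔ a = 0 ∧ b = 0 := by
  constructor
  · intro h
    have hr := congrArg Complex.re h
    have hi := congrArg Complex.im h
    simp at hr hi
    exact ⟨hr, hi⟩
  · rintro ⟨rfl, rfl⟩
    simp

theorem ofReal_add_I_ne_zero (τ : ℝ) : (τ : ℂ) + Complex.I ≠ 0 := fun h => by
  simpa using congrArg Complex.im h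

theorem one_add_I_mul_ne_zero (τ : ℝ) : 1 + Complex.I * (τ : ℂ) ≠ 0 := fun h => by
  simpa using congrArg Complex.re h

section Components

variable {ζ : M → ℂ} (hζ : ContMDiff (𝓡 3) 𝓘(ℝ, ℂ) ∞ ζ)
  (hμ : ∀ p, η.mu p = differential (𝓡 3) ζ p) (hU : IsOpen U) {q : M × ℝ} (hq : q ∈ U) {ρ : ℝ}
  {e : Fin 4 → ℂ ⊗[ℝ] TangentSpace lineModel q} (hρ : ρ ≠ 0)
  (he : IsAdaptedFrame (D.metric q) (ρ • vertical q) e)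

include hζ hμ hU hq hρ he in
theorem ricciComponent_33 : D.ricciComponent q e 3 3 = 0 ↔
    1 / 2 - 2 * deriv (deriv fun r => Real.log (D.P (q.1, r))) q.2
      + 2 * deriv (fun r => Real.log (D.P (q.1, r))) q.2 ^ 2 = 0 := by
  rw [← ricci_vertical hζ hμ hU hq, ricciComponent, ricciC, he.1, baseChange_apply, map_smul,
    LinearMap.map_smul₂, smul_eq_mul, smul_eq_mul]
  simp [hρ]

variable {a s : M → ℝ} (h : D.HasProfile a s) (ha : ∀ p, a p ≠ 0)

include hζ hμ hU hq hρ he h ha in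
-- The fibre variable enters only through the factor tan((r+s)/2) + i, which has imaginary part 1;
-- removing it leaves a condition at the base point.
theorem ricciComponent_13
    (hV : ricciTensor lineModel D.metric q (vertical q) (vertical q) = 0) :
    D.ricciComponent q e 1 3 = 0 ↔ D.profileEq a s q.1 = -(2 * η.c q.1 / 3) := by
  obtain ⟨α, β, γ, γ', ε, hn, hε, h1⟩ := he.exists_rotation (finrank_tangentSpace_lineModel q)
    (pow_ne_zero 2 (D.P_ne_zero q hq)) (D.metric_realFrame q) hρ
  rw [ricciComponent, ricciC, he.1]
  refine (baseChange_e₂_e₄ (F := D.realFrame q) hε hn hρ h1 hV).trans ?_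
  refine ofReal_sub_I_mul_eq_zero.symm.trans ?_
  have h2 := ricci_e₁_V h ha hζ hμ hU hq
  change (ricciTensor lineModel D.metric q (D.realFrame q 0) (vertical q) : ℂ)
      - Complex.I * ricciTensor lineModel D.metric q (D.realFrame q 1) (vertical q) = 0 ↔ _
  rw [h2, mul_eq_zero, mul_eq_zero, or_iff_right, eq_neg_iff_add_eq_zero]
  exact not_or.2 ⟨by norm_num, ofReal_add_I_ne_zero _⟩

include hζ hμ hU hq hρ he h ha in
-- The equation of (ii) is needed on all of M, not only at the base point, because the formula for
-- Ric(A-iB, A-iB) differentiates it.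
theorem ricciComponent_11
    (hV : ricciTensor lineModel D.metric q (vertical q) (vertical q) = 0)
    (heq : ∀ p, D.profileEq a s p = -(2 * η.c p / 3)) :
    D.ricciComponent q e 1 1 = 0 ↔
      η.d (η.t D.x a s) q.1 + η.t D.x a s q.1 * (η.c q.1 - η.t D.x a s q.1) = 0 := by
  obtain ⟨α, β, γ, γ', ε, hn, hε, h1⟩ := he.exists_rotation (finrank_tangentSpace_lineModel q)
    (pow_ne_zero 2 (D.P_ne_zero q hq)) (D.metric_realFrame q) hρ
  have h2 := ricci_e₁_V h ha hζ hμ hU hq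
  rw [heq q.1, neg_add_cancel, mul_zero, ofReal_sub_I_mul_eq_zero] at h2
  have h3 := ricci_vertical_comm (D := D) hζ hμ hU hq
  rw [ricciComponent, ricciC]
  refine (baseChange_e₂_e₂ (F := D.realFrame q) hε hn h1 hV h2.1 (h3.1.trans h2.1) h2.2
    (h3.2.trans h2.2)).trans ?_
  refine ofReal_sub_I_mul_eq_zero.symm.trans ?_
  rw [ricci_e₁_e₁ h ha hζ hμ hU heq hq, mul_eq_zero, or_iff_right]
  exact neg_ne_zero.2 (one_add_I_mul_ne_zero _)

end Components

end QuasiFefferman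

end StandardFrame

/-! ### Change of distinguished frame by the factor e^{-τ-iθ}. -/

section FrameChange

theorem tmul_sub_injective {V : Type*} [AddCommGroup V] [Module ℝ V] {a b a' b' : V}
    (h : (1 : ℂ) ⊗ₜ[ℝ] a - Complex.I ⊗ₜ[ℝ] b = (1 : ℂ) ⊗ₜ[ℝ] a' - Complex.I ⊗ₜ[ℝ] b') :
    a = a' ∧ b = b' := by
  have hr := congrArg (fun t => TensorProduct.lid ℝ V (LinearMap.rTensor V Complex.reLm t)) h
  have hi := congrArg (fun t => TensorProduct.lid ℝ V (LinearMap.rTensor V Complex.imLm t)) h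
  simp at hr hi
  exact ⟨hr, hi⟩

variable {M : Type*} [TopologicalSpace M] [ChartedSpace (EuclideanSpace ℝ (Fin 3)) M]

theorem differential_comp_prod {F : Type*} [NormedAddCommGroup F] [NormedSpace ℝ F] {τ θ : M → ℝ}
    {p : M} (hτ : MDifferentiableAt (𝓡 3) 𝓘(ℝ, ℝ) τ p)
    (hθ : MDifferentiableAt (𝓡 3) 𝓘(ℝ, ℝ) θ p) {f : ℝ × ℝ → F} {f' : ℝ × ℝ →L[ℝ] F}
    (hf : HasFDerivAt f f' (τ p, θ p)) :
    MDifferentiableAt (𝓡 3) 𝓘(ℝ, F) (fun p => f (τ p, θ p)) p ∧ ∀ v,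
      differential (𝓡 3) (fun p => f (τ p, θ p)) p v =
        f' (differential (𝓡 3) τ p v, differential (𝓡 3) θ p v) := by
  have h0 : HasMFDerivAt (𝓡 3) 𝓘(ℝ, ℝ × ℝ) (fun p => (τ p, θ p)) p
      ((mfderiv (𝓡 3) 𝓘(ℝ, ℝ) τ p).prod (mfderiv (𝓡 3) 𝓘(ℝ, ℝ) θ p)) :=
    ⟨hτ.continuousAt.prodMk hθ.continuousAt, hτ.hasMFDerivAt.2.prodMk hθ.hasMFDerivAt.2⟩
  have h := HasMFDerivAt.comp (g := f) (f := fun p => (τ p, θ p)) p hf.hasMFDerivAt h0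
  refine ⟨h.mdifferentiableAt, fun v => ?_⟩
  exact congrArg (fun L => L v) h.mfderiv

variable [IsManifold (𝓡 3) ∞ M]

theorem mlieBracket_combination {X Y : ∀ p : M, TangentSpace (𝓡 3) p} {a b c d : M → ℝ} {p : M}
    (hX : MDifferentiableAt (𝓡 3) (𝓡 3).tangent (fun p => (⟨p, X p⟩ : TangentBundle (𝓡 3) M)) p)
    (hY : MDifferentiableAt (𝓡 3) (𝓡 3).tangent (fun p => (⟨p, Y p⟩ : TangentBundle (𝓡 3) M)) p)
    (ha : MDifferentiableAt (𝓡 3) 𝓘(ℝ, ℝ) a p) (hb : MDifferentiableAt (𝓡 3) 𝓘(ℝ, ℝ) b p)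
    (hc : MDifferentiableAt (𝓡 3) 𝓘(ℝ, ℝ) c p) (hd : MDifferentiableAt (𝓡 3) 𝓘(ℝ, ℝ) d p) :
    mlieBracket (𝓡 3) (a • X + b • Y) (c • X + d • Y) p =
      (a p * d p - b p * c p) • mlieBracket (𝓡 3) X Y p
      + (a p * differential (𝓡 3) c p (X p) + b p * differential (𝓡 3) c p (Y p)
        - c p * differential (𝓡 3) a p (X p) - d p * differential (𝓡 3) a p (Y p)) • X p
      + (a p * differential (𝓡 3) d p (X p) + b p * differential (𝓡 3) d p (Y p)
        - c p * differential (𝓡 3) b p (X p) - d p * differential (𝓡 3) b p (Y p)) • Y p := by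
  have haX := ha.smul_section hX
  have hbY := hb.smul_section hY
  have hcX := hc.smul_section hX
  have hdY := hd.smul_section hY
  rw [mlieBracket_add_left haX hbY, mlieBracket_add_right hcX hdY, mlieBracket_add_right hcX hdY,
    mlieBracket_smul_right hc hX, mlieBracket_smul_right hd hY, mlieBracket_smul_right hc hX,
    mlieBracket_smul_right hd hY, mlieBracket_smul_left ha hX, mlieBracket_smul_left ha hX,
    mlieBracket_smul_left hb hY, mlieBracket_smul_left hb hY, mlieBracket_self, mlieBracket_self,
    mlieBracket_swap_apply (V := Y) (W := X)]
  have e : ∀ (f : M → ℝ) (v : TangentSpace (𝓡 3) p),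
      mvfderiv (𝓡 3) f p v = differential (𝓡 3) f p v := fun f v => rfl
  simp only [Pi.smul_apply', map_smul, e, Pi.zero_apply, smul_zero, smul_eq_mul]
  module

variable {C : CRStructure M} {η η' : DistinguishedCoframe C} {τ θ : M → ℝ}

/-- The real part of `e^{-τ-iθ}`. -/
noncomputable def scaleRe (τ θ : M → ℝ) (p : M) : ℝ := Real.exp (-τ p) * Real.cos (θ p)

/-- The imaginary part of `e^{-τ-iθ}`. -/
noncomputable def scaleIm (τ θ : M → ℝ) (p : M) : ℝ := -(Real.exp (-τ p) * Real.sin (θ p))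

omit [ChartedSpace (EuclideanSpace ℝ (Fin 3)) M] [IsManifold (𝓡 3) ∞ M] [TopologicalSpace M] in
theorem exp_scale (τ θ : M → ℝ) (p : M) : Complex.exp (-(τ p : ℂ) - Complex.I * θ p) =
    scaleRe τ θ p + Complex.I * scaleIm τ θ p := by
  rw [show -(τ p : ℂ) - Complex.I * θ p = ((-τ p : ℝ) : ℂ) + ((-θ p : ℝ) : ℂ) * Complex.I by
    push_cast; ring, Complex.exp_add, Complex.exp_mul_I, scaleRe, scaleIm]
  push_cast
  rw [Complex.cos_neg, Complex.sin_neg]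
  ring

omit [ChartedSpace (EuclideanSpace ℝ (Fin 3)) M] [IsManifold (𝓡 3) ∞ M] [TopologicalSpace M] in
theorem scale_sq (τ θ : M → ℝ) (p : M) :
    scaleRe τ θ p ^ 2 + scaleIm τ θ p ^ 2 = Real.exp (-(2 * τ p)) := by
  rw [scaleRe, scaleIm, show -(2 * τ p) = -τ p + -τ p by ring, Real.exp_add]
  linear_combination Real.exp (-τ p) ^ 2 * Real.cos_sq_add_sin_sq (θ p)

omit [IsManifold (𝓡 3) ∞ M] in
theorem differential_scale {p : M} (hτ : MDifferentiableAt (𝓡 3) 𝓘(ℝ, ℝ) τ p)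
    (hθ : MDifferentiableAt (𝓡 3) 𝓘(ℝ, ℝ) θ p) :
    (MDifferentiableAt (𝓡 3) 𝓘(ℝ, ℝ) (scaleRe τ θ) p ∧
      ∀ v, differential (𝓡 3) (scaleRe τ θ) p v = -scaleRe τ θ p * differential (𝓡 3) τ p v
        + scaleIm τ θ p * differential (𝓡 3) θ p v) ∧
    MDifferentiableAt (𝓡 3) 𝓘(ℝ, ℝ) (scaleIm τ θ) p ∧
      ∀ v, differential (𝓡 3) (scaleIm τ θ) p v = -scaleIm τ θ p * differential (𝓡 3) τ p v
        - scaleRe τ θ p * differential (𝓡 3) θ p v := by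
  have h1 : HasFDerivAt (fun z : ℝ × ℝ => Real.exp (-z.1) * Real.cos z.2) _ (τ p, θ p) :=
    (hasFDerivAt_fst.neg.exp).mul hasFDerivAt_snd.cos
  have h2 : HasFDerivAt (fun z : ℝ × ℝ => -(Real.exp (-z.1) * Real.sin z.2)) _ (τ p, θ p) :=
    ((hasFDerivAt_fst.neg.exp).mul hasFDerivAt_snd.sin).neg
  have k1 := differential_comp_prod hτ hθ h1
  have k2 := differential_comp_prod hτ hθ h2
  refine ⟨⟨k1.1, fun v => (k1.2 v).trans ?_⟩, k2.1, fun v => (k2.2 v).trans ?_⟩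
  · simp [scaleRe, scaleIm]
    ring
  · simp [scaleRe, scaleIm]
    ring

namespace DistinguishedCoframe

theorem frame_change
    (hdel : ∀ p, η'.del p = Complex.exp (-(τ p : ℂ) - Complex.I * θ p) • η.del p) :
    η'.X = scaleRe τ θ • η.X + scaleIm τ θ • η.Y ∧
      η'.Y = (-scaleIm τ θ) • η.X + scaleRe τ θ • η.Y := by
  have h : ∀ p, η'.X p = scaleRe τ θ p • η.X p + scaleIm τ θ p • η.Y p ∧
      η'.Y p = -scaleIm τ θ p • η.X p + scaleRe τ θ p • η.Y p := by
    intro p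
    refine tmul_sub_injective ((hdel p).trans ?_)
    have e : ∀ (r : ℝ) (v : TangentSpace (𝓡 3) p) (z : ℂ), z ⊗ₜ[ℝ] (r • v) = (r * z) ⊗ₜ[ℝ] v :=
      fun r v z => by rw [← TensorProduct.smul_tmul, Complex.real_smul]
    have e' : ∀ (w z : ℂ) (v : TangentSpace (𝓡 3) p), w • (z ⊗ₜ[ℝ] v) = (w * z) ⊗ₜ[ℝ] v :=
      fun w z v => rfl
    rw [exp_scale, del, smul_sub, e', e', TensorProduct.tmul_add, TensorProduct.tmul_add, e, e, e, e,
      add_sub_add_comm, ← TensorProduct.sub_tmul, ← TensorProduct.sub_tmul, sub_eq_add_neg,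
      ← TensorProduct.neg_tmul]
    congr 2
    · push_cast
      ring
    · linear_combination -(scaleIm τ θ p : ℂ) * Complex.I_sq
  exact ⟨funext fun p => (h p).1, funext fun p => (h p).2⟩

/-- In complex form this is ∂₀' = e^{-2τ}(∂₀ - h∂ - h̄∂̄); the corrections come from differentiating
the scale factor in the bracket. -/
theorem del0_change (hτ : ContMDiff (𝓡 3) 𝓘(ℝ, ℝ) ∞ τ) (hθ : ContMDiff (𝓡 3) 𝓘(ℝ, ℝ) ∞ θ)
    (hdel : ∀ p, η'.del p = Complex.exp (-(τ p : ℂ) - Complex.I * θ p) • η.del p) (p : M) :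
    η'.del0 p = (scaleRe τ θ p ^ 2 + scaleIm τ θ p ^ 2) • (η.del0 p
      - (2 * (differential (𝓡 3) θ p (η.X p) + differential (𝓡 3) τ p (η.Y p))) • η.X p
      - (2 * (differential (𝓡 3) θ p (η.Y p) - differential (𝓡 3) τ p (η.X p))) • η.Y p) := by
  have hd := differential_scale ((hτ p).mdifferentiableAt (by simp))
    ((hθ p).mdifferentiableAt (by simp))
  have hneg : MDifferentiableAt (𝓡 3) 𝓘(ℝ, ℝ) (-scaleIm τ θ) p ∧
      ∀ v, differential (𝓡 3) (-scaleIm τ θ) p v = -differential (𝓡 3) (scaleIm τ θ) p v := by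
    have h := hd.2.1.hasMFDerivAt.neg
    exact ⟨h.mdifferentiableAt, fun v => congrArg (fun L => L v) h.mfderiv⟩
  obtain ⟨hX, hY⟩ := frame_change hdel
  rw [del0, hX, hY, mlieBracket_combination ((η.contMDiff_X p).mdifferentiableAt (by simp))
    ((η.contMDiff_Y p).mdifferentiableAt (by simp)) hd.1.1 hd.2.1 hneg.1 hd.1.1, del0]
  simp only [hneg.2, hd.1.2, hd.2.2, Pi.neg_apply]
  module

end DistinguishedCoframe

end FrameChange

/-! ### Independence of trigonometric functions, and the change of coframe. -/

section Transformation

/-- Differentiating twice gives three equations at one point; the two derivatives form a rotation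
applied to (p, q). -/
theorem trig_eq_zero_on_open {S : Set ℝ} (hS : IsOpen S) (hne : S.Nonempty) {k p q : ℝ}
    (h : ∀ r ∈ S, k + p * Real.cos r + q * Real.sin r = 0) : k = 0 ∧ p = 0 ∧ q = 0 := by
  have h1 : ∀ r ∈ S, -p * Real.sin r + q * Real.cos r = 0 := by
    intro r hr
    have hd : HasDerivAt (fun r => k + p * Real.cos r + q * Real.sin r)
        (p * -Real.sin r + q * Real.cos r) r :=
      (((Real.hasDerivAt_cos r).const_mul p).const_add k).add ((Real.hasDerivAt_sin r).const_mul q)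
    have h0 := hd.congr_of_eventuallyEq (f₁ := fun _ => (0 : ℝ))
      (Filter.eventually_of_mem (hS.mem_nhds hr) fun t ht => (h t ht).symm)
    linarith [h0.unique (hasDerivAt_const r (0 : ℝ))]
  have h2 : ∀ r ∈ S, -p * Real.cos r - q * Real.sin r = 0 := by
    intro r hr
    have hd : HasDerivAt (fun r => -p * Real.sin r + q * Real.cos r)
        (-p * Real.cos r + q * -Real.sin r) r :=
      ((Real.hasDerivAt_sin r).const_mul (-p)).add ((Real.hasDerivAt_cos r).const_mul q)
    have h0 := hd.congr_of_eventuallyEq (f₁ := fun _ => (0 : ℝ))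
      (Filter.eventually_of_mem (hS.mem_nhds hr) fun t ht => (h1 t ht).symm)
    linarith [h0.unique (hasDerivAt_const r (0 : ℝ))]
  obtain ⟨r, hr⟩ := hne
  have e0 := h r hr
  have e1 := h1 r hr
  have e2 := h2 r hr
  have e3 := Real.sin_sq_add_cos_sq r
  refine ⟨by linarith, ?_, ?_⟩
  · linear_combination -Real.sin r * e1 - Real.cos r * e2 - p * e3
  · linear_combination Real.cos r * e1 - Real.sin r * e2 - q * e3

theorem mul_exp_eq_on_open {S : Set ℝ} (hS : IsOpen S) (hne : S.Nonempty) {A B : ℂ}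
    (h : ∀ r ∈ S, A * Complex.exp (-(Complex.I * (r : ℂ))) = B) : A = 0 ∧ B = 0 := by
  have e : ∀ r : ℝ, Complex.exp (-(Complex.I * (r : ℂ))) =
      (Real.cos r : ℂ) - Complex.I * (Real.sin r : ℂ) := by
    intro r
    rw [show -(Complex.I * (r : ℂ)) = (-(r : ℂ)) * Complex.I by ring, Complex.exp_mul_I,
      Complex.cos_neg, Complex.sin_neg, Complex.ofReal_cos, Complex.ofReal_sin]
    ring
  have h1 : ∀ r ∈ S, -B.re + A.re * Real.cos r + A.im * Real.sin r = 0 := by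
    intro r hr
    have := congrArg Complex.re ((e r ▸ h r hr :))
    simp [-Complex.ofReal_cos, -Complex.ofReal_sin] at this
    linarith
  have h2 : ∀ r ∈ S, -B.im + A.im * Real.cos r + -A.re * Real.sin r = 0 := by
    intro r hr
    have := congrArg Complex.im ((e r ▸ h r hr :))
    simp [-Complex.ofReal_cos, -Complex.ofReal_sin] at this
    linarith
  obtain ⟨b1, a1, a2⟩ := trig_eq_zero_on_open hS hne h1
  obtain ⟨b2, -, -⟩ := trig_eq_zero_on_open hS hne h2
  exact ⟨Complex.ext a1 a2, Complex.ext (by simpa using b1) (by simpa using b2)⟩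

/-- Since 2cos²((r+α)/2) = 1 + cos(r+α), coefficients of 1, cos r, sin r can be compared. The phases
are determined modulo 2π only, which is all that e^{is} sees. -/
theorem cos_sq_profile_unique {S : Set ℝ} (hS : IsOpen S) (hne : S.Nonempty) {b b' α β : ℝ}
    (hb : b ≠ 0)
    (h : ∀ r ∈ S, b * Real.cos ((r + α) / 2) ^ 2 = b' * Real.cos ((r + β) / 2) ^ 2) :
    b = b' ∧ Complex.exp (Complex.I * α) = Complex.exp (Complex.I * β) := by
  obtain ⟨h0, h1, h2⟩ := trig_eq_zero_on_open hS hne (k := b - b')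
    (p := b * Real.cos α - b' * Real.cos β) (q := b' * Real.sin β - b * Real.sin α) (by
      intro r hr
      have h3 := h r hr
      rw [Real.cos_sq, Real.cos_sq, mul_div_cancel₀ _ two_ne_zero, mul_div_cancel₀ _ two_ne_zero,
        Real.cos_add, Real.cos_add] at h3
      linear_combination 2 * h3)
  have h3 : b' = b := by linarith
  subst h3
  refine ⟨rfl, ?_⟩
  have hc : Real.cos α = Real.cos β := mul_left_cancel₀ hb (by linarith)
  have hs : Real.sin α = Real.sin β := mul_left_cancel₀ hb (by linarith)
  rw [mul_comm, mul_comm Complex.I, Complex.exp_mul_I, Complex.exp_mul_I, ← Complex.ofReal_cos,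
    ← Complex.ofReal_cos, ← Complex.ofReal_sin, ← Complex.ofReal_sin, hc, hs]

variable {M : Type*} [TopologicalSpace M] [ChartedSpace (EuclideanSpace ℝ (Fin 3)) M]

/-- The derivative of a change of fibre coordinate on horizontal vectors. -/
theorem mfderiv_fibre_change {θ : M → ℝ} {q : M × ℝ}
    (hθ : MDifferentiableAt (𝓡 3) 𝓘(ℝ, ℝ) θ q.1) (k : ℝ) (w : TangentSpace (𝓡 3) q.1) :
    mfderiv lineModel lineModel (fun q : M × ℝ => (q.1, q.2 - k * θ q.1)) q (horizontal q w) =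
      horizontal (q.1, q.2 - k * θ q.1) w
        - (k * differential (𝓡 3) θ q.1 w) • vertical (q.1, q.2 - k * θ q.1) := by
  have h1 : HasMFDerivAt lineModel (𝓡 3) (Prod.fst : M × ℝ → M) q _ := hasMFDerivAt_fst q
  have h2 : HasMFDerivAt lineModel 𝓘(ℝ, ℝ) (Prod.snd : M × ℝ → ℝ) q _ := hasMFDerivAt_snd q
  have h3 := (hθ.hasMFDerivAt.comp q h1).const_smul k
  have h4 := h1.prodMk (h2.sub h3)
  rw [horizontal_sub_smul_vertical, horizontal_apply]
  refine (congrArg (fun L => L ((w, 0) : EuclideanSpace ℝ (Fin 3) × ℝ)) h4.mfderiv).trans ?_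
  refine Prod.ext rfl ?_
  change (0 : ℝ) - k * _ = - _
  rw [zero_sub]
  rfl

variable [IsManifold (𝓡 3) ∞ M] {C : CRStructure M} {η η' : DistinguishedCoframe C} {τ θ : M → ℝ}

namespace DistinguishedCoframe

theorem d_change (hdel : ∀ p, η'.del p = Complex.exp (-(τ p : ℂ) - Complex.I * θ p) • η.del p)
    (f : M → ℂ) (p : M) :
    η'.d f p = Complex.exp (-(τ p : ℂ) - Complex.I * θ p) * η.d f p := by
  rw [d, hdel, cderiv, map_smul]
  rfl

/-- As τ and θ are real, this is h̄ = ∂θ + i∂τ, the form in which h enters the comparison of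
metrics. -/
theorem conj_h (hτ : ContMDiff (𝓡 3) 𝓘(ℝ, ℝ) ∞ τ) (hθ : ContMDiff (𝓡 3) 𝓘(ℝ, ℝ) ∞ θ) (p : M) :
    (starRingEnd ℂ) (η.h τ θ p) =
      ((differential (𝓡 3) θ p (η.X p) : ℂ) - Complex.I * differential (𝓡 3) θ p (η.Y p))
      + Complex.I *
        ((differential (𝓡 3) τ p (η.X p) : ℂ) - Complex.I * differential (𝓡 3) τ p (η.Y p)) := by
  have hf : HasFDerivAt (fun z : ℝ × ℝ => (z.1 : ℂ) + Complex.I * (z.2 : ℂ))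
      (Complex.ofRealCLM.comp (ContinuousLinearMap.fst ℝ ℝ ℝ)
        + Complex.I • Complex.ofRealCLM.comp (ContinuousLinearMap.snd ℝ ℝ ℝ)) (τ p, θ p) :=
    (Complex.ofRealCLM.comp (ContinuousLinearMap.fst ℝ ℝ ℝ)
        + Complex.I • Complex.ofRealCLM.comp (ContinuousLinearMap.snd ℝ ℝ ℝ)).hasFDerivAt
  have h := (differential_comp_prod ((hτ p).mdifferentiableAt (by simp))
    ((hθ p).mdifferentiableAt (by simp)) hf).2
  have e : η.h τ θ p = -Complex.I * (differential (𝓡 3) (fun p => (τ p : ℂ) + Complex.I * θ p) p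
      (η.X p) + Complex.I *
      differential (𝓡 3) (fun p => (τ p : ℂ) + Complex.I * θ p) p (η.Y p)) := by
    simp [DistinguishedCoframe.h, dbar, cderiv, delbar]
  rw [e, h, h]
  simp
  linear_combination (Complex.I * (differential (𝓡 3) θ p (η.Y p) : ℂ)
    - differential (𝓡 3) θ p (η.X p)) * Complex.I_sq

theorem d_sub_two_mul {φ : M → ℝ} (hφ : ContMDiff (𝓡 3) 𝓘(ℝ, ℝ) ∞ φ)
    (hτ : ContMDiff (𝓡 3) 𝓘(ℝ, ℝ) ∞ τ) (p : M) :
    η.d (fun p => ((φ p - 2 * τ p : ℝ) : ℂ)) p = η.d (fun p => (φ p : ℂ)) p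
      - 2 * ((differential (𝓡 3) τ p (η.X p) : ℂ)
        - Complex.I * differential (𝓡 3) τ p (η.Y p)) := by
  have hd : ∀ k : ℝ, ∀ v, differential (𝓡 3) (fun p => ((φ p - k * τ p : ℝ) : ℂ)) p v =
      (differential (𝓡 3) φ p v : ℂ) - k * differential (𝓡 3) τ p v := by
    intro k v
    have hf : HasFDerivAt (fun z : ℝ × ℝ => ((z.1 - k * z.2 : ℝ) : ℂ))
        (Complex.ofRealCLM.comp (ContinuousLinearMap.fst ℝ ℝ ℝ
          - k • ContinuousLinearMap.snd ℝ ℝ ℝ)) (φ p, τ p) :=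
      (Complex.ofRealCLM.comp (ContinuousLinearMap.fst ℝ ℝ ℝ
          - k • ContinuousLinearMap.snd ℝ ℝ ℝ)).hasFDerivAt
    rw [(differential_comp_prod ((hφ p).mdifferentiableAt (by simp))
      ((hτ p).mdifferentiableAt (by simp)) hf).2]
    simp
  have h0 : ∀ v, differential (𝓡 3) (fun p => (φ p : ℂ)) p v = (differential (𝓡 3) φ p v : ℂ) := by
    intro v
    have := hd 0 v
    simpa using this
  rw [d_eq, d_eq, hd, hd, h0, h0]
  push_cast
  ring

/-- The new coframe evaluated on the old frame. -/
theorem coframe_change (hτ : ContMDiff (𝓡 3) 𝓘(ℝ, ℝ) ∞ τ) (hθ : ContMDiff (𝓡 3) 𝓘(ℝ, ℝ) ∞ θ)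
    (hdel : ∀ p, η'.del p = Complex.exp (-(τ p : ℂ) - Complex.I * θ p) • η.del p) (p : M) :
    (((scaleRe τ θ p ^ 2 + scaleIm τ θ p ^ 2 : ℝ) : ℂ) * η'.mu p (η.X p) =
        (scaleRe τ θ p - Complex.I * scaleIm τ θ p) / 2) ∧
    (((scaleRe τ θ p ^ 2 + scaleIm τ θ p ^ 2 : ℝ) : ℂ) * η'.mu p (η.Y p) =
        (scaleIm τ θ p + Complex.I * scaleRe τ θ p) / 2) ∧
    (η'.mu p (η.del0 p) =
      ((2 * (differential (𝓡 3) θ p (η.X p) + differential (𝓡 3) τ p (η.Y p)) : ℝ) : ℂ)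
        * η'.mu p (η.X p)
      + ((2 * (differential (𝓡 3) θ p (η.Y p) - differential (𝓡 3) τ p (η.X p)) : ℝ) : ℂ)
        * η'.mu p (η.Y p)) ∧
    η'.lam p (η.X p) = 0 ∧ η'.lam p (η.Y p) = 0 ∧
    (scaleRe τ θ p ^ 2 + scaleIm τ θ p ^ 2) * η'.lam p (η.del0 p) = 1 := by
  obtain ⟨hX, hY⟩ := frame_change hdel
  have hX' : η'.X p = scaleRe τ θ p • η.X p + scaleIm τ θ p • η.Y p := congrFun hX p
  have hY' : η'.Y p = -scaleIm τ θ p • η.X p + scaleRe τ θ p • η.Y p := congrFun hY p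
  have hT := del0_change hτ hθ hdel p
  have hn : scaleRe τ θ p ^ 2 + scaleIm τ θ p ^ 2 ≠ 0 := by
    rw [scale_sq]
    exact (Real.exp_pos _).ne'
  have m1 := η'.mu_X p
  have m2 := η'.mu_Y p
  have m3 := η'.mu_del0 p
  have l1 := η'.lam_X p
  have l2 := η'.lam_Y p
  have l3 := η'.lam_del0 p
  rw [hX'] at m1 l1
  rw [hY'] at m2 l2
  rw [hT] at m3 l3
  simp only [map_add, map_sub, map_smul, smul_eq_mul, Complex.real_smul] at m1 m2 m3 l1 l2 l3
  -- The change of frame is a rotation times a scaling. It is inverted by the transposed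
  -- combination, at the cost of the factor `scaleRe² + scaleIm²`.
  have k1 : η'.lam p (η.X p) = 0 := mul_left_cancel₀ hn (by
    linear_combination scaleRe τ θ p * l1 - scaleIm τ θ p * l2)
  have k2 : η'.lam p (η.Y p) = 0 := mul_left_cancel₀ hn (by
    linear_combination scaleIm τ θ p * l1 + scaleRe τ θ p * l2)
  refine ⟨?_, ?_, ?_, k1, k2, ?_⟩
  · push_cast at m1 m2 ⊢
    linear_combination (scaleRe τ θ p : ℂ) * m1 - (scaleIm τ θ p : ℂ) * m2
  · push_cast at m1 m2 ⊢
    linear_combination (scaleIm τ θ p : ℂ) * m1 + (scaleRe τ θ p : ℂ) * m2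
  · rcases mul_eq_zero.1 m3 with h | h
    · exact absurd (Complex.ofReal_eq_zero.1 h) hn
    · linear_combination h
  · rw [k1, k2] at l3
    linear_combination l3

end DistinguishedCoframe

end Transformation

/-! ### Comparison of the parameters of one metric in two coframes. -/

section Transformation

/-- Three components suffice: (X, X) determines the conformal factor, and (X, ∂₀), (Y, ∂₀) the real
and imaginary parts of W. Here a, b are the derivatives of θ and c, d those of τ along X, Y; u + iv
is the scale factor. -/
theorem metric_comparison {u v P P' k a b c d lT : ℝ} {W W' mX mY : ℂ} (hn : u ^ 2 + v ^ 2 ≠ 0)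
    (hP : P ≠ 0) (m1 : ((u ^ 2 + v ^ 2 : ℝ) : ℂ) * mX = (u - Complex.I * v) / 2)
    (m2 : ((u ^ 2 + v ^ 2 : ℝ) : ℂ) * mY = (v + Complex.I * u) / 2)
    (l3 : (u ^ 2 + v ^ 2) * lT = 1)
    (hXX : P ^ 2 = 4 * P' ^ 2 * (mX.re ^ 2 + mX.im ^ 2))
    (hXT : P ^ 2 * W.re = 2 * P' ^ 2 * (mX.re * (2 * (a + d) * mX.re + 2 * (b - c) * mY.re)
      + mX.im * (2 * (a + d) * mX.im + 2 * (b - c) * mY.im)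
      + (2 * (W'.re * mX.re - W'.im * mX.im) - k * a) * lT / 2))
    (hYT : -(P ^ 2 * W.im) = 2 * P' ^ 2 * (mY.re * (2 * (a + d) * mX.re + 2 * (b - c) * mY.re)
      + mY.im * (2 * (a + d) * mX.im + 2 * (b - c) * mY.im)
      + (2 * (W'.re * mY.re - W'.im * mY.im) - k * b) * lT / 2)) :
    P' ^ 2 = (u ^ 2 + v ^ 2) * P ^ 2 ∧ ((u : ℂ) + Complex.I * v) * W = W' + (u + Complex.I * v) *
      ((a - Complex.I * b) + Complex.I * (c - Complex.I * d) - k * (a - Complex.I * b)) := by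
  have r1 : mX.re = u / (2 * (u ^ 2 + v ^ 2)) := by
    have := congrArg Complex.re m1
    rw [Complex.re_ofReal_mul] at this
    simp at this
    field_simp
    linarith
  have i1 : mX.im = -v / (2 * (u ^ 2 + v ^ 2)) := by
    have := congrArg Complex.im m1
    rw [Complex.im_ofReal_mul] at this
    simp at this
    field_simp
    linarith
  have r2 : mY.re = v / (2 * (u ^ 2 + v ^ 2)) := by
    have := congrArg Complex.re m2
    rw [Complex.re_ofReal_mul] at this
    simp at this
    field_simp
    linarith
  have i2 : mY.im = u / (2 * (u ^ 2 + v ^ 2)) := by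
    have := congrArg Complex.im m2
    rw [Complex.im_ofReal_mul] at this
    simp at this
    field_simp
    linarith
  have e3 : lT = 1 / (u ^ 2 + v ^ 2) := by
    field_simp
    linarith
  rw [r1, i1] at hXX
  rw [r1, i1, r2, i2, e3] at hXT hYT
  have hPP : P' ^ 2 = (u ^ 2 + v ^ 2) * P ^ 2 := by
    rw [hXX]
    field_simp
    ring
  refine ⟨hPP, ?_⟩
  rw [hPP] at hXT hYT
  have hP2 : P ^ 2 ≠ 0 := pow_ne_zero 2 hP
  have f1 : (u ^ 2 + v ^ 2) * W.re =
      (u ^ 2 + v ^ 2) * (a + d - k * a) + (u * W'.re + v * W'.im) := by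
    refine mul_left_cancel₀ hP2 ?_
    rw [mul_left_comm, hXT]
    field_simp
    ring
  have f2 : -((u ^ 2 + v ^ 2) * W.im) =
      (u ^ 2 + v ^ 2) * (b - c - k * b) + (v * W'.re - u * W'.im) := by
    refine mul_left_cancel₀ hP2 ?_
    rw [mul_neg, mul_left_comm, ← mul_neg, hYT]
    field_simp
    ring
  refine Complex.ext (mul_left_cancel₀ hn ?_) (mul_left_cancel₀ hn ?_)
  · simp [-mul_eq_mul_left_iff]
    linear_combination u * f1 + v * f2
  · simp [-mul_eq_mul_left_iff]
    linear_combination v * f1 - u * f2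

variable {M : Type*} [TopologicalSpace M] [ChartedSpace (EuclideanSpace ℝ (Fin 3)) M]
  [IsManifold (𝓡 3) ∞ M] {C : CRStructure M} {η η' : DistinguishedCoframe C} {τ θ : M → ℝ}

namespace QuasiFefferman

variable {U U' : Set (M × ℝ)} {D : QuasiFefferman η U} {D' : QuasiFefferman η' U'} {k : ℝ}

/-- The metric in the new trivialisation on horizontal vectors. -/
theorem metric_fibre_change (hθ : ContMDiff (𝓡 3) 𝓘(ℝ, ℝ) ∞ θ) {q : M × ℝ}
    (hg : D.metric q = (D'.metric (q.1, q.2 - k * θ q.1)).compl₁₂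
      (mfderiv lineModel lineModel (fun q : M × ℝ => (q.1, q.2 - k * θ q.1)) q).toLinearMap
      (mfderiv lineModel lineModel (fun q : M × ℝ => (q.1, q.2 - k * θ q.1)) q).toLinearMap)
    (v w : TangentSpace (𝓡 3) q.1) :
    D.metric q (horizontal q v) (horizontal q w) =
      2 * D'.P (q.1, q.2 - k * θ q.1) ^ 2 * ((η'.mu q.1 v).re * (η'.mu q.1 w).re
      + (η'.mu q.1 v).im * (η'.mu q.1 w).im
      + (η'.lam q.1 v * (2 * (D'.W (q.1, q.2 - k * θ q.1) * η'.mu q.1 w).re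
          + D'.H (q.1, q.2 - k * θ q.1) * η'.lam q.1 w - k * differential (𝓡 3) θ q.1 w)
        + (2 * (D'.W (q.1, q.2 - k * θ q.1) * η'.mu q.1 v).re
          + D'.H (q.1, q.2 - k * θ q.1) * η'.lam q.1 v - k * differential (𝓡 3) θ q.1 v)
          * η'.lam q.1 w) / 2) := by
  have hΦ := fun w => mfderiv_fibre_change ((hθ q.1).mdifferentiableAt (by simp)) k w
  refine (congrArg (fun B => B (horizontal q v) (horizontal q w)) hg).trans ?_
  refine (congrArg₂ (fun a b => D'.metric (q.1, q.2 - k * θ q.1) a b) (hΦ v) (hΦ w)).trans ?_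
  rw [metric_apply]
  simp only [map_sub, map_smul, mu_horizontal, mu_vertical, lam_horizontal, lam_vertical,
    kappa_horizontal, kappa_vertical, smul_zero, sub_zero, smul_eq_mul, mul_one, mul_zero]

theorem parameters_change (hτ : ContMDiff (𝓡 3) 𝓘(ℝ, ℝ) ∞ τ) (hθ : ContMDiff (𝓡 3) 𝓘(ℝ, ℝ) ∞ θ)
    (hdel : ∀ p, η'.del p = Complex.exp (-(τ p : ℂ) - Complex.I * θ p) • η.del p) {q : M × ℝ}
    (hq : q ∈ U)
    (hg : D.metric q = (D'.metric (q.1, q.2 - k * θ q.1)).compl₁₂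
      (mfderiv lineModel lineModel (fun q : M × ℝ => (q.1, q.2 - k * θ q.1)) q).toLinearMap
      (mfderiv lineModel lineModel (fun q : M × ℝ => (q.1, q.2 - k * θ q.1)) q).toLinearMap) :
    D'.P (q.1, q.2 - k * θ q.1) ^ 2 = Real.exp (-(2 * τ q.1)) * D.P q ^ 2 ∧
    Complex.exp (-(τ q.1 : ℂ) - Complex.I * θ q.1) * D.W q = D'.W (q.1, q.2 - k * θ q.1)
      + Complex.exp (-(τ q.1 : ℂ) - Complex.I * θ q.1) * ((starRingEnd ℂ) (η.h τ θ q.1)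
      - k * ((differential (𝓡 3) θ q.1 (η.X q.1) : ℂ)
        - Complex.I * differential (𝓡 3) θ q.1 (η.Y q.1))) := by
  have hXX := metric_fibre_change hθ hg (η.X q.1) (η.X q.1)
  have hXT := metric_fibre_change hθ hg (η.X q.1) (η.del0 q.1)
  have hYT := metric_fibre_change hθ hg (η.Y q.1) (η.del0 q.1)
  obtain ⟨m1, m2, m3, l1, l2, l3⟩ := DistinguishedCoframe.coframe_change hτ hθ hdel q.1
  rw [metric_apply] at hXX hXT hYT
  simp only [mu_horizontal, lam_horizontal, kappa_horizontal, η.mu_X, η.mu_Y, η.mu_del0, η.lam_X,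
    η.lam_Y, η.lam_del0, l1, l2, m3] at hXX hXT hYT
  rw [DistinguishedCoframe.conj_h hτ hθ, exp_scale, ← scale_sq τ θ]
  have hn : scaleRe τ θ q.1 ^ 2 + scaleIm τ θ q.1 ^ 2 ≠ 0 := by
    rw [scale_sq]
    exact (Real.exp_pos _).ne'
  have hP := D.P_ne_zero q hq
  refine metric_comparison hn hP m1 m2 l3 ?_ ?_ ?_
  · simp at hXX
    linear_combination 2 * hXX
  · simp at hXT
    linear_combination hXT
  · simp at hYT
    linear_combination hYT

end QuasiFefferman

end Transformation

/-! ### The transformation of t, and the theorem. -/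

section Main

variable {M : Type*} [TopologicalSpace M] [ChartedSpace (EuclideanSpace ℝ (Fin 3)) M]
  [IsManifold (𝓡 3) ∞ M] {C : CRStructure M} {η η' : DistinguishedCoframe C} {τ θ : M → ℝ}

namespace QuasiFefferman

variable {U U' : Set (M × ℝ)} {D : QuasiFefferman η U} {D' : QuasiFefferman η' U'}

/-- The invariant `t` under a change of distinguished coframe. -/
theorem t_change (hτ : ContMDiff (𝓡 3) 𝓘(ℝ, ℝ) ∞ τ) (hθ : ContMDiff (𝓡 3) 𝓘(ℝ, ℝ) ∞ θ)
    (hdel : ∀ p, η'.del p = Complex.exp (-(τ p : ℂ) - Complex.I * θ p) • η.del p)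
    (hU : IsOpen U) (hfib : ∀ p : M, IsConnected {r : ℝ | (p, r) ∈ U})
    (hUU' : ∀ q ∈ U, (q.1, q.2 - 2 / 3 * θ q.1) ∈ U')
    (hg : ∀ q ∈ U, D.metric q = (D'.metric (q.1, q.2 - 2 / 3 * θ q.1)).compl₁₂
      (mfderiv lineModel lineModel (fun q : M × ℝ => (q.1, q.2 - 2 / 3 * θ q.1)) q).toLinearMap
      (mfderiv lineModel lineModel (fun q : M × ℝ => (q.1, q.2 - 2 / 3 * θ q.1)) q).toLinearMap)
    {a s a' s' : M → ℝ} (h : D.HasProfile a s) (h' : D'.HasProfile a' s') (p : M) :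
    η'.t D'.x a' s' p = Complex.exp (-(τ p : ℂ) - Complex.I * θ p) *
      (η.t D.x a s p - Complex.I * (starRingEnd ℂ) (η.h τ θ p)) := by
  have ha := h.ne_zero hfib
  have hpar := fun p r (hr : (p, r) ∈ U) => parameters_change hτ hθ hdel hr (hg (p, r) hr)
  -- Only P² is known to transform, so the squared profiles are compared. The shift of r moves the
  -- phase of the new profile to s' - (2/3) θ.
  have hprof : ∀ p, Real.exp (-(2 * τ p)) * a p ^ 2 = a' p ^ 2 ∧
      Complex.exp (Complex.I * (s' p - 2 / 3 * θ p : ℝ)) = Complex.exp (Complex.I * s p) := by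
    intro p
    refine (cos_sq_profile_unique (isOpen_fibre hU p) (hfib p).nonempty
      (mul_ne_zero (Real.exp_pos _).ne' (pow_ne_zero 2 (ha p))) fun r hr => ?_)
    obtain ⟨c1, e1⟩ := h.2.2 _ hr
    obtain ⟨c2, e2⟩ := h'.2.2 _ (hUU' _ hr)
    have e3 := (hpar p r hr).1
    simp only [e1, e2] at e3
    simp only at c1 c2
    rw [show r - 2 / 3 * θ p + s' p = r + (s' p - 2 / 3 * θ p) by ring] at e3 c2
    rw [div_pow, div_pow, ← mul_div_assoc, div_eq_div_iff (pow_ne_zero 2 c2)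
      (pow_ne_zero 2 c1)] at e3
    exact e3.symm
  have hlog : (fun p => ((Real.log (a' p ^ 2) : ℝ) : ℂ)) =
      fun p => ((Real.log (a p ^ 2) - 2 * τ p : ℝ) : ℂ) := by
    funext p
    rw [← (hprof p).1, Real.log_mul (Real.exp_pos _).ne' (pow_ne_zero 2 (ha p)), Real.log_exp]
    congr 1
    ring
  have hexp : Complex.exp (Complex.I * s' p) =
      Complex.exp (Complex.I * s p) * Complex.exp (Complex.I * (2 / 3 * θ p)) := by
    rw [← (hprof p).2, ← Complex.exp_add]
    congr 1
    push_cast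
    ring
  set f := Complex.exp (-(τ p : ℂ) - Complex.I * θ p) with hf
  -- The relation between W and W' holds for all r in an open interval; its e^{-ir} part gives the
  -- rule for x, its constant part the rule for c.
  have hW := mul_exp_eq_on_open (isOpen_fibre hU p) (hfib p).nonempty
    (A := Complex.I * (f * D.x p - D'.x p * Complex.exp (Complex.I * (2 / 3 * θ p))))
    (B := Complex.I / 3 * (f * η.c p - η'.c p) + f * ((starRingEnd ℂ) (η.h τ θ p)
      - 2 / 3 * ((differential (𝓡 3) θ p (η.X p) : ℂ)
        - Complex.I * differential (𝓡 3) θ p (η.Y p)))) (by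
      intro r hr
      have h2 := (hpar p r hr).2
      simp only [W, ← hf] at h2
      have h3 : Complex.exp (-(Complex.I * ((r - 2 / 3 * θ p : ℝ) : ℂ))) =
          Complex.exp (-(Complex.I * r)) * Complex.exp (Complex.I * (2 / 3 * θ p)) := by
        rw [← Complex.exp_add]
        congr 1
        push_cast
        ring
      rw [h3] at h2
      push_cast at h2
      linear_combination h2)
  obtain ⟨hx, hc⟩ := hW
  have hx' : f * D.x p = D'.x p * Complex.exp (Complex.I * (2 / 3 * θ p)) := by
    have := (mul_eq_zero.1 hx).resolve_left Complex.I_ne_zero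
    linear_combination this
  rw [DistinguishedCoframe.t, DistinguishedCoframe.t, DistinguishedCoframe.d_change hdel, ← hf, hlog,
    DistinguishedCoframe.d_sub_two_mul (contMDiff_real_log_sq h.1 ha) hτ, hexp]
  rw [DistinguishedCoframe.conj_h hτ hθ] at hc ⊢
  -- With f the scale factor, c' = f(c - 3i h̄ + 2i ∂θ), ∂' log a'² = f(∂ log a² - 2∂τ) and x'
  -- e^{is'} = f x e^{is}. The shift 2/3 of the fibre coordinate is what makes 2i ∂θ - 2∂τ equal to
  -- 2i h̄, leaving -i h̄.
  linear_combination (3 * Complex.I) * hc + Complex.exp (Complex.I * s p) * hx'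
    + (η'.c p - 2 * f * ((differential (𝓡 3) τ p (η.X p) : ℂ)
      - Complex.I * differential (𝓡 3) τ p (η.Y p)) - f * η.c p) * Complex.I_sq

end QuasiFefferman

end Main

theorem mainTheorem3 {M : Type*} [TopologicalSpace M]
    [ChartedSpace (EuclideanSpace ℝ (Fin 3)) M] [IsManifold (𝓡 3) ∞ M]
    (C : CRStructure M) (η : DistinguishedCoframe C)
    -- `ζ` is a CR function with `μ = dζ`
    (ζ : M → ℂ) (hζ : ContMDiff (𝓡 3) 𝓘(ℝ, ℂ) ∞ ζ) (hCR : ∀ p, η.dbar ζ p = 0)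
    (hμ : ∀ p, η.mu p = differential (𝓡 3) ζ p)
    -- the domain of the metric is open, and its fibres over `M` are non-empty intervals
    (U : Set (M × ℝ)) (hU : IsOpen U)
    (hfib : ∀ p : M, IsConnected {r : ℝ | (p, r) ∈ U})
    (D : QuasiFefferman η U) :
    -- the standard frame is an adapted frame
    (∀ q ∈ U, IsAdaptedFrame (D.metric q) ((D.P q)⁻¹ • vertical q) (D.standardFrame q)) ∧
    -- the Ricci components with respect to any adapted frame
    (∀ (ρ : M × ℝ → ℝ) (e : ∀ q : M × ℝ, Fin 4 → ℂ ⊗[ℝ] TangentSpace lineModel q),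
      (∀ q ∈ U, ρ q ≠ 0 ∧ IsAdaptedFrame (D.metric q) (ρ q • vertical q) (e q)) →
      -- (i)
      ((∀ q ∈ U, D.ricciComponent q (e q) 3 3 = 0) ↔ ∃ a s : M → ℝ, D.HasProfile a s) ∧
      ∀ a s : M → ℝ, D.HasProfile a s →
        -- (ii)
        ((∀ q ∈ U, D.ricciComponent q (e q) 1 3 = 0) ↔
          ∀ p, η.d (fun p' => ((Real.log (a p' ^ 2) : ℝ) : ℂ)) p
            + Complex.I * η.d (fun p' => (s p' : ℂ)) p
            - 2 * D.x p * Complex.exp (Complex.I * s p) = -(2 * η.c p / 3)) ∧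
        -- (iii)
        ((∀ q ∈ U, D.ricciComponent q (e q) 1 3 = 0) →
          ((∀ q ∈ U, D.ricciComponent q (e q) 1 1 = 0) ↔
            ∀ p, η.d (η.t D.x a s) p
              + η.t D.x a s p * (η.c p - η.t D.x a s p) = 0))) ∧
    -- the transformation of `t` when the same metric is written in another distinguished coframe
    (∀ (η' : DistinguishedCoframe C) (τ θ : M → ℝ),
      ContMDiff (𝓡 3) 𝓘(ℝ, ℝ) ∞ τ → ContMDiff (𝓡 3) 𝓘(ℝ, ℝ) ∞ θ →
      (∀ p, η'.del p = Complex.exp (-(τ p : ℂ) - Complex.I * θ p) • η.del p) →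
      ∀ D' : QuasiFefferman η' {q : M × ℝ | (q.1, q.2 + 2 / 3 * θ q.1) ∈ U},
        -- `D'` is the metric of `D` after the change of fibre coordinate `r' = r - (2/3) θ`
        (∀ q ∈ U, D.metric q =
          (D'.metric (q.1, q.2 - 2 / 3 * θ q.1)).compl₁₂
            (mfderiv lineModel lineModel (fun q : M × ℝ => (q.1, q.2 - 2 / 3 * θ q.1)) q).toLinearMap
            (mfderiv lineModel lineModel
              (fun q : M × ℝ => (q.1, q.2 - 2 / 3 * θ q.1)) q).toLinearMap) →
        ∀ a s a' s' : M → ℝ, D.HasProfile a s → D'.HasProfile a' s' →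
          ∀ p, η'.t D'.x a' s' p =
            Complex.exp (-(τ p : ℂ) - Complex.I * θ p) *
              (η.t D.x a s p - Complex.I * (starRingEnd ℂ) (η.h τ θ p))) := by
  have hfibU : ∀ p : M, ∃ r : ℝ, (p, r) ∈ U := fun p => (hfib p).nonempty
  refine ⟨fun q hq => D.isAdaptedFrame_standardFrame hq, fun ρ e he => ⟨?_, fun a s h => ?_⟩, ?_⟩
  · rw [← QuasiFefferman.vertical_equation_iff hU hfib]
    exact forall₂_congr fun q hq =>
      QuasiFefferman.ricciComponent_33 hζ hμ hU hq (he q hq).1 (he q hq).2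
  · have ha := h.ne_zero hfib
    have hV : ∀ q ∈ U, ricciTensor lineModel D.metric q (vertical q) (vertical q) = 0 := by
      intro q hq
      rw [QuasiFefferman.ricci_vertical hζ hμ hU hq]
      exact (QuasiFefferman.vertical_equation_iff hU hfib).2 ⟨a, s, h⟩ q hq
    have h13 : (∀ q ∈ U, D.ricciComponent q (e q) 1 3 = 0) ↔
        ∀ p, D.profileEq a s p = -(2 * η.c p / 3) := by
      have h0 := fun q hq => QuasiFefferman.ricciComponent_13 hζ hμ hU hq (he q hq).1 (he q hq).2 h
        ha (hV q hq)
      refine ⟨fun hR p => ?_, fun hR q hq => (h0 q hq).2 (hR q.1)⟩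
      -- The condition does not involve r, so any point of the non-empty fibre gives it at `p`.
      obtain ⟨r, hr⟩ := hfibU p
      exact (h0 _ hr).1 (hR _ hr)
    refine ⟨h13, fun hR => ?_⟩
    have h0 := fun q hq => QuasiFefferman.ricciComponent_11 hζ hμ hU hq (he q hq).1 (he q hq).2 h
      ha (hV q hq) (h13.1 hR)
    refine ⟨fun hR' p => ?_, fun hR' q hq => (h0 q hq).2 (hR' q.1)⟩
    obtain ⟨r, hr⟩ := hfibU p
    exact (h0 _ hr).1 (hR' _ hr)
  · intro η' τ θ hτ hθ hdel D' hg a s a' s' h h' p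
    refine QuasiFefferman.t_change hτ hθ hdel hU hfib (fun q hq => ?_) hg h h' p
    simpa using hq
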